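/- Work in ZFC. For a set $A$, let $L_0[A]=\emptyset$, let $L_{\xi+1}[A]$ be the set of all subsets of $L_\xi[A]$ that are first-order definable with parameters over the structure $(L_\xi[A],\in,A\cap L_\xi[A])$, let $L_\xi[A]=\bigcup_{\eta<\xi}L_\eta[A]$ for limit ordinals $\xi$, and let $L[A]=\bigcup_{\xi}L_\xi[A]$. **Lemma.** Suppose that $\kappa$ is an (infinite) regular cardinal, that $A\subseteq\kappa$, and that $V=L[A]$, i.e. every set belongs to $L[A]$. Then the structure $(L_\kappa[A],\in,A\cap L_\kappa[A])$ is a Jónsson algebra of cardinality $\kappa$: it has cardinality $\kappa$, and every elementary substructure of it which has cardinality $\kappa$ is equal to the whole structure. Consequently $\kappa$ is not a Jónsson cardinal: it is not the case that every first-order structure in a countable language with universe $\kappa$ has an elementary substructure whose universe $A'$ satisfies $|A'|=\kappa$ and $A'\neq\kappa$. -/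

import Mathlib

open Cardinal

universe u

namespace RelConstr

/-- The relation symbols of the language of set theory with one additional unary predicate. -/
inductive SetPredRel : ℕ → Type
  | pred : SetPredRel 1
  | mem : SetPredRel 2

/-- The first-order language `{∈, Ȧ}`: a binary relation symbol and a unary predicate symbol. -/
def setPredLang : FirstOrder.Language.{0, 0} where
  Functions := fun _ => Empty
  Relations := SetPredRel

/-- The set `M`, regarded as the universe of the structure `(M, ∈, A ∩ M)`. -/
def PredModel (_A M : ZFSet.{u}) : Type (u + 1) :=
  {x : ZFSet.{u} // x ∈ M}

/-- The structure `(M, ∈, A ∩ M)`. -/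
instance (A M : ZFSet.{u}) : setPredLang.Structure (PredModel A M) where
  funMap := fun f => Empty.elim f
  RelMap := fun r v =>
    match r with
    | SetPredRel.pred => (v 0).1 ∈ A
    | SetPredRel.mem => (v 0).1 ∈ (v 1).1

/-- `Def_A(M)`: the set of all subsets of `M` that are first-order definable, with parameters
from `M`, over the structure `(M, ∈, A ∩ M)`. -/
noncomputable def defPowerset (A M : ZFSet.{u}) : ZFSet.{u} :=
  ZFSet.sep
    (fun x => Set.Definable₁ (Set.univ : Set (PredModel A M)) setPredLang
      {y : PredModel A M | y.1 ∈ x})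
    (ZFSet.powerset M)

/-- The hierarchy `L_ξ[A]` of sets constructible from the predicate `A`:
`L_0[A] = ∅`, `L_{ξ+1}[A] = Def_A(L_ξ[A])`, and `L_ξ[A] = ⋃ η < ξ, L_η[A]` for `ξ` a limit. -/
noncomputable def L (A : ZFSet.{u}) (ξ : Ordinal.{u}) : ZFSet.{u} :=
  Ordinal.limitRecOn (motive := fun _ => ZFSet.{u}) ξ
    ∅
    (fun _ M => defPowerset A M)
    (fun ξ _ Lη => ZFSet.iUnion (fun η : Set.Iio ξ => Lη η.1 η.2))

theorem L_zero (A : ZFSet.{u}) : L A 0 = ∅ := by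
  simp [L]

theorem L_add_one (A : ZFSet.{u}) (ξ : Ordinal.{u}) : L A (ξ + 1) = defPowerset A (L A ξ) := by
  unfold L
  rw [Ordinal.limitRecOn_add_one]

theorem L_limit (A : ZFSet.{u}) (ξ : Ordinal.{u}) (h : Order.IsSuccLimit ξ) :
    L A ξ = ZFSet.iUnion (fun η : Set.Iio ξ => L A η.1) := by
  unfold L
  rw [Ordinal.limitRecOn_limit _ _ _ _ h]

/-- `V = L[A]`: every set belongs to some `L_ξ[A]`. -/
def UniverseEqL (A : ZFSet.{u}) : Prop :=
  ∀ x : ZFSet.{u}, ∃ ξ : Ordinal.{u}, x ∈ L A ξ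

/-- The structure `(L_ξ[A], ∈, A ∩ L_ξ[A])`. -/
abbrev LModel (A : ZFSet.{u}) (ξ : Ordinal.{u}) : Type (u + 1) :=
  PredModel A (L A ξ)

end RelConstr

/-- A first-order structure is a Jónsson algebra if it has no proper elementary substructure of
the same cardinality as the whole structure. -/
def IsJonssonAlgebra (L : FirstOrder.Language) (M : Type*) [L.Structure M] : Prop :=
  ∀ X : L.ElementarySubstructure M, #X = #M → X = ⊤

/-- A cardinal `κ` is Jónsson if every first-order structure in a countable language with universe
`κ` has an elementary substructure whose universe has cardinality `κ` but is different
from `κ`. -/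
def IsJonssonCardinal (κ : Cardinal.{u}) : Prop :=
  ∀ (L : FirstOrder.Language.{0, 0}) [Countable L.Symbols] [L.Structure κ.ord.ToType],
    ∃ X : L.ElementarySubstructure κ.ord.ToType, #X = κ ∧ X ≠ ⊤

/-! Let κ be uncountable and M = L_κ[A]. Call a subset X of M bad (`IsBad`) if it is proper,
contained in no element of M, and closed under the Gödel operations, under choosing an element of
each nonempty member, and under finding a code of a level around each member. The range of an
elementary embedding into M that is not onto, and that is contained in no set of fewer than κ
elements, is bad (`isBad_of_elementaryEmbedding`). It remains to see that there are no bad sets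
(`not_isBad`).

Otherwise let m be the least element of M, in the canonical well-order, that is omitted by some bad
set X. By condensation X collapses to a level N of height κ built from the image B of A, and
inverting the collapse gives a cofinal embedding j of N into M that preserves bounded formulas and
has values in X (`IsBad.exists_emb`). Since V = L[A], X lies in the level of A of height d for some
regular d > κ. Now j is stretched to the level of B of height d by an extender ultrapower: its
points are functions from that level paired with seeds a in M, and a measures Z in N by whether a ∈
j Z. The needed sets are measured because a subset of an element of N that is constructed before d
is already in N (`mem_lev_of_subset_lev`, the argument of Gödel's proof of GCH). The ultrapower is
well-founded (`Emb.wellFounded_tr`): a descending sequence is captured by a hull of size less than κ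
whose collapse lies in N, and applying j would give a descending ∈-sequence in M. Łoś's theorem
(`Emb.los`) and condensation identify the collapsed ultrapower with a level of A of height at least
d (`Emb.exists_lev_eq_range`), so X belongs to it.

Hence X is represented by a function f at a seed s, and f(t) is bad over N for almost all t. Let g
be the least element of N omitted by some bad Y constructed from B before d. The image of Y is bad
over M and omits j g, so m ≤ j g. On the other hand everything strictly below g is in every bad
f(t), so by Łoś everything strictly below j g is in X. As j g is in X as well, m is in X, a
contradiction (`Emb.false_of_isBad`).

Condensation needs a hierarchy whose correct construction is a bounded property. The levels `lev`
serve for this: each step adds only single values of Gödel operations, and the well-order is built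
along with the level. `lev_eq_L` shows that they agree with L[A] at uncountable regular heights. For
κ = ω every element of L_ω[A] is finite, and ∈-induction is enough (`surjective_of_omega0`). The
last claim follows by copying the structure to κ along a bijection. -/

namespace RelConstr

/-! ### Bounded formulas -/

/-- Bounded formulas of the language `{∈, Ȧ}` in `n` free variables; the variable bound by `bex`
is the last one. -/
inductive Fm : ℕ → Type
  | mem {n} (i j : Fin n) : Fm n
  | pred {n} (i : Fin n) : Fm n
  | neg {n} (φ : Fm n) : Fm n
  | and {n} (φ ψ : Fm n) : Fm n
  | bex {n} (i : Fin n) (φ : Fm (n + 1)) : Fm n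

/-- Truth of a bounded formula, with `A` interpreting the predicate. -/
def Sat (A : ZFSet.{u}) : {n : ℕ} → Fm n → (Fin n → ZFSet.{u}) → Prop
  | _, .mem i j, v => v i ∈ v j
  | _, .pred i, v => v i ∈ A
  | _, .neg φ, v => ¬ Sat A φ v
  | _, .and φ ψ, v => Sat A φ v ∧ Sat A ψ v
  | _, .bex i φ, v => ∃ z ∈ v i, Sat A φ (Fin.snoc (α := fun _ => ZFSet.{u}) v z)

/-- Renaming of variables in a bounded formula. -/
def Fm.rename : {n m : ℕ} → Fm n → (Fin n → Fin m) → Fm m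
  | _, _, .mem i j, f => .mem (f i) (f j)
  | _, _, .pred i, f => .pred (f i)
  | _, _, .neg φ, f => .neg (φ.rename f)
  | _, _, .and φ ψ, f => .and (φ.rename f) (ψ.rename f)
  | _, m, .bex i φ, f => .bex (f i)
      (φ.rename (Fin.snoc (α := fun _ => Fin (m + 1)) (fun i => (f i).castSucc) (Fin.last m)))

theorem sat_rename (A : ZFSet.{u}) {n m : ℕ} (φ : Fm n) (f : Fin n → Fin m)
    (v : Fin m → ZFSet.{u}) : Sat A (φ.rename f) v ↔ Sat A φ (fun i => v (f i)) := by
  induction φ generalizing m with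
  | mem i j => rfl
  | pred i => rfl
  | neg φ ih => simp only [Fm.rename, Sat, ih]
  | and φ ψ ih ih' => simp only [Fm.rename, Sat, ih, ih']
  | bex i φ ih =>
    simp only [Fm.rename, Sat, ih]
    refine exists_congr fun z => and_congr_right fun _ => iff_of_eq ?_
    congr 1
    funext k
    refine Fin.lastCases ?_ (fun k => ?_) k <;> simp

/-- A relation is `D0` if it is defined by a bounded formula. -/
def D0 {n : ℕ} (Q : ZFSet.{u} → (Fin n → ZFSet.{u}) → Prop) : Prop :=
  ∃ φ : Fm n, ∀ A v, Q A v ↔ Sat A φ v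

/-- All values but the last one. -/
abbrev Fst {n : ℕ} (e : Fin (n + 1) → ZFSet.{u}) : Fin n → ZFSet.{u} := fun i => e i.castSucc

/-- The last value. -/
abbrev Lst {n : ℕ} (e : Fin (n + 1) → ZFSet.{u}) : ZFSet.{u} := e (Fin.last n)

theorem fst_snoc {n : ℕ} (v : Fin n → ZFSet.{u}) (z : ZFSet.{u}) :
    Fst (Fin.snoc (α := fun _ => ZFSet.{u}) v z) = v := by
  funext i; simp [Fst]

theorem fst_comp_snoc {n m : ℕ} (e : Fin m → ZFSet.{u}) (g : Fin n → Fin m) (k : Fin m) :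
    Fst (fun i => e (Fin.snoc (α := fun _ => Fin m) g k i)) = fun i => e (g i) := by
  funext i; simp [Fst]

/-- A function of the values of the variables that is one of them. -/
def IsVar {n : ℕ} (t : (Fin n → ZFSet.{u}) → ZFSet.{u}) : Prop := ∃ i, ∀ e, t e = e i

theorem IsVar.mk {n : ℕ} (i : Fin n) : IsVar (fun e : Fin n → ZFSet.{u} => e i) :=
  ⟨i, fun _ => rfl⟩

/-! ### Closure properties of the relations defined by bounded formulas -/

namespace D0

section
variable {n : ℕ} {Q R : ZFSet.{u} → (Fin n → ZFSet.{u}) → Prop}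
  {t s w t' s' : (Fin n → ZFSet.{u}) → ZFSet.{u}}

theorem congr (h : D0 Q) (h' : ∀ A e, R A e ↔ Q A e) : D0 R := by
  obtain ⟨φ, hφ⟩ := h
  exact ⟨φ, fun A v => (h' A v).trans (hφ A v)⟩

theorem rename {m : ℕ} (h : D0 Q) (f : Fin n → Fin m) :
    D0 (fun A (e : Fin m → ZFSet.{u}) => Q A (fun i => e (f i))) := by
  obtain ⟨φ, hφ⟩ := h
  exact ⟨φ.rename f, fun A v => (hφ A _).trans (sat_rename A φ f v).symm⟩

theorem mem (ht : IsVar t) (hs : IsVar s) : D0 (fun _ e => t e ∈ s e) := by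
  obtain ⟨i, hi⟩ := ht
  obtain ⟨j, hj⟩ := hs
  exact ⟨.mem i j, fun A v => by simp [Sat, hi, hj]⟩

theorem pred (ht : IsVar t) : D0 (fun A e => t e ∈ A) := by
  obtain ⟨i, hi⟩ := ht
  exact ⟨.pred i, fun A v => by simp [Sat, hi]⟩

theorem neg (h : D0 Q) : D0 (fun A e => ¬ Q A e) := by
  obtain ⟨φ, hφ⟩ := h
  exact ⟨.neg φ, fun A v => by simp [Sat, hφ]⟩

theorem and (h : D0 Q) (h' : D0 R) : D0 (fun A e => Q A e ∧ R A e) := by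
  obtain ⟨φ, hφ⟩ := h
  obtain ⟨ψ, hψ⟩ := h'
  exact ⟨.and φ ψ, fun A v => by simp [Sat, hφ, hψ]⟩

theorem or (h : D0 Q) (h' : D0 R) : D0 (fun A e => Q A e ∨ R A e) := by
  simpa [or_iff_not_and_not] using (h.neg.and h'.neg).neg

theorem imp (h : D0 Q) (h' : D0 R) : D0 (fun A e => Q A e → R A e) := by
  simpa [imp_iff_not_or] using (h.neg.or h')

theorem iff (h : D0 Q) (h' : D0 R) : D0 (fun A e => Q A e ↔ R A e) := by
  simpa [iff_iff_implies_and_implies] using (h.imp h').and (h'.imp h)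

/-- No atomic formula is closed, so some variable must be available; falsity is then the formula x ∈
x. -/
theorem false (i : Fin n) : D0 (fun _ (_ : Fin n → ZFSet.{u}) => False) :=
  (mem (IsVar.mk i) (IsVar.mk i)).congr fun _ e => by simp [ZFSet.mem_irrefl]

theorem bex (ht : IsVar t) {Q : ZFSet.{u} → (Fin n → ZFSet.{u}) → ZFSet.{u} → Prop}
    (h : D0 (n := n + 1) (fun A e => Q A (Fst e) (Lst e))) :
    D0 (fun A e => ∃ z ∈ t e, Q A e z) := by
  obtain ⟨i, hi⟩ := ht
  obtain ⟨φ, hφ⟩ := h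
  refine ⟨.bex i φ, fun A v => ?_⟩
  simp only [Sat, hi, ← hφ, fst_snoc]
  simp [Lst]

theorem ball (ht : IsVar t) {Q : ZFSet.{u} → (Fin n → ZFSet.{u}) → ZFSet.{u} → Prop}
    (h : D0 (n := n + 1) (fun A e => Q A (Fst e) (Lst e))) :
    D0 (fun A e => ∀ z ∈ t e, Q A e z) := by
  simpa using (bex (Q := fun A e z => ¬ Q A e z) ht h.neg).neg

theorem comp1 {P : ZFSet.{u} → ZFSet.{u} → Prop} (h : D0 (n := 1) fun A e => P A (e 0))
    (ht : IsVar t) : D0 (fun A e => P A (t e)) := by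
  obtain ⟨i, hi⟩ := ht
  simpa [hi] using h.rename ![i]

theorem comp2 {P : ZFSet.{u} → ZFSet.{u} → ZFSet.{u} → Prop}
    (h : D0 (n := 2) fun A e => P A (e 0) (e 1))
    (ht : IsVar t) (hs : IsVar s) : D0 (fun A e => P A (t e) (s e)) := by
  obtain ⟨i, hi⟩ := ht
  obtain ⟨j, hj⟩ := hs
  simpa [hi, hj] using h.rename ![i, j]

theorem comp3 {P : ZFSet.{u} → ZFSet.{u} → ZFSet.{u} → ZFSet.{u} → Prop}
    (h : D0 (n := 3) fun A e => P A (e 0) (e 1) (e 2))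
    (ht : IsVar t) (hs : IsVar s) (hw : IsVar w) : D0 (fun A e => P A (t e) (s e) (w e)) := by
  obtain ⟨i, hi⟩ := ht
  obtain ⟨j, hj⟩ := hs
  obtain ⟨k, hk⟩ := hw
  simpa [hi, hj, hk] using h.rename ![i, j, k]

theorem comp4 {P : ZFSet.{u} → ZFSet.{u} → ZFSet.{u} → ZFSet.{u} → ZFSet.{u} → Prop}
    (h : D0 (n := 4) fun A e => P A (e 0) (e 1) (e 2) (e 3))
    (ht : IsVar t) (hs : IsVar s) (hw : IsVar w) (ht' : IsVar t') :
    D0 (fun A e => P A (t e) (s e) (w e) (t' e)) := by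
  obtain ⟨i, hi⟩ := ht
  obtain ⟨j, hj⟩ := hs
  obtain ⟨k, hk⟩ := hw
  obtain ⟨l, hl⟩ := ht'
  simpa [hi, hj, hk, hl] using h.rename ![i, j, k, l]

theorem exFin {k : ℕ} {Q : Fin k → ZFSet.{u} → (Fin (n + 1) → ZFSet.{u}) → Prop}
    (h : ∀ i, D0 (Q i)) : D0 (fun A e => ∃ i, Q i A e) := by
  induction k with
  | zero => exact (D0.false 0).congr fun A e => by simp
  | succ k ih =>
    exact ((h 0).or (ih fun i => h i.succ)).congr fun A e => by simp [Fin.exists_fin_succ]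

theorem allFin {k : ℕ} {Q : Fin k → ZFSet.{u} → (Fin (n + 1) → ZFSet.{u}) → Prop}
    (h : ∀ i, D0 (Q i)) : D0 (fun A e => ∀ i, Q i A e) := by
  simpa using (exFin fun i => (h i).neg).neg

theorem const (p : Prop) (i : Fin n) : D0 (fun _ (_ : Fin n → ZFSet.{u}) => p) := by
  by_cases hp : p
  · exact ((D0.false i).neg).congr fun A e => by simp [hp]
  · exact (D0.false i).congr fun A e => by simp [hp]

theorem sub (ht : IsVar t) (hs : IsVar s) : D0 (fun _ e => t e ⊆ s e) := by
  simp only [ZFSet.subset_def]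
  obtain ⟨i, hi⟩ := ht
  obtain ⟨j, hj⟩ := hs
  simp only [hi, hj]
  exact ball (IsVar.mk i) (mem (IsVar.mk _) (IsVar.mk _))

theorem eq (ht : IsVar t) (hs : IsVar s) : D0 (fun _ e => t e = s e) :=
  ((sub ht hs).and (sub hs ht)).congr fun A e =>
    ⟨fun h => by simp [h], fun h => subset_antisymm h.1 h.2⟩

theorem isEmpty (ht : IsVar t) : D0 (fun _ e => t e = ∅) :=
  comp1 (P := fun _ x => x = ∅) ((ball (IsVar.mk 0) (Q := fun _ _ _ => False)
    (D0.false 0)).congr fun A e => by simp [ZFSet.eq_empty]) ht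

theorem upair (ht : IsVar t) (hs : IsVar s) (hw : IsVar w) :
    D0 (fun _ e => t e = ({s e, w e} : ZFSet.{u})) := by
  refine comp3 (P := fun _ x y z => x = {y, z}) ?_ ht hs hw
  refine D0.congr (Q := fun _ e => e 1 ∈ e 0 ∧ e 2 ∈ e 0 ∧ ∀ a ∈ e 0, a = e 1 ∨ a = e 2) ?_ ?_
  · apply_rules [D0.mem, D0.and, D0.ball, D0.or, D0.eq, IsVar.mk]
  · intro A e
    constructor
    · intro h
      simp [h]
    · intro h
      ext a
      simp only [ZFSet.mem_pair]
      exact ⟨h.2.2 a, fun ha => by rcases ha with rfl | rfl <;> tauto⟩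

theorem opair (ht : IsVar t) (hs : IsVar s) (hw : IsVar w) :
    D0 (fun _ e => t e = ZFSet.pair (s e) (w e)) := by
  refine comp3 (P := fun _ x y z => x = ZFSet.pair y z) ?_ ht hs hw
  refine D0.congr (Q := fun _ e => (∃ a ∈ e 0, a = {e 1, e 1}) ∧ (∃ a ∈ e 0, a = {e 1, e 2}) ∧
    ∀ a ∈ e 0, a = {e 1, e 1} ∨ a = {e 1, e 2}) ?_ ?_
  · apply_rules [D0.mem, D0.and, D0.ball, D0.bex, D0.or, D0.upair, IsVar.mk]
  · intro A e
    simp only [exists_eq_right, ZFSet.pair, ZFSet.pair_eq_singleton]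
    constructor
    · intro h
      simp [h]
    · intro h
      ext a
      simp only [ZFSet.mem_pair]
      exact ⟨h.2.2 a, fun ha => by rcases ha with rfl | rfl <;> tauto⟩

theorem opair_mem (ht : IsVar t) (hs : IsVar s) (hw : IsVar w) :
    D0 (fun _ e => ZFSet.pair (s e) (w e) ∈ t e) := by
  refine comp3 (P := fun _ x y z => ZFSet.pair y z ∈ x) ?_ ht hs hw
  refine D0.congr (Q := fun _ e => ∃ p ∈ e 0, p = ZFSet.pair (e 1) (e 2)) ?_ (by simp)
  apply_rules [D0.bex, D0.opair, IsVar.mk]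

/-- The components of a Kuratowski pair are elements of its elements, so quantifying over them is
bounded in two steps. -/
theorem expair (ht : IsVar t)
    {Q : ZFSet.{u} → (Fin n → ZFSet.{u}) → ZFSet.{u} → ZFSet.{u} → Prop}
    (h : D0 (n := n + 1 + 1) (fun A e => Q A (Fst (Fst e)) (Lst (Fst e)) (Lst e))) :
    D0 (fun A e => ∃ b c, t e = ZFSet.pair b c ∧ Q A e b c) := by
  obtain ⟨i, hi⟩ := ht
  refine D0.congr (Q := fun A e => ∃ s ∈ e i, ∃ b ∈ s, ∃ s' ∈ e i, ∃ c ∈ s',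
    e i = ZFSet.pair b c ∧ Q A e b c) ?_ ?_
  · refine bex (IsVar.mk _) (bex (IsVar.mk _) (bex (IsVar.mk i.castSucc.castSucc)
      (bex (IsVar.mk _) ((opair (IsVar.mk i.castSucc.castSucc.castSucc.castSucc)
      (IsVar.mk (Fin.last (n + 1)).castSucc.castSucc) (IsVar.mk _)).and ?_))))
    exact h.rename (Fin.snoc (α := fun _ => Fin (n + 4)) (Fin.snoc (α := fun _ => Fin (n + 4))
      (fun i : Fin n => i.castSucc.castSucc.castSucc.castSucc)
      (Fin.last (n + 1)).castSucc.castSucc) (Fin.last (n + 3))) |>.congr fun A e => by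
        rw [fst_comp_snoc, fst_comp_snoc]
        simp [Lst]
  · intro A e
    simp only [hi]
    constructor
    · rintro ⟨b, c, h, hQ⟩
      refine ⟨{b}, ?_, b, ?_, {b, c}, ?_, c, ?_, h, hQ⟩ <;> simp [h, ZFSet.pair]
    · rintro ⟨s, -, b, -, s', -, c, -, h⟩
      exact ⟨b, c, h⟩

theorem allpair (ht : IsVar t)
    {Q : ZFSet.{u} → (Fin n → ZFSet.{u}) → ZFSet.{u} → ZFSet.{u} → Prop}
    (h : D0 (n := n + 1 + 1) (fun A e => Q A (Fst (Fst e)) (Lst (Fst e)) (Lst e))) :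
    D0 (fun A e => ∀ b c, t e = ZFSet.pair b c → Q A e b c) := by
  simpa using (expair (Q := fun A e b c => ¬ Q A e b c) ht h.neg).neg

/-- Parameters of a step of the hierarchy range over S ∪ {S}. This quantifier stays bounded because
the extra value S can be substituted for the bound variable. -/
theorem explus (ht : IsVar t) {Q : ZFSet.{u} → (Fin n → ZFSet.{u}) → ZFSet.{u} → Prop}
    (h : D0 (n := n + 1) (fun A e => Q A (Fst e) (Lst e))) :
    D0 (fun A e => ∃ z, (z ∈ t e ∨ z = t e) ∧ Q A e z) := by
  obtain ⟨i, hi⟩ := ht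
  refine D0.congr (Q := fun A e => (∃ z ∈ e i, Q A e z) ∨ Q A e (e i))
    ((bex (IsVar.mk i) h).or ((h.rename (Fin.snoc (α := fun _ => Fin n) id i)).congr
      fun A e => by rw [fst_comp_snoc]; simp [Lst])) ?_
  intro A e
  simp only [hi]
  constructor
  · rintro ⟨z, h | rfl, h'⟩
    · exact Or.inl ⟨z, h, h'⟩
    · exact Or.inr h'
  · rintro (⟨z, h, h'⟩ | h')
    · exact ⟨z, Or.inl h, h'⟩
    · exact ⟨_, Or.inr rfl, h'⟩

theorem allplus (ht : IsVar t) {Q : ZFSet.{u} → (Fin n → ZFSet.{u}) → ZFSet.{u} → Prop}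
    (h : D0 (n := n + 1) (fun A e => Q A (Fst e) (Lst e))) :
    D0 (fun A e => ∀ z, (z ∈ t e ∨ z = t e) → Q A e z) := by
  simpa only [not_exists, not_and, not_not] using
    (explus (Q := fun A e z => ¬ Q A e z) ht h.neg).neg

end

end D0

/-! ### Well-orders of sets -/

/-- `le` well-orders `D`: it is antisymmetric and every nonempty subset has a least element. -/
structure LWO {α : Type*} (D : Set α) (le : α → α → Prop) : Prop where
  anti : ∀ x ∈ D, ∀ y ∈ D, le x y → le y x → x = y
  least : ∀ Z : Set α, Z.Nonempty → Z ⊆ D → ∃ m ∈ Z, ∀ z ∈ Z, le m z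

theorem LWO.congr {α : Type*} {D : Set α} {le le' : α → α → Prop} (h : LWO D le)
    (h' : ∀ x ∈ D, ∀ y ∈ D, le' x y ↔ le x y) : LWO D le' where
  anti x hx y hy h1 h2 := h.anti x hx y hy ((h' x hx y hy).1 h1) ((h' y hy x hx).1 h2)
  least Z hZ hZD := by
    obtain ⟨m, hm, hmin⟩ := h.least Z hZ hZD
    exact ⟨m, hm, fun z hz => (h' m (hZD hm) z (hZD hz)).2 (hmin z hz)⟩

theorem LWO.of_linear {α : Type*} [LinearOrder α] [WellFoundedLT α] (D : Set α) :
    LWO D (fun x y : α => x ≤ y) where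
  anti _ _ _ _ h1 h2 := le_antisymm h1 h2
  least Z hZ _ := ⟨WellFounded.min wellFounded_lt Z hZ, WellFounded.min_mem _ _ _,
    fun _ hz => WellFounded.min_le wellFounded_lt hz⟩

theorem LWO.lex {α β : Type*} {D : Set α} {le : α → α → Prop} (h : LWO D le) {D' : Set β}
    {le' : β → β → Prop} (h' : LWO D' le') :
    LWO (D ×ˢ D') (fun p q => (p.1 ≠ q.1 ∧ le p.1 q.1) ∨ (p.1 = q.1 ∧ le' p.2 q.2)) where
  anti := by
    rintro ⟨x, y⟩ ⟨hx, hy⟩ ⟨x', y'⟩ ⟨hx', hy'⟩ h1 h2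
    dsimp only at *
    rcases h1 with ⟨h1, h3⟩ | ⟨h1, h3⟩ <;> rcases h2 with ⟨h2, h4⟩ | ⟨h2, h4⟩
    · exact absurd (h.anti _ hx _ hx' h3 h4) h1
    · exact absurd h2.symm h1
    · exact absurd h1.symm h2
    · rw [h1, h'.anti _ hy _ hy' h3 h4]
  least Z hZ hZD := by
    obtain ⟨m, ⟨⟨m0, m1⟩, hm, rfl⟩, hmin⟩ := h.least (Prod.fst '' Z) (hZ.image _) (by
      rintro _ ⟨p, hp, rfl⟩; exact (hZD hp).1)
    obtain ⟨k, hk, hkmin⟩ := h'.least {y | (m0, y) ∈ Z} ⟨m1, hm⟩ (fun y hy => (hZD hy).2)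
    refine ⟨(m0, k), hk, ?_⟩
    rintro ⟨x, y⟩ hz
    dsimp only
    by_cases hx : m0 = x
    · subst hx
      exact Or.inr ⟨rfl, hkmin y hz⟩
    · exact Or.inl ⟨hx, hmin x ⟨_, hz, rfl⟩⟩

/-- Objects are compared by their least codes, and disjointness of the code sets gives antisymmetry.
Saying that some code of x is below all codes of y avoids naming the least code and keeps the order
bounded. -/
theorem LWO.of_codes {α γ : Type*} {D : Set γ} {le : γ → γ → Prop} (h : LWO D le) (N : Set α)
    (C : α → Set γ) (hC : ∀ x ∈ N, (C x).Nonempty ∧ C x ⊆ D)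
    (hdis : ∀ x ∈ N, ∀ y ∈ N, ∀ c, c ∈ C x → c ∈ C y → x = y) :
    LWO N (fun x y => ∃ c ∈ C x, ∀ c' ∈ C y, le c c') where
  anti x hx y hy := by
    rintro ⟨c, hc, h1⟩ ⟨d, hd, h2⟩
    have := h.anti c ((hC x hx).2 hc) d ((hC y hy).2 hd) (h1 d hd) (h2 c hc)
    exact hdis x hx y hy c hc (this ▸ hd)
  least Z hZ hZN := by
    obtain ⟨z, hz⟩ := hZ
    obtain ⟨m, hm, hmin⟩ := h.least (⋃ x ∈ Z, C x) (by
      obtain ⟨c, hc⟩ := (hC z (hZN hz)).1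
      exact ⟨c, by simpa using ⟨z, hz, hc⟩⟩) (by
      simp only [Set.iUnion_subset_iff]
      exact fun x hx => (hC x (hZN hx)).2)
    simp only [Set.mem_iUnion, exists_prop] at hm
    obtain ⟨x, hx, hm⟩ := hm
    exact ⟨x, hx, fun y hy => ⟨m, hm, fun c' hc' =>
      hmin c' (by simpa using ⟨y, hy, hc'⟩)⟩⟩

theorem LWO.sum {α : Type*} {D D' : Set α} {le le' : α → α → Prop} (h : LWO D le)
    (h' : LWO D' le') (hd : ∀ x ∈ D', x ∉ D) :
    LWO (D ∪ D') (fun x y => (x ∈ D ∧ y ∈ D ∧ le x y) ∨ (y ∉ D ∧ (x ∈ D ∨ (x ∉ D ∧ le' x y)))) where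
  anti x hx y hy := by
    rintro h1 h2
    have := h.anti x
    have := h'.anti x
    have := hd x
    have := hd y
    simp only [Set.mem_union] at hx hy
    grind
  least Z hZ hZD := by
    by_cases hne : (Z ∩ D).Nonempty
    · obtain ⟨m, hm, hmin⟩ := h.least _ hne Set.inter_subset_right
      refine ⟨m, hm.1, fun z hz => ?_⟩
      by_cases hzD : z ∈ D
      · exact Or.inl ⟨hm.2, hzD, hmin z ⟨hz, hzD⟩⟩
      · exact Or.inr ⟨hzD, Or.inl hm.2⟩
    · have hout : ∀ z ∈ Z, z ∉ D := fun z hz hzD => hne ⟨z, hz, hzD⟩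
      obtain ⟨m, hm, hmin⟩ := h'.least Z hZ fun z hz => (hZD hz).resolve_left (hout z hz)
      exact ⟨m, hm, fun z hz => Or.inr ⟨hout z hz, Or.inr ⟨hout m hm, hmin z hz⟩⟩⟩

/-! ### Gödel operations -/

open ZFSet (pair)

/-- Membership in the value of the `i`-th Gödel operation at `(x, y)`. -/
def GMem (i : Fin 10) (A a x y : ZFSet.{u}) : Prop :=
  match i with
  | 0 => a = x ∨ a = y
  | 1 => a ∈ x ∧ a ∉ y
  | 2 => ∃ b c, a = pair b c ∧ b ∈ x ∧ c ∈ y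
  | 3 => ∃ p ∈ x, ∃ b c, p = pair b c ∧ a = c
  | 4 => ∃ e d, a = pair e d ∧ ∃ b c, d = pair b c ∧ b ∈ y ∧ pair e c ∈ x
  | 5 => a ∈ x ∧ ∃ b d, a = pair b d ∧ ∃ c e, d = pair c e ∧ b ∈ c
  | 6 => a ∈ x ∧ ∃ b d, a = pair b d ∧ ∃ c e, d = pair c e ∧ c ∈ b
  | 7 => a ∈ x ∧ ∃ b d, a = pair b d ∧ ∃ c e, d = pair c e ∧ b = c
  | 8 => a ∈ x ∧ ∃ b c, a = pair b c ∧ b ∈ A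
  | 9 => pair a y ∈ x

section
variable {n : ℕ} {t s w t' s' : (Fin n → ZFSet.{u}) → ZFSet.{u}}

theorem D0.gmem (i : Fin 10) (ht : IsVar t) (hs : IsVar s) (hw : IsVar w) :
    D0 (fun A e => GMem i A (t e) (s e) (w e)) := by
  refine D0.comp3 (P := GMem i) ?_ ht hs hw
  fin_cases i <;> dsimp only [GMem]
  all_goals apply_rules [D0.opair_mem, D0.mem, D0.and, D0.or, D0.neg, D0.bex, D0.expair, D0.eq,
    D0.pred, IsVar.mk]

end

/-- The `i`-th Gödel operation. -/
noncomputable def G (A : ZFSet.{u}) (i : Fin 10) (x y : ZFSet.{u}) : ZFSet.{u} :=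
  ZFSet.sep (fun a => GMem i A a x y) ({x, y} ∪ x ∪ ZFSet.prod x y ∪
    x.sUnion.sUnion ∪ ZFSet.prod x.sUnion.sUnion (ZFSet.prod y x.sUnion.sUnion) : ZFSet.{u})

theorem left_mem_sUnion_sUnion {a b x : ZFSet.{u}} (h : pair a b ∈ x) :
    a ∈ x.sUnion.sUnion := by
  simp only [ZFSet.mem_sUnion]
  exact ⟨{a}, ⟨_, h, by simp [ZFSet.pair]⟩, by simp⟩

theorem right_mem_sUnion_sUnion {a b x : ZFSet.{u}} (h : pair a b ∈ x) :
    b ∈ x.sUnion.sUnion := by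
  simp only [ZFSet.mem_sUnion]
  exact ⟨{a, b}, ⟨_, h, by simp [ZFSet.pair]⟩, by simp⟩

/-- The set from which `G` is separated contains everything that any of the ten operations admits,
so the separation loses nothing. -/
theorem mem_G {A : ZFSet.{u}} {i : Fin 10} {x y a : ZFSet.{u}} :
    a ∈ G A i x y ↔ GMem i A a x y := by
  rw [G, ZFSet.mem_sep, and_iff_right_iff_imp]
  intro h
  simp only [ZFSet.mem_union]
  fin_cases i <;> dsimp only [GMem] at h
  · exact .inl (.inl (.inl (.inl (by simpa using h))))
  · exact .inl (.inl (.inl (.inr h.1)))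
  · obtain ⟨b, c, rfl, hb, hc⟩ := h
    exact .inl (.inl (.inr (by simp [hb, hc])))
  · obtain ⟨_, hp, b, c, rfl, rfl⟩ := h
    exact .inl (.inr (right_mem_sUnion_sUnion hp))
  · obtain ⟨e, d, rfl, b, c, rfl, hb, hp⟩ := h
    refine .inr ?_
    rw [ZFSet.pair_mem_prod, ZFSet.pair_mem_prod]
    exact ⟨left_mem_sUnion_sUnion hp, hb, right_mem_sUnion_sUnion hp⟩
  · exact .inl (.inl (.inl (.inr h.1)))
  · exact .inl (.inl (.inl (.inr h.1)))
  · exact .inl (.inl (.inl (.inr h.1)))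
  · exact .inl (.inl (.inl (.inr h.1)))
  · exact .inl (.inr (left_mem_sUnion_sUnion h))

/-! ### One step of the hierarchy -/

/-- `x` is the intersection of `S` with the value of the `i`-th operation at `(a, b)`. -/
def IsCut (A S : ZFSet.{u}) (i : Fin 10) (a b x : ZFSet.{u}) : Prop :=
  (∀ z ∈ x, z ∈ S ∧ GMem i A z a b) ∧ ∀ z ∈ S, GMem i A z a b → z ∈ x

theorem isCut_iff {A S : ZFSet.{u}} {i : Fin 10} {a b x : ZFSet.{u}} :
    IsCut A S i a b x ↔ x = S ∩ G A i a b := by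
  constructor
  · intro h
    ext z
    simp only [ZFSet.mem_inter, mem_G]
    exact ⟨h.1 z, fun hz => h.2 z hz.1 hz.2⟩
  · rintro rfl
    refine ⟨fun z hz => ?_, fun z hz hz' => ?_⟩
    · simpa [mem_G] using hz
    · simpa [mem_G] using ⟨hz, hz'⟩

theorem D0.isCut (i : Fin 10) {n : ℕ} {t s w t' : (Fin n → ZFSet.{u}) → ZFSet.{u}}
    (ht : IsVar t) (hs : IsVar s) (hw : IsVar w) (ht' : IsVar t') :
    D0 (fun A e => IsCut A (t e) i (s e) (w e) (t' e)) := by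
  refine D0.comp4 (P := fun A S a b x => IsCut A S i a b x) ?_ ht hs hw ht'
  unfold IsCut
  apply_rules [D0.mem, D0.and, D0.ball, D0.imp, D0.gmem, IsVar.mk]

/-- The elements of the step applied to `S`. -/
def InStep (A S x : ZFSet.{u}) : Prop :=
  x ∈ S ∨ ∃ i, ∃ a, (a ∈ S ∨ a = S) ∧ ∃ b, (b ∈ S ∨ b = S) ∧ IsCut A S i a b x

theorem D0.inStep {n : ℕ} {t s : (Fin n → ZFSet.{u}) → ZFSet.{u}} (ht : IsVar t)
    (hs : IsVar s) : D0 (fun A e => InStep A (t e) (s e)) := by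
  refine D0.comp2 (P := InStep) ?_ ht hs
  unfold InStep
  refine D0.or (D0.mem (IsVar.mk _) (IsVar.mk _)) (D0.exFin fun i => ?_)
  apply_rules [D0.explus, D0.isCut, IsVar.mk]

/-- The step applied to `S`. -/
noncomputable def StepS (A S : ZFSet.{u}) : ZFSet.{u} :=
  ZFSet.sep (InStep A S) (S ∪ ZFSet.powerset S)

theorem mem_StepS {A S x : ZFSet.{u}} : x ∈ StepS A S ↔ InStep A S x := by
  rw [StepS, ZFSet.mem_sep, and_iff_right_iff_imp]
  rintro (h | ⟨i, a, -, b, -, h⟩)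
  · simp [h]
  · simp only [ZFSet.mem_union, ZFSet.mem_powerset]
    exact .inr fun z hz => (h.1 z hz).1

/-- The order on `S ∪ {S}` that puts `S` on top. -/
def PlusLe (S r a b : ZFSet.{u}) : Prop := pair a b ∈ r ∨ ((a ∈ S ∨ a = S) ∧ b = S)

/-- The lexicographic order of codes. -/
def CodeLe (S r : ZFSet.{u}) (i : Fin 10) (a b : ZFSet.{u}) (i' : Fin 10) (a' b' : ZFSet.{u}) :
    Prop :=
  (i ≠ i' ∧ i ≤ i') ∨ (i = i' ∧ ((a ≠ a' ∧ PlusLe S r a a') ∨ (a = a' ∧ PlusLe S r b b')))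

/-- The order of the elements of the step applied to `S`, ordered by `r`. -/
def StepLe (A S r x y : ZFSet.{u}) : Prop :=
  pair x y ∈ r ∨ ((InStep A S y ∧ y ∉ S) ∧ (x ∈ S ∨ ((InStep A S x ∧ x ∉ S) ∧
    ∃ i, ∃ a, (a ∈ S ∨ a = S) ∧ ∃ b, (b ∈ S ∨ b = S) ∧ IsCut A S i a b x ∧
    ∀ i', ∀ a', (a' ∈ S ∨ a' = S) → ∀ b', (b' ∈ S ∨ b' = S) → IsCut A S i' a' b' y →
    CodeLe S r i a b i' a' b')))

theorem D0.plusLe {n : ℕ} {t s w t' : (Fin n → ZFSet.{u}) → ZFSet.{u}}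
    (ht : IsVar t) (hs : IsVar s) (hw : IsVar w) (ht' : IsVar t') :
    D0 (fun _ e => PlusLe (t e) (s e) (w e) (t' e)) := by
  refine D0.comp4 (P := fun _ => PlusLe) ?_ ht hs hw ht'
  unfold PlusLe
  apply_rules [D0.opair_mem, D0.mem, D0.and, D0.or, D0.eq, IsVar.mk]

theorem D0.codeLe (i i' : Fin 10) :
    D0 (n := 6) (fun _ e => CodeLe (e 0) (e 1) i (e 2) (e 3) i' (e 4) (e 5)) := by
  unfold CodeLe
  apply_rules [D0.plusLe, D0.and, D0.or, D0.neg, D0.const _ 0, D0.eq, IsVar.mk]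

theorem D0.stepLe {n : ℕ} {t s w t' : (Fin n → ZFSet.{u}) → ZFSet.{u}}
    (ht : IsVar t) (hs : IsVar s) (hw : IsVar w) (ht' : IsVar t') :
    D0 (fun A e => StepLe A (t e) (s e) (w e) (t' e)) := by
  refine D0.comp4 (P := StepLe) ?_ ht hs hw ht'
  unfold StepLe
  refine D0.or (D0.opair_mem (IsVar.mk _) (IsVar.mk _) (IsVar.mk _)) (D0.and ?_ (D0.or
    (D0.mem (IsVar.mk _) (IsVar.mk _)) (D0.and ?_ (D0.exFin fun i => ?_))))
  · apply_rules [D0.and, D0.neg, D0.mem, D0.inStep, IsVar.mk]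
  · apply_rules [D0.and, D0.neg, D0.mem, D0.inStep, IsVar.mk]
  · refine D0.explus (IsVar.mk _) (D0.explus (IsVar.mk _) (D0.and ?_
      (D0.allFin fun i' => D0.allplus (IsVar.mk _) (D0.allplus (IsVar.mk _) (D0.imp ?_ ?_)))))
    · apply_rules [D0.isCut, IsVar.mk]
    · apply_rules [D0.isCut, IsVar.mk]
    · exact (D0.codeLe i i').rename ![0, 1, 4, 5, 6, 7]

/-- The order `StepLe`, as a set of pairs. -/
noncomputable def StepR (A S r : ZFSet.{u}) : ZFSet.{u} :=
  ZFSet.sep (fun p => ∃ x y, p = pair x y ∧ StepLe A S r x y)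
    (ZFSet.prod (StepS A S) (StepS A S))

/-- `r` is a well-order of `S`. -/
structure WO (S r : ZFSet.{u}) : Prop where
  field : ∀ p ∈ r, ∃ x ∈ S, ∃ y ∈ S, p = pair x y
  lwo : LWO (S : Set ZFSet.{u}) (fun x y => pair x y ∈ r)

theorem WO.left {S r x y : ZFSet.{u}} (h : WO S r) (hp : pair x y ∈ r) : x ∈ S := by
  obtain ⟨a, ha, b, hb, he⟩ := h.field _ hp
  rw [(ZFSet.pair_inj.1 he).1]; exact ha

theorem WO.right {S r x y : ZFSet.{u}} (h : WO S r) (hp : pair x y ∈ r) : y ∈ S := by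
  obtain ⟨a, ha, b, hb, he⟩ := h.field _ hp
  rw [(ZFSet.pair_inj.1 he).2]; exact hb

theorem WO.pair_mem_StepR {A S r x y : ZFSet.{u}} (h : WO S r) :
    pair x y ∈ StepR A S r ↔ StepLe A S r x y := by
  rw [StepR, ZFSet.mem_sep]
  constructor
  · rintro ⟨-, a, b, he, hl⟩
    obtain ⟨rfl, rfl⟩ := ZFSet.pair_inj.1 he
    exact hl
  · intro hl
    refine ⟨?_, x, y, rfl, hl⟩
    rw [ZFSet.pair_mem_prod, mem_StepS, mem_StepS]
    rcases hl with hl | ⟨⟨hy, -⟩, hx | ⟨⟨hx, -⟩, -⟩⟩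
    · exact ⟨.inl (h.left hl), .inl (h.right hl)⟩
    · exact ⟨.inl hx, hy⟩
    · exact ⟨hx, hy⟩

theorem WO.plus {S r : ZFSet.{u}} (h : WO S r) :
    LWO {a | a ∈ S ∨ a = S} (PlusLe S r) := by
  have hS : S ∉ S := ZFSet.mem_irrefl S
  have h' : LWO ({S} : Set ZFSet.{u}) (fun _ _ => True) :=
    ⟨by simp, fun Z hZ hZS => ⟨_, hZ.some_mem, by simp⟩⟩
  have := (h.lwo.sum h' (by simpa using hS)).congr (le' := PlusLe S r) (by
    intro x hx y hy
    simp only [Set.mem_union, SetLike.mem_coe, Set.mem_singleton_iff] at hx hy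
    simp only [SetLike.mem_coe, PlusLe]
    have := @h.left S r x y
    have := @h.right S r x y
    grind)
  convert this using 1
  ext a; simp [or_comm]

-- Old elements keep their order and form an initial segment. A new element is coded by an operation
-- with two parameters from S ∪ {S}; codes are ordered lexicographically and new elements by their
-- least codes. A code determines the cut that it codes, so distinct elements share no code.
set_option maxHeartbeats 400000 in
theorem WO.step {A S r : ZFSet.{u}} (h : WO S r) : WO (StepS A S) (StepR A S r) := by
  refine ⟨fun p hp => ?_, ?_⟩
  · rw [StepR, ZFSet.mem_sep] at hp
    obtain ⟨a, ha, b, hb, rfl⟩ := ZFSet.mem_prod.1 hp.1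
    exact ⟨a, ha, b, hb, rfl⟩
  have hcode := (LWO.of_linear (Set.univ : Set (Fin 10))).lex (h.plus.lex h.plus)
  have hnew := hcode.of_codes {x | InStep A S x ∧ x ∉ S}
    (fun x => {c | (c.2.1 ∈ S ∨ c.2.1 = S) ∧ (c.2.2 ∈ S ∨ c.2.2 = S) ∧ IsCut A S c.1 c.2.1 c.2.2 x})
    (by
      rintro x ⟨hx | ⟨i, a, ha, b, hb, hx⟩, hxS⟩
      · exact absurd hx hxS
      · exact ⟨⟨⟨i, a, b⟩, ha, hb, hx⟩, fun c hc => ⟨Set.mem_univ _, hc.1, hc.2.1⟩⟩)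
    (by
      rintro x - y - c ⟨-, -, hc⟩ ⟨-, -, hc'⟩
      rw [isCut_iff] at hc hc'
      rw [hc, hc'])
  have := (h.lwo.sum hnew (by rintro x ⟨-, hx⟩; exact hx)).congr
    (le' := fun x y => pair x y ∈ StepR A S r) (by
    intro x hx y hy
    rw [h.pair_mem_StepR]
    simp only [Set.mem_union, SetLike.mem_coe, Set.mem_ofPred_eq] at hx hy
    have h1 := @h.left S r x y
    have h2 := @h.right S r x y
    have key : (∃ c : Fin 10 × ZFSet × ZFSet, c ∈ {c : Fin 10 × ZFSet × ZFSet |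
        (c.2.1 ∈ S ∨ c.2.1 = S) ∧ (c.2.2 ∈ S ∨ c.2.2 = S) ∧ IsCut A S c.1 c.2.1 c.2.2 x} ∧
        ∀ c' ∈ {c : Fin 10 × ZFSet × ZFSet |
        (c.2.1 ∈ S ∨ c.2.1 = S) ∧ (c.2.2 ∈ S ∨ c.2.2 = S) ∧ IsCut A S c.1 c.2.1 c.2.2 y},
        (c.1 ≠ c'.1 ∧ c.1 ≤ c'.1) ∨ (c.1 = c'.1 ∧ ((c.2.1 ≠ c'.2.1 ∧ PlusLe S r c.2.1 c'.2.1) ∨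
          (c.2.1 = c'.2.1 ∧ PlusLe S r c.2.2 c'.2.2)))) ↔
        ∃ i, ∃ a, (a ∈ S ∨ a = S) ∧ ∃ b, (b ∈ S ∨ b = S) ∧ IsCut A S i a b x ∧
        ∀ i', ∀ a', (a' ∈ S ∨ a' = S) → ∀ b', (b' ∈ S ∨ b' = S) → IsCut A S i' a' b' y →
        CodeLe S r i a b i' a' b' := by
      constructor
      · rintro ⟨⟨i, a, b⟩, ⟨ha, hb, hc⟩, hmin⟩
        exact ⟨i, a, ha, b, hb, hc, fun i' a' ha' b' hb' hc' => hmin ⟨i', a', b'⟩ ⟨ha', hb', hc'⟩⟩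
      · rintro ⟨i, a, ha, b, hb, hc, hmin⟩
        exact ⟨⟨i, a, b⟩, ⟨ha, hb, hc⟩, fun c' hc' => hmin _ _ hc'.1 _ hc'.2.1 hc'.2.2⟩
    rw [StepLe, key]
    simp only [SetLike.mem_coe]
    constructor
    · rintro (hp | ⟨⟨hy1, hy2⟩, hx1 | ⟨⟨hx1, hx2⟩, hc⟩⟩)
      · exact .inl ⟨h1 hp, h2 hp, hp⟩
      · exact .inr ⟨hy2, .inl hx1⟩
      · exact .inr ⟨hy2, .inr ⟨hx2, hc⟩⟩
    · rintro (⟨-, -, hp⟩ | ⟨hy2, hx1 | ⟨hx2, hc⟩⟩)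
      · exact .inl hp
      · exact .inr ⟨hy.resolve_left hy2, .inl hx1⟩
      · exact .inr ⟨hy.resolve_left hy2, .inr ⟨hx.resolve_left hx2, hc⟩⟩)
  convert this using 1
  ext a
  simp only [SetLike.mem_coe, mem_StepS, Set.mem_union, Set.mem_ofPred_eq]
  exact ⟨fun h => or_iff_not_imp_left.2 fun h' => ⟨h, h'⟩, fun h => h.elim Or.inl And.left⟩

open ZFSet (pair)

/-! ### The hierarchy -/

/-- The levels of the hierarchy generated by the Gödel operations, with their well-orders. -/
noncomputable def levPair (A : ZFSet.{u}) (ξ : Ordinal.{u}) : ZFSet.{u} × ZFSet.{u} :=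
  (ZFSet.iUnion fun η : Set.Iio ξ => StepS A (levPair A η.1).1,
    ZFSet.iUnion fun η : Set.Iio ξ => StepR A (levPair A η.1).1 (levPair A η.1).2)
termination_by ξ
decreasing_by all_goals exact η.2

/-- The `ξ`-th level of the hierarchy. -/
noncomputable def lev (A : ZFSet.{u}) (ξ : Ordinal.{u}) : ZFSet.{u} := (levPair A ξ).1

/-- The well-order of the `ξ`-th level. -/
noncomputable def levLe (A : ZFSet.{u}) (ξ : Ordinal.{u}) : ZFSet.{u} := (levPair A ξ).2

variable {A : ZFSet.{u}} {ξ η ζ : Ordinal.{u}} {x y : ZFSet.{u}}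

theorem mem_lev : x ∈ lev A ξ ↔ ∃ η < ξ, InStep A (lev A η) x := by
  rw [lev, levPair]
  simp [mem_StepS, lev]

theorem mem_levLe : x ∈ levLe A ξ ↔ ∃ η < ξ, x ∈ StepR A (lev A η) (levLe A η) := by
  rw [levLe, levPair]
  simp [lev, levLe]

theorem InStep.mem_lev (h : InStep A (lev A η) x) (hη : η < ξ) : x ∈ lev A ξ :=
  RelConstr.mem_lev.2 ⟨η, hη, h⟩

theorem lev_mono (h : η ≤ ξ) : lev A η ⊆ lev A ξ := by
  rcases h.eq_or_lt with rfl | h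
  · exact subset_rfl
  · exact fun x hx => InStep.mem_lev (.inl hx) h

theorem levLe_mono (h : η ≤ ξ) : levLe A η ⊆ levLe A ξ := by
  intro p hp
  obtain ⟨ζ, hζ, hp⟩ := mem_levLe.1 hp
  exact mem_levLe.2 ⟨ζ, hζ.trans_le h, hp⟩

theorem mem_lev_add_one : x ∈ lev A (ξ + 1) ↔ InStep A (lev A ξ) x := by
  constructor
  · intro h
    obtain ⟨η, hη, h'⟩ := mem_lev.1 h
    rcases (Order.lt_add_one_iff.1 hη).eq_or_lt with rfl | hη
    · exact h'
    · exact .inl (h'.mem_lev hη)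
  · exact fun h => h.mem_lev (Order.lt_add_one_iff.2 le_rfl)

theorem lev_add_one : lev A (ξ + 1) = StepS A (lev A ξ) := by
  ext x; rw [mem_lev_add_one, mem_StepS]

theorem isTransitive_lev (A : ZFSet.{u}) (ξ : Ordinal.{u}) : (lev A ξ).IsTransitive := by
  induction ξ using WellFoundedLT.induction with
  | ind ξ ih =>
    intro x hx z hz
    obtain ⟨η, hη, hx | ⟨i, a, -, b, -, hc⟩⟩ := mem_lev.1 hx
    · exact lev_mono hη.le (ih η hη x hx hz)
    · exact lev_mono hη.le (hc.1 z hz).1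

theorem cut_mem_lev (hη : η < ξ) (i : Fin 10) (hx : x ∈ lev A η ∨ x = lev A η)
    (hy : y ∈ lev A η ∨ y = lev A η) : lev A η ∩ G A i x y ∈ lev A ξ :=
  InStep.mem_lev (.inr ⟨i, x, hx, y, hy, isCut_iff.2 rfl⟩) hη

/-- A level is the cut of itself by the difference of itself and ∅. The empty set is an admissible
parameter: it is an element by regularity, unless the level itself is empty. -/
theorem lev_mem_lev (h : η < ξ) : lev A η ∈ lev A ξ := by
  have hempty : (∅ : ZFSet) ∈ lev A η ∨ ∅ = lev A η := by
    by_cases he : lev A η = ∅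
    · exact .inr he.symm
    · obtain ⟨y, hy, hd⟩ := ZFSet.regularity _ he
      have : y = ∅ := by
        rw [ZFSet.eq_empty]
        intro z hz
        have : z ∈ lev A η ∩ y := ZFSet.mem_inter.2 ⟨isTransitive_lev A η y hy hz, hz⟩
        rw [hd] at this
        exact ZFSet.notMem_empty z this
      exact .inl (this ▸ hy)
  have := cut_mem_lev h 1 (.inr rfl) hempty
  convert this using 1
  ext z
  simp [mem_G, GMem]

theorem lev_mem_lev_iff : lev A η ∈ lev A ξ ↔ η < ξ := by
  refine ⟨fun h => ?_, lev_mem_lev⟩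
  by_contra hn
  exact ZFSet.mem_irrefl _ (lev_mono (not_lt.1 hn) h)

theorem lev_injective (A : ZFSet.{u}) : Function.Injective (lev A) := by
  intro η ξ h
  rcases lt_trichotomy η ξ with h' | h' | h'
  · exact absurd (h ▸ lev_mem_lev h') (ZFSet.mem_irrefl _)
  · exact h'
  · exact absurd (h ▸ lev_mem_lev h') (ZFSet.mem_irrefl _)

theorem mem_lev_of_isSuccLimit (hξ : Order.IsSuccLimit ξ) :
    x ∈ lev A ξ ↔ ∃ η < ξ, x ∈ lev A η := by
  constructor
  · intro h
    obtain ⟨η, hη, h⟩ := mem_lev.1 h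
    exact ⟨η + 1, hξ.add_one_lt hη, mem_lev_add_one.2 h⟩
  · rintro ⟨η, hη, h⟩
    exact lev_mono hη.le h

/-- The properties of the orders of the levels that are proved simultaneously. -/
structure LevOrder (A : ZFSet.{u}) (ξ : Ordinal.{u}) : Prop where
  wo : WO (lev A ξ) (levLe A ξ)
  initial : ∀ η ≤ ξ, ∀ x, ∀ y ∈ lev A η, pair x y ∈ levLe A ξ → pair x y ∈ levLe A η
  above : ∀ η ≤ ξ, ∀ x ∈ lev A η, ∀ y ∈ lev A ξ, y ∉ lev A η → pair x y ∈ levLe A ξ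

/-- Each step end-extends the order. Well-ordering at ξ is glued from the earlier steps by means of
the initial segment property and of the fact that later elements lie above, so the three are proved
together. -/
theorem levOrder (A : ZFSet.{u}) (ξ : Ordinal.{u}) : LevOrder A ξ := by
  induction ξ using WellFoundedLT.induction with
  | ind ξ ih =>
  have initial : ∀ η ≤ ξ, ∀ x, ∀ y ∈ lev A η, pair x y ∈ levLe A ξ → pair x y ∈ levLe A η := by
    intro η hη x y hy hp
    rcases hη.eq_or_lt with rfl | hη
    · exact hp
    obtain ⟨ζ, hζ, hp⟩ := mem_levLe.1 hp
    rcases lt_or_ge ζ η with h | h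
    · exact mem_levLe.2 ⟨ζ, h, hp⟩
    · rw [(ih ζ hζ).wo.pair_mem_StepR] at hp
      rcases hp with hp | ⟨⟨-, hy'⟩, -⟩
      · exact (ih ζ hζ).initial η h x y hy hp
      · exact absurd (lev_mono h hy) hy'
  have above : ∀ η ≤ ξ, ∀ x ∈ lev A η, ∀ y ∈ lev A ξ, y ∉ lev A η → pair x y ∈ levLe A ξ := by
    intro η hη x hx y hy hyη
    obtain ⟨ζ, hζ, hy⟩ := mem_lev.1 hy
    rcases lt_or_ge ζ η with h | h
    · exact absurd (hy.mem_lev h) hyη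
    refine mem_levLe.2 ⟨ζ, hζ, (ih ζ hζ).wo.pair_mem_StepR.2 ?_⟩
    by_cases hyζ : y ∈ lev A ζ
    · exact .inl ((ih ζ hζ).above η h x hx y hyζ hyη)
    · exact .inr ⟨⟨hy, hyζ⟩, .inl (lev_mono h hx)⟩
  -- A comparison may be recorded at any stage ζ; for elements present at step η it is already valid
  -- at step η, because later steps only add comparisons whose larger element is new.
  have hstep : ∀ η < ξ, ∀ x ∈ StepS A (lev A η), ∀ y ∈ StepS A (lev A η),
      pair x y ∈ levLe A ξ → pair x y ∈ StepR A (lev A η) (levLe A η) := by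
    intro η hη x hx y hy hp
    rw [(ih η hη).wo.pair_mem_StepR]
    obtain ⟨ζ, hζ, hp⟩ := mem_levLe.1 hp
    rcases lt_trichotomy ζ η with h | rfl | h
    · exact .inl (mem_levLe.2 ⟨ζ, h, hp⟩)
    · exact (ih ζ hζ).wo.pair_mem_StepR.1 hp
    · rw [(ih ζ hζ).wo.pair_mem_StepR] at hp
      rw [← lev_add_one] at hx hy
      have h1 : η + 1 ≤ ζ := Order.add_one_le_iff.2 h
      rcases hp with hp | ⟨⟨-, hy'⟩, -⟩
      · have := (ih ζ hζ).initial _ h1 x y hy hp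
        obtain ⟨δ, hδ, hp⟩ := mem_levLe.1 this
        rcases (Order.lt_add_one_iff.1 hδ).eq_or_lt with rfl | hδ
        · exact (ih _ hη).wo.pair_mem_StepR.1 hp
        · exact .inl (mem_levLe.2 ⟨δ, hδ, hp⟩)
      · exact absurd (lev_mono h1 hy) hy'
  refine ⟨⟨?_, ?_, ?_⟩, initial, above⟩
  · intro p hp
    obtain ⟨ζ, hζ, hp⟩ := mem_levLe.1 hp
    obtain ⟨x, hx, y, hy, rfl⟩ := (ih ζ hζ).wo.step.field _ hp
    exact ⟨x, (mem_StepS.1 hx).mem_lev hζ, y, (mem_StepS.1 hy).mem_lev hζ, rfl⟩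
  · intro x hx y hy h1 h2
    obtain ⟨ζ, hζ, hx⟩ := mem_lev.1 hx
    obtain ⟨δ, hδ, hy⟩ := mem_lev.1 hy
    have key : ∃ ε < ξ, InStep A (lev A ε) x ∧ InStep A (lev A ε) y := by
      rcases lt_trichotomy ζ δ with h | rfl | h
      · exact ⟨δ, hδ, .inl (hx.mem_lev h), hy⟩
      · exact ⟨ζ, hζ, hx, hy⟩
      · exact ⟨ζ, hζ, hx, .inl (hy.mem_lev h)⟩
    obtain ⟨ε, hε, hx, hy⟩ := key
    rw [← mem_StepS] at hx hy
    exact (ih ε hε).wo.step.lwo.anti x hx y hy (hstep ε hε x hx y hy h1) (hstep ε hε y hy x hx h2)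
  · intro Z hZ hZξ
    obtain ⟨z, hz⟩ := hZ
    obtain ⟨δ, hδ, hzδ⟩ := mem_lev.1 (hZξ hz)
    -- Any stage ε whose step meets `Z` would do: the least element of `Z` in that step lies below
    -- all elements that arrive later.
    obtain ⟨ε, ⟨hε, z', hz', hzε⟩, hmin⟩ := WellFounded.has_min (wellFounded_lt (α := Ordinal.{u}))
      {ε | ε < ξ ∧ ∃ z ∈ Z, InStep A (lev A ε) z} ⟨δ, hδ, z, hz, hzδ⟩
    obtain ⟨m, hm, hml⟩ := (ih ε hε).wo.step.lwo.least (Z ∩ {z | z ∈ StepS A (lev A ε)})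
      ⟨z', hz', mem_StepS.2 hzε⟩ Set.inter_subset_right
    refine ⟨m, hm.1, fun w hw => ?_⟩
    by_cases hwε : w ∈ StepS A (lev A ε)
    · exact mem_levLe.2 ⟨ε, hε, hml w ⟨hw, hwε⟩⟩
    · rw [← lev_add_one] at hwε
      exact above (ε + 1) (Order.add_one_le_iff.2 hε) m (by rw [lev_add_one]; exact hm.2) w
        (hZξ hw) hwε

theorem wo_lev (A : ZFSet.{u}) (ξ : Ordinal.{u}) : WO (lev A ξ) (levLe A ξ) := (levOrder A ξ).wo

/-! ### Sequences of levels -/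

/-- `(S, r)` is obtained by the step from the entries of `K` with index in `i`. -/
def IsEntry (A K i S r : ZFSet.{u}) : Prop :=
  (∀ x ∈ S, ∃ q ∈ K, ∃ i' o', q = pair i' o' ∧ i' ∈ i ∧ ∃ S' r', o' = pair S' r' ∧
    InStep A S' x) ∧
  (∀ q ∈ K, ∀ i' o', q = pair i' o' → i' ∈ i → ∀ S' r', o' = pair S' r' →
    (∀ x ∈ S', x ∈ S) ∧ (∀ i, ∀ a, (a ∈ S' ∨ a = S') → ∀ b, (b ∈ S' ∨ b = S') →
    ∃ x ∈ S, IsCut A S' i a b x) ∧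
    (∀ x ∈ S, ∀ y ∈ S, StepLe A S' r' x y → pair x y ∈ r)) ∧
  (∀ t ∈ r, ∃ x y, t = pair x y ∧ x ∈ S ∧ y ∈ S ∧ ∃ q ∈ K, ∃ i' o', q = pair i' o' ∧ i' ∈ i ∧
    ∃ S' r', o' = pair S' r' ∧ StepLe A S' r' x y)

/-- `K` consists of triples `(i, (S, r))` such that `(S, r)` is obtained from the entries of `K`
with index in `i`. -/
def IsSeq (A K : ZFSet.{u}) : Prop :=
  ∀ p ∈ K, ∃ i o, p = pair i o ∧ ∃ S r, o = pair S r ∧ IsEntry A K i S r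

theorem D0.isEntry {n : ℕ} {t s w t' : (Fin n → ZFSet.{u}) → ZFSet.{u}}
    (ht : IsVar t) (hs : IsVar s) (hw : IsVar w) (ht' : IsVar t') :
    D0 (fun A e => IsEntry A (t e) (s e) (w e) (t' e)) := by
  refine D0.comp4 (P := IsEntry) ?_ ht hs hw ht'
  unfold IsEntry
  refine D0.and ?_ (D0.and ?_ ?_)
  · apply_rules [D0.inStep, D0.opair_mem, D0.mem, D0.and, D0.bex, D0.ball, D0.expair, IsVar.mk]
  · refine D0.ball (IsVar.mk _) (D0.allpair ?_ (D0.imp ?_ (D0.allpair ?_ (D0.and ?_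
      (D0.and (D0.allFin fun i => ?_) ?_)))))
    all_goals apply_rules [D0.isCut, D0.stepLe, D0.opair_mem, D0.mem, D0.and, D0.imp, D0.bex,
      D0.ball, D0.allplus, D0.expair, IsVar.mk]
  · apply_rules [D0.stepLe, D0.opair_mem, D0.mem, D0.and, D0.bex, D0.ball, D0.expair, IsVar.mk]

theorem D0.isSeq {n : ℕ} {t : (Fin n → ZFSet.{u}) → ZFSet.{u}} (ht : IsVar t) :
    D0 (fun A e => IsSeq A (t e)) := by
  refine D0.comp1 (P := IsSeq) ?_ ht
  unfold IsSeq
  apply_rules [D0.isEntry, D0.ball, D0.expair, IsVar.mk]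

/-- The level and its well-order, as an ordered pair. -/
noncomputable def lp (A : ZFSet.{u}) (ξ : Ordinal.{u}) : ZFSet.{u} := pair (lev A ξ) (levLe A ξ)

/-- Steps increase, so the entries indexed by a set of ordinals cofinal in ξ already determine the
ξ-th level. Hence the indices in `K` need not be ordinals, nor need `K` contain all levels below ξ.
-/
theorem isEntry_iff {K i S r : ZFSet.{u}} (B : Set Ordinal.{u})
    (hB : ∀ i' ∈ i, ∀ o, pair i' o ∈ K → ∃ η ∈ B, o = lp A η)
    (hB' : ∀ η ∈ B, ∃ i' ∈ i, pair i' (lp A η) ∈ K)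
    (hξ : ∀ η ∈ B, η < ξ) (hξ' : ∀ η < ξ, ∃ ζ ∈ B, η ≤ ζ) :
    IsEntry A K i S r ↔ S = lev A ξ ∧ r = levLe A ξ := by
  have hS : ∀ x, x ∈ lev A ξ ↔ ∃ η ∈ B, InStep A (lev A η) x := by
    intro x
    constructor
    · intro hx
      obtain ⟨η, hη, hx⟩ := mem_lev.1 hx
      obtain ⟨ζ, hζ, hle⟩ := hξ' η hη
      rcases hle.eq_or_lt with rfl | h
      · exact ⟨_, hζ, hx⟩
      · exact ⟨ζ, hζ, .inl (hx.mem_lev h)⟩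
    · rintro ⟨η, hη, hx⟩
      exact hx.mem_lev (hξ η hη)
  have hr : ∀ x y, pair x y ∈ levLe A ξ ↔ ∃ η ∈ B, StepLe A (lev A η) (levLe A η) x y := by
    intro x y
    constructor
    · intro hx
      obtain ⟨η, hη, hx⟩ := mem_levLe.1 hx
      obtain ⟨ζ, hζ, hle⟩ := hξ' η hη
      rcases hle.eq_or_lt with rfl | h
      · exact ⟨_, hζ, (wo_lev A _).pair_mem_StepR.1 hx⟩
      · exact ⟨ζ, hζ, .inl (mem_levLe.2 ⟨η, h, hx⟩)⟩
    · rintro ⟨η, hη, hx⟩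
      exact mem_levLe.2 ⟨η, hξ η hη, (wo_lev A _).pair_mem_StepR.2 hx⟩
  constructor
  · rintro ⟨h1, h2, h3⟩
    have hSeq : S = lev A ξ := by
      ext x
      rw [hS]
      constructor
      · intro hx
        obtain ⟨q, hq, i', o', rfl, hi', S', r', rfl, hst⟩ := h1 x hx
        obtain ⟨η, hη, he⟩ := hB i' hi' _ hq
        rw [lp, ZFSet.pair_inj] at he
        exact ⟨η, hη, he.1 ▸ hst⟩
      · rintro ⟨η, hη, hx⟩
        obtain ⟨i', hi', hq⟩ := hB' η hη
        obtain ⟨h4, h5, -⟩ := h2 _ hq i' _ rfl hi' _ _ rfl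
        rcases hx with hx | ⟨i, a, ha, b, hb, hc⟩
        · exact h4 x hx
        · obtain ⟨x', hx', hc'⟩ := h5 i a ha b hb
          rw [isCut_iff] at hc hc'
          rw [hc, ← hc']
          exact hx'
    refine ⟨hSeq, ?_⟩
    ext t
    constructor
    · intro ht
      obtain ⟨x, y, rfl, hx, hy, q, hq, i', o', rfl, hi', S', r', rfl, hst⟩ := h3 t ht
      rw [hr]
      obtain ⟨η, hη, he⟩ := hB i' hi' _ hq
      rw [lp, ZFSet.pair_inj] at he
      exact ⟨η, hη, he.1 ▸ he.2 ▸ hst⟩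
    · intro ht
      obtain ⟨x, hx, y, hy, rfl⟩ := (wo_lev A ξ).field t ht
      obtain ⟨η, hη, hst⟩ := (hr x y).1 ht
      obtain ⟨i', hi', hq⟩ := hB' η hη
      obtain ⟨-, -, h5⟩ := h2 _ hq i' _ rfl hi' _ _ rfl
      rw [← hSeq] at hx hy
      exact h5 x hx y hy hst
  · rintro ⟨rfl, rfl⟩
    refine ⟨fun x hx => ?_, ?_, fun t ht => ?_⟩
    · obtain ⟨η, hη, hst⟩ := (hS x).1 hx
      obtain ⟨i', hi', hq⟩ := hB' η hη
      exact ⟨_, hq, _, _, rfl, hi', _, _, rfl, hst⟩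
    · rintro q hq i' o' rfl hi' S' r' rfl
      obtain ⟨η, hη, he⟩ := hB i' hi' _ hq
      rw [lp, ZFSet.pair_inj] at he
      obtain ⟨rfl, rfl⟩ := he
      refine ⟨fun x hx => (hS x).2 ⟨η, hη, .inl hx⟩, fun i a ha b hb => ?_, fun x _ y _ hst =>
        (hr x y).2 ⟨η, hη, hst⟩⟩
      exact ⟨lev A η ∩ G A i a b, (hS _).2 ⟨η, hη, .inr ⟨i, a, ha, b, hb, isCut_iff.2 rfl⟩⟩,
        isCut_iff.2 rfl⟩
    · obtain ⟨x, hx, y, hy, rfl⟩ := (wo_lev A ξ).field t ht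
      obtain ⟨η, hη, hst⟩ := (hr x y).1 ht
      obtain ⟨i', hi', hq⟩ := hB' η hη
      exact ⟨x, y, rfl, hx, hy, _, hq, _, _, rfl, hi', _, _, rfl, hst⟩

/-- This bounds the ordinals whose levels lie in a given set, so that such ordinals have a least
strict upper bound. -/
theorem le_rank_lev (A : ZFSet.{u}) (ξ : Ordinal.{u}) : ξ ≤ (lev A ξ).rank :=
  StrictMono.le_apply (f := fun ξ => (lev A ξ).rank)
    (fun _ _ h => ZFSet.rank_lt_of_mem (lev_mem_lev h))

/-- ∈-induction on the index. Any set satisfying the bounded condition `IsSeq` lists true levels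
with their true orders; this absoluteness underlies condensation. -/
theorem IsSeq.eq_lp {K : ZFSet.{u}} (hK : IsSeq A K) (i : ZFSet.{u}) :
    ∀ o, pair i o ∈ K → ∃ ξ, o = lp A ξ := by
  induction i using ZFSet.inductionOn with
  | h i ih =>
  intro o ho
  obtain ⟨i1, o1, he, S, r, rfl, hentry⟩ := hK _ ho
  obtain ⟨rfl, rfl⟩ := ZFSet.pair_inj.1 he
  let B : Set Ordinal.{u} := {η | ∃ i' ∈ i, pair i' (lp A η) ∈ K}
  have hbdd : ∀ η ∈ B, η < K.rank := by
    rintro η ⟨i', -, hq⟩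
    refine (le_rank_lev A η).trans_lt ((?_ : _ < _).trans (ZFSet.rank_lt_of_mem hq))
    have h1 : (lev A η).rank < (lp A η).rank :=
      (ZFSet.rank_lt_of_mem (y := lev A η) (x := {lev A η}) (by simp)).trans
        (ZFSet.rank_lt_of_mem (by simp [lp, pair]))
    refine h1.trans ?_
    exact (ZFSet.rank_lt_of_mem (y := lp A η) (x := {i', lp A η}) (by simp)).trans
      (ZFSet.rank_lt_of_mem (by simp [pair]))
  -- The least strict upper bound of the ordinals of the entries with index in `i`.
  obtain ⟨ξ, hξ, hmin⟩ := WellFounded.has_min (wellFounded_lt (α := Ordinal.{u}))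
    {ξ | ∀ η ∈ B, η < ξ} ⟨K.rank, hbdd⟩
  refine ⟨ξ, ?_⟩
  have := (isEntry_iff (A := A) (ξ := ξ) B (fun i' hi' o ho => ?_) (fun η hη => hη) hξ
    (fun η hη => ?_)).1 hentry
  · rw [this.1, this.2, lp]
  · obtain ⟨η, rfl⟩ := ih i' hi' o ho
    exact ⟨η, ⟨i', hi', ho⟩, rfl⟩
  · by_contra hn
    push Not at hn
    exact hmin η hn hη

open ZFSet (pair prod)

/-! ### Definable relations -/

/-- Finite sequences coded as nested pairs, the last value first. -/
noncomputable def tup : {n : ℕ} → (Fin n → ZFSet.{u}) → ZFSet.{u}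
  | 0, _ => ∅
  | _ + 1, v => pair (Lst v) (tup (Fst v))

/-- The set of codes of sequences of length `n` in `m`. -/
noncomputable def pw (m : ZFSet.{u}) : ℕ → ZFSet.{u}
  | 0 => {∅}
  | n + 1 => prod m (pw m n)

variable {A m x y : ZFSet.{u}} {n : ℕ}

theorem tup_snoc (v : Fin n → ZFSet.{u}) (z : ZFSet.{u}) :
    tup (Fin.snoc (α := fun _ => ZFSet.{u}) v z) = pair z (tup v) := by
  rw [tup, fst_snoc]
  simp [Lst]

theorem snoc_fst_lst (v : Fin (n + 1) → ZFSet.{u}) :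
    Fin.snoc (α := fun _ => ZFSet.{u}) (Fst v) (Lst v) = v :=
  Fin.snoc_init_self (α := fun _ => ZFSet.{u}) v

theorem mem_pw : x ∈ pw m n ↔ ∃ v : Fin n → ZFSet.{u}, (∀ i, v i ∈ m) ∧ x = tup v := by
  induction n generalizing x with
  | zero =>
    simp only [pw, ZFSet.mem_singleton, tup]
    exact ⟨fun h => ⟨Fin.elim0, fun i => i.elim0, h⟩, fun ⟨_, _, h⟩ => h⟩
  | succ n ih =>
    simp only [pw, ZFSet.mem_prod]
    constructor
    · rintro ⟨a, ha, b, hb, rfl⟩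
      obtain ⟨v, hv, rfl⟩ := ih.1 hb
      exact ⟨Fin.snoc (α := fun _ => ZFSet.{u}) v a,
        fun i => Fin.lastCases (by simpa) (fun i => by simpa using hv i) i, (tup_snoc v a).symm⟩
    · rintro ⟨v, hv, rfl⟩
      exact ⟨Lst v, hv _, tup (Fst v), ih.2 ⟨_, fun i => hv _, rfl⟩, rfl⟩

theorem tup_mem_pw {v : Fin n → ZFSet.{u}} (hv : ∀ i, v i ∈ m) : tup v ∈ pw m n :=
  mem_pw.2 ⟨v, hv, rfl⟩

/-- `Rel A m E R`: `E` is a power of `m` and `R` is a relation on `m` obtained from the operations;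
these are the relations definable over `(m, ∈, A)` without parameters. -/
inductive Rel (A m : ZFSet.{u}) : ZFSet.{u} → ZFSet.{u} → Prop
  | base : Rel A m {∅} {∅}
  | diff {E R R'} : Rel A m E R → Rel A m E R' → Rel A m E (G A 1 R R')
  | weak {E R} : Rel A m E R → Rel A m (G A 2 m E) (G A 2 m R)
  | ins {E R} : Rel A m (G A 2 m E) R → Rel A m (G A 2 m (G A 2 m E)) (G A 4 R m)
  | ran {E R} : Rel A m (G A 2 m E) R → Rel A m E (G A 3 R R)
  | lt {E R} : Rel A m (G A 2 m (G A 2 m E)) R → Rel A m (G A 2 m (G A 2 m E)) (G A 5 R R)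
  | gt {E R} : Rel A m (G A 2 m (G A 2 m E)) R → Rel A m (G A 2 m (G A 2 m E)) (G A 6 R R)
  | eq {E R} : Rel A m (G A 2 m (G A 2 m E)) R → Rel A m (G A 2 m (G A 2 m E)) (G A 7 R R)
  | pred {E R} : Rel A m (G A 2 m E) R → Rel A m (G A 2 m E) (G A 8 R R)

theorem G_two : G A 2 x y = prod x y := by
  ext z
  simp only [mem_G, GMem, ZFSet.mem_prod]
  exact ⟨fun ⟨b, c, h, hb, hc⟩ => ⟨b, hb, c, hc, h⟩, fun ⟨b, hb, c, hc, h⟩ => ⟨b, c, h, hb, hc⟩⟩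

theorem pw_succ (A : ZFSet.{u}) : pw m (n + 1) = G A 2 m (pw m n) := by rw [G_two, pw]

theorem mem_G_two {A a b x y : ZFSet.{u}} : pair a b ∈ G A 2 x y ↔ a ∈ x ∧ b ∈ y := by
  rw [G_two, ZFSet.pair_mem_prod]

theorem Rel.subset {E R : ZFSet.{u}} (h : Rel A m E R) : R ⊆ E := by
  induction h with
  | base => exact subset_rfl
  | diff _ _ ih _ =>
    intro z hz
    exact ih (mem_G.1 hz).1
  | weak _ ih =>
    intro z hz
    rw [G_two] at hz ⊢
    obtain ⟨a, ha, b, hb, rfl⟩ := ZFSet.mem_prod.1 hz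
    exact ZFSet.pair_mem_prod.2 ⟨ha, ih hb⟩
  | ins _ ih =>
    intro z hz
    obtain ⟨e, _, rfl, b, c, rfl, hb, hp⟩ := mem_G.1 hz
    have := ih hp
    simp only [mem_G_two] at this ⊢
    exact ⟨this.1, hb, this.2⟩
  | ran _ ih =>
    intro z hz
    obtain ⟨_, hp, b, c, rfl, rfl⟩ := mem_G.1 hz
    exact (mem_G_two.1 (ih hp)).2
  | lt _ ih | gt _ ih | eq _ ih | pred _ ih =>
    intro z hz
    exact ih (mem_G.1 hz).1

/-- An element of `m`, as an element of the structure `(m, ∈, A)`. -/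
def PredModel.mk (A : ZFSet.{u}) (x : ZFSet.{u}) (hx : x ∈ m) : PredModel A m := ⟨x, hx⟩

theorem PredModel.ext_iff {a b : PredModel A m} : a = b ↔ a.1 = b.1 := Subtype.ext_iff

/-- A sequence of elements of `m`, as a sequence in the structure `(m, ∈, A)`. -/
def toModel (A : ZFSet.{u}) (v : Fin n → ZFSet.{u}) (hv : ∀ i, v i ∈ m) :
    Fin n → PredModel A m := fun i => .mk A (v i) (hv i)

theorem toModel_val {v : Fin n → ZFSet.{u}} (hv : ∀ i, v i ∈ m) (i : Fin n) :
    (toModel A v hv i).1 = v i := rfl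

/-- The relation `Q` on `m` is obtained from the operations. -/
def IsRel (A m : ZFSet.{u}) {n : ℕ} (Q : (Fin n → ZFSet.{u}) → Prop) : Prop :=
  ∃ R, Rel A m (pw m n) R ∧ ∀ v, (∀ i, v i ∈ m) → (tup v ∈ R ↔ Q v)

namespace IsRel

variable {Q Q' : (Fin n → ZFSet.{u}) → Prop}

theorem congr (h : IsRel A m Q) (h' : ∀ v, (∀ i, v i ∈ m) → (Q v ↔ Q' v)) : IsRel A m Q' := by
  obtain ⟨R, hR, hv⟩ := h
  exact ⟨R, hR, fun v hvm => (hv v hvm).trans (h' v hvm)⟩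

theorem diff (h : IsRel A m Q) (h' : IsRel A m Q') : IsRel A m (fun v => Q v ∧ ¬ Q' v) := by
  obtain ⟨R, hR, hv⟩ := h
  obtain ⟨R', hR', hv'⟩ := h'
  exact ⟨_, hR.diff hR', fun v hvm => by simp [mem_G, GMem, hv v hvm, hv' v hvm]⟩

theorem weak (h : IsRel A m Q) :
    IsRel A m (n := n + 1) (fun v => Q (Fst v)) := by
  obtain ⟨R, hR, hv⟩ := h
  refine ⟨_, (pw_succ A (m := m)).symm ▸ hR.weak, fun v hvm => ?_⟩
  rw [G_two, tup, ZFSet.pair_mem_prod]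
  simp [hvm, hv (Fst v) (fun i => hvm _)]

theorem top : IsRel A m (n := n) (fun _ => True) := by
  induction n with
  | zero => exact ⟨_, Rel.base, fun v _ => by simp [tup]⟩
  | succ n ih => exact ih.weak

theorem neg (h : IsRel A m Q) : IsRel A m (fun v => ¬ Q v) :=
  (top.diff h).congr fun v _ => by simp

theorem and (h : IsRel A m Q) (h' : IsRel A m Q') : IsRel A m (fun v => Q v ∧ Q' v) :=
  (h.diff h'.neg).congr fun v _ => by simp

/-- Since the last value is the outer first component of a tuple, quantifying it away is taking the
range, operation 3. -/
theorem ex {Q : (Fin (n + 1) → ZFSet.{u}) → Prop} (h : IsRel A m Q) :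
    IsRel A m (fun v => ∃ z ∈ m, Q (Fin.snoc (α := fun _ => ZFSet.{u}) v z)) := by
  obtain ⟨R, hR, hv⟩ := h
  rw [pw_succ A] at hR
  refine ⟨_, hR.ran, fun v hvm => ?_⟩
  have hs : ∀ z ∈ m, ∀ i, Fin.snoc (α := fun _ => ZFSet.{u}) v z i ∈ m := fun z hz i =>
    Fin.lastCases (by simpa) (fun i => by simpa using hvm i) i
  rw [mem_G]
  constructor
  · rintro ⟨_, hp, z, _, rfl, rfl⟩
    have hz : z ∈ m := (mem_G_two.1 (hR.subset hp)).1
    rw [← tup_snoc, hv _ (hs z hz)] at hp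
    exact ⟨z, hz, hp⟩
  · rintro ⟨z, hz, hQ⟩
    refine ⟨_, (hv _ (hs z hz)).2 hQ, z, _, tup_snoc v z, rfl⟩

/-- Operation 4 inserts a dummy value just before the last one. Together with dummies in last place
this reaches atomic relations between any two variables. -/
theorem ins {Q : ZFSet.{u} → (Fin n → ZFSet.{u}) → Prop}
    (h : IsRel A m (n := n + 1) (fun v => Q (Lst v) (Fst v))) :
    IsRel A m (n := n + 2) (fun v => Q (Lst v) (Fst (Fst v))) := by
  obtain ⟨R, hR, hv⟩ := h
  rw [pw_succ A] at hR
  refine ⟨_, (pw_succ A (m := m)).symm ▸ (pw_succ A (m := m)).symm ▸ hR.ins, fun v hvm => ?_⟩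
  have hvm' : ∀ i, Fin.snoc (α := fun _ => ZFSet.{u}) (Fst (Fst v)) (Lst v) i ∈ m := fun i =>
    Fin.lastCases (by simpa using hvm _) (fun i => by simpa using hvm _) i
  have := hv _ hvm'
  rw [tup_snoc] at this
  simp only [Lst, Fin.snoc_last, fst_snoc] at this
  rw [mem_G, tup, tup]
  refine Iff.trans ?_ this
  constructor
  · rintro ⟨e, d, he, b, c, rfl, hb, hp⟩
    obtain ⟨h1, he⟩ := ZFSet.pair_inj.1 he
    obtain ⟨-, h2⟩ := ZFSet.pair_inj.1 he
    rw [← h1, ← h2] at hp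
    exact hp
  · intro hp
    exact ⟨_, _, rfl, _, _, rfl, hvm _, hp⟩

theorem pred (i : Fin n) : IsRel A m (fun v => v i ∈ A) := by
  induction n with
  | zero => exact i.elim0
  | succ n ih =>
    refine Fin.lastCases ?_ (fun i => (ih i).weak) i
    obtain ⟨R, hR, hv⟩ := top (A := A) (m := m) (n := n + 1)
    rw [pw_succ A] at hR
    refine ⟨_, (pw_succ A (m := m)).symm ▸ hR.pred, fun v hvm => ?_⟩
    rw [mem_G]
    constructor
    · rintro ⟨-, b, c, h, hb⟩
      rw [← (ZFSet.pair_inj.1 h).1] at hb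
      exact hb
    · intro h
      exact ⟨(hv v hvm).2 trivial, _, _, rfl, h⟩

/-- Reduction of relations between two values to the last two values. -/
theorem of_last {P : ZFSet.{u} → ZFSet.{u} → Prop}
    (h1 : ∀ n, IsRel A m (n := n + 2) (fun v => P (Lst v) (Lst (Fst v))))
    (h2 : ∀ n, IsRel A m (n := n + 2) (fun v => P (Lst (Fst v)) (Lst v)))
    (h3 : ∀ n i, IsRel A m (n := n) (fun v => P (v i) (v i))) (i j : Fin n) :
    IsRel A m (fun v => P (v i) (v j)) := by
  have key : ∀ (P : ZFSet.{u} → ZFSet.{u} → Prop)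
      (h1 : ∀ n, IsRel A m (n := n + 2) (fun v => P (Lst v) (Lst (Fst v)))) (n : ℕ) (j : Fin n),
      IsRel A m (n := n + 1) (fun v => P (Lst v) (Fst v j)) := by
    intro P h1 n j
    induction n with
    | zero => exact j.elim0
    | succ n ih =>
      exact Fin.lastCases (h1 n) (fun j => (ih j).ins (Q := fun z v => P z (v j))) j
  induction n with
  | zero => exact i.elim0
  | succ n ih =>
    refine Fin.lastCases ?_ (fun i => ?_) i <;> refine Fin.lastCases ?_ (fun j => ?_) j
    · exact h3 _ _
    · exact key P h1 n j
    · exact key (fun a b => P b a) h2 n i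
    · exact (ih i j).weak

theorem mem (i j : Fin n) : IsRel A m (fun v => v i ∈ v j) := by
  refine of_last (P := fun a b => a ∈ b) (fun n => ?_) (fun n => ?_)
    (fun n i => top.neg.congr fun v _ => by simp [ZFSet.mem_irrefl]) i j
  all_goals
    obtain ⟨R, hR, hv⟩ := top (A := A) (m := m) (n := n + 2)
    rw [pw_succ A, pw_succ A] at hR
  · refine ⟨_, (pw_succ A (m := m)).symm ▸ (pw_succ A (m := m)).symm ▸ hR.lt, fun v hvm => ?_⟩
    rw [mem_G]
    constructor
    · rintro ⟨-, b, d, h, c, e, rfl, hbc⟩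
      obtain ⟨h1, h⟩ := ZFSet.pair_inj.1 h
      obtain ⟨h2, -⟩ := ZFSet.pair_inj.1 h
      rw [← h1, ← h2] at hbc
      exact hbc
    · intro h
      exact ⟨(hv v hvm).2 trivial, _, _, rfl, _, _, rfl, h⟩
  · refine ⟨_, (pw_succ A (m := m)).symm ▸ (pw_succ A (m := m)).symm ▸ hR.gt, fun v hvm => ?_⟩
    rw [mem_G]
    constructor
    · rintro ⟨-, b, d, h, c, e, rfl, hbc⟩
      obtain ⟨h1, h⟩ := ZFSet.pair_inj.1 h
      obtain ⟨h2, -⟩ := ZFSet.pair_inj.1 h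
      rw [← h1, ← h2] at hbc
      exact hbc
    · intro h
      exact ⟨(hv v hvm).2 trivial, _, _, rfl, _, _, rfl, h⟩

theorem eq (i j : Fin n) : IsRel A m (fun v => v i = v j) := by
  have (n : ℕ) : IsRel A m (n := n + 2) (fun v => Lst v = Lst (Fst v)) := by
    obtain ⟨R, hR, hv⟩ := top (A := A) (m := m) (n := n + 2)
    rw [pw_succ A, pw_succ A] at hR
    refine ⟨_, (pw_succ A (m := m)).symm ▸ (pw_succ A (m := m)).symm ▸ hR.eq, fun v hvm => ?_⟩
    rw [mem_G]
    constructor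
    · rintro ⟨-, b, d, h, c, e, rfl, hbc⟩
      obtain ⟨h1, h⟩ := ZFSet.pair_inj.1 h
      obtain ⟨h2, -⟩ := ZFSet.pair_inj.1 h
      rw [← h1, ← h2] at hbc
      exact hbc
    · intro h
      exact ⟨(hv v hvm).2 trivial, _, _, rfl, _, _, rfl, h⟩
  exact of_last (P := fun a b => a = b) this (fun n => (this n).congr fun v _ => eq_comm)
    (fun n i => top.congr fun v _ => by simp) i j

theorem sat (hm : m.IsTransitive) (φ : Fm n) : IsRel A m (Sat A φ) := by
  induction φ with
  | mem i j => exact mem i j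
  | pred i => exact pred i
  | neg φ ih => exact ih.neg
  | and φ ψ ih ih' => exact ih.and ih'
  | bex i φ ih =>
    -- Transitivity of `m` turns the bounded quantifier into a quantifier over `m`.
    refine ((mem (Fin.last _) i.castSucc).and ih).ex.congr fun v hv => ?_
    simp only [Sat, Fin.snoc_last, Fin.snoc_castSucc]
    exact ⟨fun ⟨z, _, h⟩ => ⟨z, h⟩, fun ⟨z, h⟩ => ⟨z, hm _ (hv i) h.1, h⟩⟩

/-- The sequence `w` is unique when it exists; the existential form makes realization a predicate of
arbitrary sequences of sets, as `IsRel` requires. -/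
theorem realize (φ : setPredLang.BoundedFormula Empty n) :
    IsRel A m (fun v => ∃ w : Fin n → PredModel A m, (∀ i, (w i).1 = v i) ∧
      φ.Realize default w) := by
  have hterm : ∀ {n} (t : setPredLang.Term (Empty ⊕ Fin n)), ∃ i : Fin n,
      ∀ w : Fin n → PredModel A m, t.realize (Sum.elim default w) = w i := by
    intro n t
    cases t with
    | var i =>
      rcases i with i | i
      · exact i.elim
      · exact ⟨i, fun w => rfl⟩
    | func f => exact Empty.elim f
  have hw : ∀ {n} {v : Fin n → ZFSet.{u}} (hv : ∀ i, v i ∈ m)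
      {P : (Fin n → PredModel A m) → Prop},
      (∃ w : Fin n → PredModel A m, (∀ i, (w i).1 = v i) ∧ P w) ↔ P (toModel A v hv) := by
    intro n v hv P
    constructor
    · rintro ⟨w, hw, hP⟩
      have : w = toModel A v hv := funext fun i => PredModel.ext_iff.2 (hw i)
      exact this ▸ hP
    · exact fun h => ⟨_, fun i => rfl, h⟩
  induction φ with
  | falsum => exact top.neg.congr fun v hv => by simp [FirstOrder.Language.BoundedFormula.Realize]
  | equal t₁ t₂ =>
    obtain ⟨i, hi⟩ := hterm t₁
    obtain ⟨j, hj⟩ := hterm t₂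
    refine (eq i j).congr fun v hv => ?_
    rw [hw hv]
    simp only [FirstOrder.Language.BoundedFormula.Realize, hi, hj]
    exact (PredModel.ext_iff (a := toModel A v hv i) (b := toModel A v hv j)).symm
  | rel r ts =>
    cases r with
    | pred =>
      obtain ⟨i, hi⟩ := hterm (ts 0)
      refine (pred i).congr fun v hv => ?_
      rw [hw hv]
      simp only [FirstOrder.Language.BoundedFormula.Realize]
      change _ ↔ ((ts 0).realize (Sum.elim default (toModel A v hv))).1 ∈ A
      rw [hi, toModel_val]
    | mem =>
      obtain ⟨i, hi⟩ := hterm (ts 0)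
      obtain ⟨j, hj⟩ := hterm (ts 1)
      refine (mem i j).congr fun v hv => ?_
      rw [hw hv]
      simp only [FirstOrder.Language.BoundedFormula.Realize]
      change _ ↔ ((ts 0).realize (Sum.elim default (toModel A v hv))).1 ∈
        ((ts 1).realize (Sum.elim default (toModel A v hv))).1
      rw [hi, hj, toModel_val, toModel_val]
  | imp f₁ f₂ ih₁ ih₂ =>
    refine (ih₁.and ih₂.neg).neg.congr fun v hv => ?_
    rw [hw hv, hw hv, hw hv]
    simp [FirstOrder.Language.BoundedFormula.Realize]
  | all f ih =>
    refine ih.neg.ex.neg.congr fun v hv => ?_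
    rw [hw hv]
    simp only [FirstOrder.Language.BoundedFormula.Realize, not_exists, not_and]
    have key : ∀ z (hz : z ∈ m), (∃ w : Fin _ → PredModel A m,
        (∀ i, (w i).1 = Fin.snoc (α := fun _ => ZFSet.{u}) v z i) ∧ f.Realize default w) ↔
        f.Realize default (Fin.snoc (α := fun _ => PredModel A m) (toModel A v hv) (.mk A z hz)) := by
      intro z hz
      rw [hw (fun i => Fin.lastCases (by simpa) (fun i => by simpa using hv i) i)]
      refine iff_of_eq (congrArg _ (funext fun i => ?_))
      refine PredModel.ext_iff.2 ?_
      rw [toModel_val]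
      refine Fin.lastCases ?_ (fun i => ?_) i
      · rw [Fin.snoc_last, Fin.snoc_last]; rfl
      · rw [Fin.snoc_castSucc, Fin.snoc_castSucc, toModel_val]
    constructor
    · intro h x
      exact (key x.1 x.2).1 (by simpa using h x.1 x.2)
    · intro h z hz
      have := (key z hz).2 (h (.mk A z hz))
      simpa using this

end IsRel

/-! ### Relations generated by the operations are first-order definable -/

/-- The values of a sequence in the structure `(m, ∈, A)`. -/
def vals {ι : Type*} (w : ι → PredModel A m) : ι → ZFSet.{u} := fun i => (w i).1

theorem vals_mem {ι : Type*} (w : ι → PredModel A m) (i : ι) : vals w i ∈ m := (w i).2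

theorem fst_vals (w : Fin (n + 1) → PredModel A m) :
    Fst (vals w) = vals (w ∘ Fin.castSucc) := rfl

/-- For nonempty `m` the factor `E` can be read off from its product with `m`, and no such product
is {∅}. For empty `m` all positive powers coincide and the arity is lost. -/
theorem exists_pw_of_prod_eq {E : ZFSet.{u}} (hm : m.Nonempty) (h : G A 2 m E = pw m n) :
    ∃ k, n = k + 1 ∧ E = pw m k := by
  cases n with
  | zero =>
    have h0 : (∅ : ZFSet) ∈ G A 2 m E := by rw [h]; simp [pw]
    obtain ⟨b, c, h0, -⟩ := mem_G.1 h0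
    exact absurd (h0 ▸ (by simp [pair] : ({b} : ZFSet.{u}) ∈ pair b c)) (ZFSet.notMem_empty _)
  | succ k =>
    refine ⟨k, rfl, ?_⟩
    obtain ⟨x, hx⟩ := hm
    ext z
    rw [pw_succ A] at h
    have := mem_G_two (A := A) (a := x) (b := z) (x := m) (y := E)
    rw [h, mem_G_two] at this
    have hx : x ∈ m := hx
    simp only [hx, true_and] at this
    exact this.symm

theorem Rel.exists_eq_pw {E R : ZFSet.{u}} (h : Rel A m E R) (hm : m.Nonempty) :
    ∃ n, E = pw m n := by
  have hs : ∀ E : ZFSet.{u}, (∃ n, E = pw m n) → ∃ n, G A 2 m E = pw m n := by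
    rintro _ ⟨n, rfl⟩
    exact ⟨n + 1, (pw_succ A).symm⟩
  induction h with
  | base => exact ⟨0, rfl⟩
  | diff _ _ ih _ | lt _ ih | gt _ ih | eq _ ih | pred _ ih => exact ih
  | weak _ ih | ins _ ih => exact hs _ ih
  | ran _ ih =>
    obtain ⟨n, hn⟩ := ih
    obtain ⟨k, -, h⟩ := exists_pw_of_prod_eq hm hn
    exact ⟨k, h⟩

/-- The relation `Q` on `m` is definable over `(m, ∈, A)` without parameters. -/
def IsDef (A m : ZFSet.{u}) (Q : (Fin n → ZFSet.{u}) → Prop) : Prop :=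
  (∅ : Set (PredModel A m)).Definable setPredLang {w : Fin n → PredModel A m | Q (vals w)}

namespace IsDef

variable {Q Q' : (Fin n → ZFSet.{u}) → Prop}

theorem congr (h : IsDef A m Q) (h' : ∀ v, (∀ i, v i ∈ m) → (Q v ↔ Q' v)) : IsDef A m Q' := by
  rw [IsDef] at h ⊢
  convert h using 1
  ext w
  exact (h' _ (vals_mem w)).symm

theorem and (h : IsDef A m Q) (h' : IsDef A m Q') : IsDef A m (fun v => Q v ∧ Q' v) :=
  Set.Definable.inter h h'

theorem diff (h : IsDef A m Q) (h' : IsDef A m Q') : IsDef A m (fun v => Q v ∧ ¬ Q' v) :=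
  Set.Definable.sdiff h h'

theorem rename {k : ℕ} {Q : (Fin k → ZFSet.{u}) → Prop} (h : IsDef A m Q) (f : Fin k → Fin n) :
    IsDef A m (fun v => Q (fun i => v (f i))) :=
  Set.Definable.preimage_comp f h

theorem ex {Q : (Fin (n + 1) → ZFSet.{u}) → Prop} (h : IsDef A m Q) :
    IsDef A m (fun v => ∃ z ∈ m, Q (Fin.snoc (α := fun _ => ZFSet.{u}) v z)) := by
  have := Set.Definable.image_comp h (Fin.castSucc : Fin n → Fin (n + 1))
  rw [IsDef]
  convert this using 1
  ext w
  simp only [Set.mem_ofPred_eq, Set.mem_image]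
  constructor
  · rintro ⟨z, hz, hQ⟩
    refine ⟨Fin.snoc (α := fun _ => PredModel A m) w (.mk A z hz), ?_, ?_⟩
    · convert hQ using 1
      funext i
      refine Fin.lastCases ?_ (fun i => ?_) i
      · rw [vals, Fin.snoc_last, Fin.snoc_last]; rfl
      · rw [vals, Fin.snoc_castSucc, Fin.snoc_castSucc]; rfl
    · funext i
      exact Fin.snoc_castSucc (α := fun _ => PredModel A m) _ _ i
  · rintro ⟨w, hw, rfl⟩
    refine ⟨Lst (vals w), vals_mem w _, ?_⟩
    rw [← fst_vals, snoc_fst_lst]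
    exact hw

open FirstOrder.Language in
theorem atom {k : ℕ} (r : setPredLang.Relations k) (f : Fin k → Fin n) :
    (∅ : Set (PredModel A m)).Definable setPredLang
      {w : Fin n → PredModel A m | Structure.RelMap r (w ∘ f)} := by
  rw [Set.empty_definable_iff]
  refine ⟨Relations.formula r fun i => Term.var (f i), ?_⟩
  ext w
  change Structure.RelMap r (w ∘ f) ↔
    Formula.Realize (Relations.formula r fun i => Term.var (f i)) w
  rw [Formula.realize_rel]
  rfl

theorem mem (i j : Fin n) : IsDef A m (fun v => v i ∈ v j) := atom SetPredRel.mem ![i, j]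

theorem pred (i : Fin n) : IsDef A m (fun v => v i ∈ A) := atom SetPredRel.pred ![i]

open FirstOrder.Language in
theorem eq (i j : Fin n) : IsDef A m (fun v => v i = v j) := by
  rw [IsDef, Set.empty_definable_iff]
  exact ⟨Term.equal (Term.var i) (Term.var j), by
    ext w; simp [Formula.realize_equal, vals, PredModel.ext_iff]⟩

end IsDef

/-- `Rel` records only the ambient power and not its arity, so the induction recovers the arity from
`E`, for which `m` must be nonempty. -/
theorem Rel.isDef {E R : ZFSet.{u}} (h : Rel A m E R) (hm : m.Nonempty) (n : ℕ)
    (hn : E = pw m n) : IsDef A m (fun v : Fin n → ZFSet.{u} => tup v ∈ R) := by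
  -- Operations 5, 6 and 7 all select the tuples whose last two values satisfy a binary relation
  -- `P`; they are treated at once.
  have key : ∀ (P : ZFSet.{u} → ZFSet.{u} → Prop) (R : ZFSet.{u}) (E : ZFSet.{u}) (i : Fin 10),
      (∀ n (i j : Fin n), IsDef A m (fun v => P (v i) (v j))) →
      (∀ a x y, GMem i A a x y ↔ a ∈ x ∧ ∃ b d, a = pair b d ∧ ∃ c e, d = pair c e ∧ P b c) →
      (∀ n, G A 2 m (G A 2 m E) = pw m n →
        IsDef A m (fun v : Fin n → ZFSet.{u} => tup v ∈ R)) →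
      ∀ n, G A 2 m (G A 2 m E) = pw m n →
        IsDef A m (fun v : Fin n → ZFSet.{u} => tup v ∈ G A i R R) := by
    intro P R E i hP hG ih n hn
    obtain ⟨k, rfl, hn'⟩ := exists_pw_of_prod_eq hm hn
    obtain ⟨k, rfl, -⟩ := exists_pw_of_prod_eq hm hn'
    refine ((ih _ hn).and (hP _ (Fin.last _) (Fin.last _).castSucc)).congr (Q := fun v =>
      tup v ∈ R ∧ P (Lst v) (Lst (Fst v))) fun v hv => ?_
    rw [mem_G, hG]
    refine and_congr_right fun _ => ⟨fun h => ⟨_, _, rfl, _, _, rfl, h⟩, ?_⟩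
    rintro ⟨b, d, h, c, e, rfl, hP⟩
    obtain ⟨h1, h⟩ := ZFSet.pair_inj.1 h
    obtain ⟨h2, -⟩ := ZFSet.pair_inj.1 h
    rw [← h1, ← h2] at hP
    exact hP
  induction h generalizing n with
  | base =>
    obtain rfl : n = 0 := by
      cases n with
      | zero => rfl
      | succ n =>
        obtain ⟨x, hx⟩ := hm
        have : tup (fun _ : Fin (n + 1) => x) ∈ ({∅} : ZFSet.{u}) :=
          hn ▸ tup_mem_pw fun _ => hx
        simp only [ZFSet.mem_singleton, tup] at this
        exact absurd (this ▸ (by simp [pair] : ({x} : ZFSet.{u}) ∈ pair x _))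
          (ZFSet.notMem_empty _)
    refine IsDef.congr (Q := fun _ => True) ?_ fun v _ => by simp [tup]
    exact Set.definable_univ
  | diff _ _ ih ih' =>
    exact ((ih n hn).diff (ih' n hn)).congr fun v _ => by simp [mem_G, GMem]
  | weak _ ih =>
    obtain ⟨k, rfl, hk⟩ := exists_pw_of_prod_eq hm hn.symm.symm
    refine ((ih k hk).rename Fin.castSucc).congr fun v hv => ?_
    rw [tup, mem_G_two]
    exact (and_iff_right (hv _)).symm
  | ins _ ih =>
    obtain ⟨k, rfl, hk⟩ := exists_pw_of_prod_eq hm hn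
    obtain ⟨k, rfl, hk'⟩ := exists_pw_of_prod_eq hm hk
    refine ((ih _ hk).rename (Fin.snoc (α := fun _ => Fin (k + 2))
      (fun i => i.castSucc.castSucc) (Fin.last _))).congr fun v hv => ?_
    rw [tup, fst_comp_snoc, mem_G, tup, tup]
    simp only [Lst, Fin.snoc_last]
    constructor
    · intro hp
      exact ⟨_, _, rfl, _, _, rfl, hv _, hp⟩
    · rintro ⟨e, d, he, b, c, rfl, hb, hp⟩
      obtain ⟨h1, he⟩ := ZFSet.pair_inj.1 he
      obtain ⟨-, h2⟩ := ZFSet.pair_inj.1 he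
      rw [← h1, ← h2] at hp
      exact hp
  | ran h ih =>
    refine (ih (n + 1) (by rw [pw_succ A, hn])).ex.congr fun v hv => ?_
    simp only [tup_snoc]
    rw [mem_G]
    constructor
    · rintro ⟨z, hz, hp⟩
      exact ⟨_, hp, _, _, rfl, rfl⟩
    · rintro ⟨_, hp, z, _, rfl, rfl⟩
      exact ⟨z, (mem_G_two.1 (h.subset hp)).1, hp⟩
  | lt _ ih => exact key (fun a b => a ∈ b) _ _ 5 (fun _ => IsDef.mem) (fun _ _ _ => Iff.rfl) ih n hn
  | gt _ ih =>
    exact key (fun a b => b ∈ a) _ _ 6 (fun _ i j => IsDef.mem j i) (fun _ _ _ => Iff.rfl) ih n hn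
  | eq _ ih => exact key (fun a b => a = b) _ _ 7 (fun _ => IsDef.eq) (fun _ _ _ => Iff.rfl) ih n hn
  | pred _ ih =>
    obtain ⟨k, rfl, hn'⟩ := exists_pw_of_prod_eq hm hn
    refine ((ih _ hn).and (IsDef.pred (Fin.last _))).congr fun v hv => ?_
    rw [mem_G]
    refine and_congr_right fun _ => ⟨fun h => ⟨_, _, rfl, h⟩, ?_⟩
    rintro ⟨b, d, h, hb⟩
    rw [← (ZFSet.pair_inj.1 h).1] at hb
    exact hb

theorem IsDef.sat (hm : m.IsTransitive) (hm' : m.Nonempty) (φ : Fm n) : IsDef A m (Sat A φ) := by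
  obtain ⟨R, hR, hv⟩ := IsRel.sat (A := A) hm φ
  exact (hR.isDef hm' n rfl).congr hv


/-! ### Definable subsets -/

/-- `x` is a section of a relation on `m` obtained from the operations. -/
def IsSection (A m x : ZFSet.{u}) : Prop :=
  x ⊆ m ∧ ∃ E R t, Rel A m (G A 2 m E) R ∧ t ∈ E ∧ ∀ y ∈ m, y ∈ x ↔ pair y t ∈ R

theorem IsRel.isSection {Q : (Fin (n + 1) → ZFSet.{u}) → Prop} (h : IsRel A m Q) (hx : x ⊆ m)
    {v : Fin n → ZFSet.{u}} (hv : ∀ i, v i ∈ m)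
    (hQ : ∀ y ∈ m, y ∈ x ↔ Q (Fin.snoc (α := fun _ => ZFSet.{u}) v y)) : IsSection A m x := by
  obtain ⟨R, hR, hvR⟩ := h
  refine ⟨hx, pw m n, R, tup v, pw_succ A ▸ hR, tup_mem_pw hv, fun y hy => ?_⟩
  rw [hQ y hy, ← hvR, tup_snoc]
  exact fun i => Fin.lastCases (by simpa) (fun i => by simpa using hv i) i

open FirstOrder.Language in
theorem IsSection.of_definable (hx : x ⊆ m)
    (h : Set.Definable₁ (Set.univ : Set (PredModel A m)) setPredLang {y : PredModel A m | y.1 ∈ x}) :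
    IsSection A m x := by
  classical
  obtain ⟨φ, hφ⟩ := Set.definable_iff_exists_formula_sum.1 h
  rcases m.eq_empty_or_nonempty with rfl | ⟨m0, hm0⟩
  · exact ⟨hx, {∅}, _, ∅, Rel.base.weak, by simp, fun y hy => absurd hy (ZFSet.notMem_empty y)⟩
  let s := φ.freeVarFinset
  let e := s.equivFin
  let f : s → Fin (s.card + 1) := fun z => Sum.elim (fun _ => (e z).castSucc)
    (fun _ => Fin.last _) z.1
  -- The parameters of the formula are numbered through `e`. The default `m0` only fills the slot
  -- belonging to the variable of the section, which `f` moves to the last place.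
  let p : Fin s.card → PredModel A m := fun i =>
    Sum.elim (fun a => a.1) (fun _ => PredModel.mk A m0 hm0) (e.symm i).1
  have hreal : ∀ y : PredModel A m, y.1 ∈ x ↔ (BoundedFormula.restrictFreeVar φ f).Realize
      (Fin.snoc (α := fun _ => PredModel A m) p y) default := by
    intro y
    rw [BoundedFormula.realize_restrictFreeVar (Sum.elim (fun a => a.1) (fun _ : Fin 1 => y))]
    · exact Set.ext_iff.1 hφ (fun _ => y)
    · rintro ⟨z | z, hz⟩
      · simp only [f, Sum.elim_inl, Fin.snoc_castSucc, p, Equiv.symm_apply_apply]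
      · simp only [f, Sum.elim_inr, Fin.snoc_last]
  refine (IsRel.realize (A := A) (m := m) (BoundedFormula.relabel
    (Sum.inr : Fin (s.card + 1) → Empty ⊕ Fin (s.card + 1))
      (BoundedFormula.restrictFreeVar φ f))).isSection hx (v := vals p) (vals_mem p) fun y hy => ?_
  refine (hreal (.mk A y hy)).trans ?_
  have hval : ∀ i, ((Fin.snoc (α := fun _ => PredModel A m) p (PredModel.mk A y hy) :
      Fin (s.card + 1) → PredModel A m) i).1 =
      (Fin.snoc (α := fun _ => ZFSet.{u}) (vals p) y : Fin (s.card + 1) → ZFSet.{u}) i := by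
    intro i
    refine Fin.lastCases ?_ (fun i => ?_) i
    · rw [Fin.snoc_last, Fin.snoc_last]; rfl
    · rw [Fin.snoc_castSucc, Fin.snoc_castSucc]; rfl
  constructor
  · intro h
    exact ⟨_, hval, (Formula.realize_relabel_sumInr _).2 h⟩
  · rintro ⟨w, hw, h⟩
    have : w = Fin.snoc (α := fun _ => PredModel A m) p (PredModel.mk A y hy) :=
      funext fun i => PredModel.ext_iff.2 ((hw i).trans (hval i).symm)
    exact this ▸ (Formula.realize_relabel_sumInr _).1 h

open FirstOrder.Language in
theorem IsSection.definable (h : IsSection A m x) :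
    Set.Definable₁ (Set.univ : Set (PredModel A m)) setPredLang {y : PredModel A m | y.1 ∈ x} := by
  obtain ⟨hx, E, R, t, hR, ht, hy⟩ := h
  rcases m.eq_empty_or_nonempty with rfl | hm
  · have : {y : PredModel A ∅ | y.1 ∈ x} = ∅ := by
      ext y
      exact absurd y.2 (ZFSet.notMem_empty _)
    rw [this]
    exact Set.definable_empty
  obtain ⟨k, hk⟩ := hR.exists_eq_pw hm
  obtain ⟨n, rfl, rfl⟩ := exists_pw_of_prod_eq hm hk
  obtain ⟨v, hv, rfl⟩ := mem_pw.1 ht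
  obtain ⟨φ, hφ⟩ := Set.empty_definable_iff.1 (hR.isDef hm _ hk)
  refine Set.definable_iff_exists_formula_sum.2 ⟨φ.relabel
    (Fin.snoc (α := fun _ => (Set.univ : Set (PredModel A m)) ⊕ Fin 1)
      (fun i => Sum.inl ⟨.mk A (v i) (hv i), trivial⟩) (Sum.inr 0)), ?_⟩
  ext w
  have h1 := hy _ (w 0).2
  rw [← tup_snoc] at h1
  change (w 0).1 ∈ x ↔ Formula.Realize _ _
  rw [h1, Formula.realize_relabel]
  have h2 := Set.ext_iff.1 hφ (Sum.elim (fun a => a.1) w ∘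
    (Fin.snoc (α := fun _ => (Set.univ : Set (PredModel A m)) ⊕ Fin 1)
      (fun i => Sum.inl ⟨.mk A (v i) (hv i), trivial⟩) (Sum.inr 0)))
  refine Iff.trans (iff_of_eq ?_) h2
  refine congrArg (fun v => tup v ∈ R) (funext fun i => ?_)
  refine Fin.lastCases ?_ (fun i => ?_) i
  · simp [vals]
  · simp [vals, PredModel.mk]

theorem mem_defPowerset : x ∈ defPowerset A m ↔ IsSection A m x := by
  rw [defPowerset, ZFSet.mem_sep, ZFSet.mem_powerset]
  exact ⟨fun h => IsSection.of_definable h.1 h.2, fun h => ⟨h.1, h.definable⟩⟩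

/-! ### Bounded separation -/

/-- The set `X` is closed under the operations. -/
def GClosed (A X : ZFSet.{u}) : Prop := ∅ ∈ X ∧ ∀ i, ∀ x ∈ X, ∀ y ∈ X, G A i x y ∈ X

theorem GClosed.rel {X E R : ZFSet.{u}} (hX : GClosed A X) (hm : m ∈ X) (hm' : m.Nonempty) (h : Rel A m E R) :
    E ∈ X ∧ R ∈ X := by
  induction h with
  | base =>
    have : G A 0 ∅ ∅ = ({∅} : ZFSet.{u}) := by ext; simp [mem_G, GMem]
    have := this ▸ hX.2 0 ∅ hX.1 ∅ hX.1
    exact ⟨this, this⟩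
  | diff _ _ ih ih' => exact ⟨ih.1, hX.2 _ _ ih.2 _ ih'.2⟩
  | weak _ ih => exact ⟨hX.2 _ _ hm _ ih.1, hX.2 _ _ hm _ ih.2⟩
  | ins _ ih => exact ⟨hX.2 _ _ hm _ ih.1, hX.2 _ _ ih.2 _ hm⟩
  | @ran E R h ih =>
    refine ⟨?_, hX.2 _ _ ih.2 _ ih.2⟩
    obtain ⟨x, hx⟩ := hm'
    have : G A 3 (G A 2 m E) (G A 2 m E) = E := by
      ext z
      rw [mem_G]
      constructor
      · rintro ⟨_, hp, b, c, rfl, rfl⟩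
        exact (mem_G_two.1 hp).2
      · intro hz
        exact ⟨_, mem_G_two.2 ⟨hx, hz⟩, _, _, rfl, rfl⟩
    exact this ▸ hX.2 _ _ ih.1 _ ih.1
  | lt _ ih | gt _ ih | eq _ ih | pred _ ih => exact ⟨ih.1, hX.2 _ _ ih.2 _ ih.2⟩

/-- Operation 9 yields the section of `R` at `t` in one application; it remains that `R` and `t` are
in `X`, for which `X` has to contain the power `E` and be transitive. -/
theorem GClosed.section_mem {X : ZFSet.{u}} (hX : GClosed A X) (hXt : X.IsTransitive) (hm : m ∈ X)
    (h : IsSection A m x) : x ∈ X := by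
  obtain ⟨hx, E, R, t, hR, ht, hy⟩ := h
  rcases m.eq_empty_or_nonempty with rfl | hne
  · have : x = ∅ := by
      rw [ZFSet.eq_empty]
      exact fun y hy => ZFSet.notMem_empty y (hx hy)
    exact this ▸ hX.1
  · have hE : E ∈ X ∧ E ∈ X := by
      obtain ⟨k, hk⟩ := hR.exists_eq_pw hne
      obtain ⟨n, rfl, rfl⟩ := exists_pw_of_prod_eq hne hk
      obtain ⟨R', hR', -⟩ := IsRel.top (A := A) (m := m) (n := n)
      have := (hX.rel hm hne hR').1
      exact ⟨this, this⟩
    have := hX.2 9 _ (hX.rel hm hne hR).2 _ (hXt _ hE.1 ht)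
    convert this using 1
    ext y
    rw [mem_G]
    constructor
    · intro h
      exact (hy y (hx h)).1 h
    · intro h
      exact (hy y (mem_G_two.1 (hR.subset h)).1).2 h

/-- A transitive `m` evaluates bounded formulas correctly, so the separated set is definable over
`m`, with `w` as one more parameter. -/
theorem isSection_sep (hm : m.IsTransitive) (φ : Fm (n + 1)) {v : Fin n → ZFSet.{u}}
    (hv : ∀ i, v i ∈ m) {w : ZFSet.{u}} (hw : w ∈ m) :
    IsSection A m (ZFSet.sep (fun t => Sat A φ (Fin.snoc (α := fun _ => ZFSet.{u}) v t)) w) := by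
  have h := (IsRel.mem (A := A) (m := m) (Fin.last (n + 1)) (Fin.last n).castSucc).and
    (IsRel.sat hm (φ.rename (Fin.snoc (α := fun _ => Fin (n + 2))
      (fun i => i.castSucc.castSucc) (Fin.last _))))
  refine h.isSection (v := Fin.snoc (α := fun _ => ZFSet.{u}) v w) (fun t ht => ?_)
    (fun i => Fin.lastCases (by simpa) (fun i => by simpa using hv i) i) fun y hy => ?_
  · exact hm _ hw (ZFSet.mem_sep.1 ht).1
  · rw [ZFSet.mem_sep, sat_rename]
    simp only [Fin.snoc_last, Fin.snoc_castSucc]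
    refine and_congr_right fun _ => iff_of_eq (congrArg _ (funext fun i => ?_))
    refine Fin.lastCases ?_ (fun i => ?_) i <;> simp

variable {ξ η : Ordinal.{u}}

theorem pair_mem_lev (hξ : η + 2 ≤ ξ) (hx : x ∈ lev A η) (hy : y ∈ lev A η) :
    pair x y ∈ lev A ξ := by
  have up : ∀ {η : Ordinal.{u}} {x y}, x ∈ lev A η → y ∈ lev A η → ({x, y} : ZFSet) ∈ lev A (η + 1) := by
    intro η x y hx hy
    have := cut_mem_lev (A := A) (Order.lt_add_one_iff.2 (le_refl η)) 0 (.inl hx) (.inl hy)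
    convert this using 1
    ext z
    simp only [ZFSet.mem_pair, ZFSet.mem_inter, mem_G, GMem]
    refine ⟨fun h => ⟨?_, h⟩, fun h => h.2⟩
    rcases h with rfl | rfl
    · exact hx
    · exact hy
  have h1 := up (up hx hx) (up hx hy)
  rw [add_assoc, one_add_one_eq_two] at h1
  refine lev_mono hξ ?_
  simpa [pair] using h1

/-- The values of the operations at elements of level δ are subsets of level δ + 4, as the worst
case consists of two nested pairs at two levels each. They are therefore cuts of that level and
appear one step later. -/
theorem gClosed_lev (hξ : Order.IsSuccLimit ξ) : GClosed A (lev A ξ) := by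
  have hlt : ∀ {η}, η < ξ → ∀ n : ℕ, η + n < ξ := by
    intro η hη n
    induction n with
    | zero => simpa
    | succ n ih =>
      rw [Nat.cast_succ, ← add_assoc]
      exact hξ.add_one_lt ih
  refine ⟨?_, fun i x hx y hy => ?_⟩
  · have h0 : lev A 0 = ∅ := by
      rw [ZFSet.eq_empty]
      intro y hy
      obtain ⟨η, hη, -⟩ := mem_lev.1 hy
      exact absurd hη (by simp)
    exact h0 ▸ lev_mem_lev hξ.bot_lt
  · obtain ⟨η, hη, hx⟩ := (mem_lev_of_isSuccLimit hξ).1 hx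
    obtain ⟨ζ, hζ, hy⟩ := (mem_lev_of_isSuccLimit hξ).1 hy
    obtain ⟨δ, hδ, hx, hy⟩ : ∃ δ < ξ, x ∈ lev A δ ∧ y ∈ lev A δ :=
      ⟨max η ζ, max_lt hη hζ, lev_mono (le_max_left _ _) hx, lev_mono (le_max_right _ _) hy⟩
    have ht := isTransitive_lev A δ
    have hl : ∀ {a b z : ZFSet.{u}}, z ∈ lev A δ → pair a b ∈ z → a ∈ lev A δ ∧ b ∈ lev A δ := by
      intro a b z hz hp
      have h1 := ht _ hz hp
      exact ⟨ht _ (ht _ h1 (by simp [pair] : ({a} : ZFSet) ∈ pair a b)) (by simp),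
        ht _ (ht _ h1 (by simp [pair] : ({a, b} : ZFSet) ∈ pair a b)) (by simp)⟩
    have hsub : G A i x y ⊆ lev A (δ + (4 : ℕ)) := by
      have h0 : lev A δ ⊆ lev A (δ + (4 : ℕ)) := lev_mono le_self_add
      have h2 : lev A (δ + 2) ⊆ lev A (δ + (4 : ℕ)) := lev_mono (by
        gcongr; exact_mod_cast (by norm_num : (2 : ℕ) ≤ 4))
      have h4 : δ + 2 + 2 ≤ δ + (4 : ℕ) := by
        rw [add_assoc]
        exact_mod_cast le_rfl
      intro a ha
      rw [mem_G] at ha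
      fin_cases i <;> dsimp only [GMem] at ha
      · rcases ha with rfl | rfl
        · exact h0 hx
        · exact h0 hy
      · exact h0 (ht _ hx ha.1)
      · obtain ⟨b, c, rfl, hb, hc⟩ := ha
        exact h2 (pair_mem_lev le_rfl (ht _ hx hb) (ht _ hy hc))
      · obtain ⟨_, hp, b, c, rfl, rfl⟩ := ha
        exact h0 (hl hx hp).2
      · obtain ⟨e, d, rfl, b, c, rfl, hb, hp⟩ := ha
        exact pair_mem_lev h4 (lev_mono le_self_add (hl hx hp).1)
          (pair_mem_lev le_rfl (ht _ hy hb) (hl hx hp).2)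
      · exact h0 (ht _ hx ha.1)
      · exact h0 (ht _ hx ha.1)
      · exact h0 (ht _ hx ha.1)
      · exact h0 (ht _ hx ha.1)
      · exact h0 (hl hx ha).1
    have := cut_mem_lev (A := A) (hlt hδ 4) i (.inl (lev_mono le_self_add hx))
      (.inl (lev_mono le_self_add hy))
    convert this using 1
    ext a
    rw [ZFSet.mem_inter]
    exact ⟨fun h => ⟨hsub h, h⟩, fun h => h.2⟩

theorem section_mem_lev (hξ : Order.IsSuccLimit ξ) (hm : m ∈ lev A ξ) (h : IsSection A m x) :
    x ∈ lev A ξ :=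
  (gClosed_lev hξ).section_mem (isTransitive_lev A ξ) hm h

open ZFSet (pair)

/-! ### Hierarchies satisfying bounded separation -/

/-- Regularity keeps the supremum below `c.ord`; adding ω makes the bound a limit and strict. -/
theorem exists_isSuccLimit_bound {c : Cardinal.{u}} (hc : c.IsRegular) (hc' : ℵ₀ < c)
    {Z : ZFSet.{u}} (hZ : Z.card < c) (g : ZFSet.{u} → Ordinal.{u})
    (hg : ∀ z ∈ Z, g z < c.ord) :
    ∃ γ < c.ord, Order.IsSuccLimit γ ∧ ∀ z ∈ Z, g z < γ := by
  have h := Ordinal.iSup_lt_of_lt_cof (f := fun z : Shrink.{u} Z => g ((equivShrink Z).symm z).1)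
    (by rwa [hc.cof_ord]) (fun z => hg _ (Subtype.prop _))
  refine ⟨_, Ordinal.isPrincipal_add_ord hc.aleph0_le h (omega0_lt_ord.2 hc'),
    Ordinal.isSuccLimit_add _ Ordinal.isSuccLimit_omega0, fun z hz => ?_⟩
  have h1 : g z ≤ ⨆ z : Shrink.{u} Z, g ((equivShrink Z).symm z).1 := by
    have := Ordinal.le_iSup (fun z : Shrink.{u} Z => g ((equivShrink Z).symm z).1)
      (equivShrink Z ⟨z, hz⟩)
    simpa using this
  exact h1.trans_lt (lt_add_of_pos_right _ Ordinal.omega0_pos)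

/-- Interpretation of the predicate by a variable. -/
def Fm.subst : {n : ℕ} → Fm n → Fin n → Fm n
  | _, .mem i j, _ => .mem i j
  | _, .pred i, j => .mem i j
  | _, .neg φ, j => .neg (φ.subst j)
  | _, .and φ ψ, j => .and (φ.subst j) (ψ.subst j)
  | _, .bex i φ, j => .bex i (φ.subst j.castSucc)

theorem sat_subst {A : ZFSet.{u}} {n : ℕ} (φ : Fm n) (j : Fin n) (v : Fin n → ZFSet.{u}) :
    Sat A (φ.subst j) v ↔ Sat (v j) φ v := by
  induction φ with
  | mem i k => rfl
  | pred i => rfl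
  | neg φ ih => simp only [Fm.subst, Sat, ih]
  | and φ ψ ih ih' => simp only [Fm.subst, Sat, ih, ih']
  | bex i φ ih => simp only [Fm.subst, Sat, ih, Fin.snoc_castSucc]

theorem D0.subst {n : ℕ} {Q : ZFSet.{u} → (Fin n → ZFSet.{u}) → Prop} (h : D0 Q) (j : Fin n) :
    D0 (fun _ e => Q (e j) e) := by
  obtain ⟨φ, hφ⟩ := h
  exact ⟨φ.subst j, fun A v => (hφ _ v).trans (sat_subst φ j v).symm⟩

/-- `lv` is an increasing hierarchy of transitive sets whose union of length `c` satisfies bounded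
separation with respect to the predicate `P`. -/
structure Hier (P : ZFSet.{u}) (c : Cardinal.{u}) (lv : Ordinal.{u} → ZFSet.{u}) : Prop where
  reg : c.IsRegular
  unc : ℵ₀ < c
  trans : ∀ γ, (lv γ).IsTransitive
  mem : ∀ {γ δ}, γ < δ → lv γ ∈ lv δ
  lim : ∀ {γ}, Order.IsSuccLimit γ → ∀ {x}, x ∈ lv γ → ∃ δ < γ, x ∈ lv δ
  sep : ∀ {n} (φ : Fm (n + 1)) (v : Fin n → ZFSet.{u}), (∀ i, v i ∈ lv c.ord) → ∀ u ∈ lv c.ord,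
    ZFSet.sep (fun t => Sat P φ (Fin.snoc (α := fun _ => ZFSet.{u}) v t)) u ∈ lv c.ord

namespace Hier

variable {P : ZFSet.{u}} {c : Cardinal.{u}} {lv : Ordinal.{u} → ZFSet.{u}} {x y : ZFSet.{u}}
  {γ δ ξ : Ordinal.{u}}

theorem mono (H : Hier P c lv) (h : γ ≤ δ) : lv γ ⊆ lv δ := by
  rcases h.eq_or_lt with rfl | h
  · exact subset_rfl
  · exact H.trans _ _ (H.mem h)

theorem isSuccLimit (H : Hier P c lv) : Order.IsSuccLimit c.ord := isSuccLimit_ord H.unc.le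

theorem sepD0 (H : Hier P c lv) {n : ℕ} {Q : ZFSet.{u} → (Fin n → ZFSet.{u}) → ZFSet.{u} → Prop}
    (h : D0 (n := n + 1) (fun A e => Q A (Fst e) (Lst e))) (v : Fin n → ZFSet.{u})
    (hv : ∀ i, v i ∈ lv c.ord) {u : ZFSet.{u}} (hu : u ∈ lv c.ord) :
    ZFSet.sep (Q P v) u ∈ lv c.ord := by
  obtain ⟨φ, hφ⟩ := h
  convert H.sep φ v hv u hu using 3 with t
  rw [← hφ]
  simp only [fst_snoc, Lst, Fin.snoc_last]

/-- A predicate that is an element of the hierarchy can be replaced by a variable, and separation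
with it becomes separation with a parameter. Thus levels built from another predicate can be
constructed inside the hierarchy. -/
theorem param (H : Hier P c lv) {a : ZFSet.{u}} (ha : a ∈ lv c.ord) : Hier a c lv where
  reg := H.reg
  unc := H.unc
  trans := H.trans
  mem := H.mem
  lim := H.lim
  sep {n} φ v hv u hu := by
    have h : D0 (n := n + 1) (fun A e => Sat A φ e) := ⟨φ, fun _ _ => Iff.rfl⟩
    have h' := (h.rename (m := n + 1 + 1) (Fin.snoc (α := fun _ => Fin (n + 2))
      (fun i => i.castSucc.castSucc) (Fin.last _))).subst (Fin.last n).castSucc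
    have := H.sepD0 (n := n + 1) (Q := fun _ e t => Sat (Lst e) φ
      (Fin.snoc (α := fun _ => ZFSet.{u}) (Fst e) t)) (h'.congr fun A e => by
        refine iff_of_eq (congrArg _ (funext fun i => ?_))
        refine Fin.lastCases ?_ (fun i => ?_) i <;> simp [Lst, Fst])
      (Fin.snoc (α := fun _ => ZFSet.{u}) v a)
      (fun i => Fin.lastCases (by simpa) (fun i => by simpa using hv i) i) hu
    rw [fst_snoc] at this
    simpa [Lst] using this

theorem exists_bound (H : Hier P c lv) {Z : ZFSet.{u}} (hZ : Z.card < c) (hsub : Z ⊆ lv c.ord) :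
    ∃ γ < c.ord, Order.IsSuccLimit γ ∧ Z ⊆ lv γ := by
  have : ∀ z ∈ Z, ∃ δ < c.ord, z ∈ lv δ := fun z hz => H.lim H.isSuccLimit (hsub hz)
  choose! g hg hg' using this
  obtain ⟨γ, hγ, hl, hb⟩ := exists_isSuccLimit_bound H.reg H.unc hZ g hg
  exact ⟨γ, hγ, hl, fun z hz => H.mono (hb z hz).le (hg' z hz)⟩

theorem exists_bound_iio (H : Hier P c lv) (hξ : ξ < c.ord) (b : Ordinal.{u} → ZFSet.{u})
    (hb : ∀ η < ξ, b η ∈ lv c.ord) :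
    ∃ γ < c.ord, Order.IsSuccLimit γ ∧ ∀ η < ξ, b η ∈ lv γ := by
  have : ∀ η < ξ, ∃ δ < c.ord, b η ∈ lv δ := fun η hη => H.lim H.isSuccLimit (hb η hη)
  choose! g hg hg' using this
  obtain ⟨γ, hγ, hl, h⟩ := exists_isSuccLimit_bound H.reg H.unc (Z := ξ.toZFSet)
    (by rw [Ordinal.card_toZFSet]; exact lt_ord.1 hξ) (fun z => g z.rank) (fun z hz => by
      obtain ⟨η, hη, rfl⟩ := Ordinal.mem_toZFSet_iff.1 hz
      rw [Ordinal.rank_toZFSet]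
      exact hg η hη)
  refine ⟨γ, hγ, hl, fun η hη => ?_⟩
  have := h η.toZFSet (Ordinal.toZFSet_mem_toZFSet_iff.2 hη)
  rw [Ordinal.rank_toZFSet] at this
  exact H.mono this.le (hg' η hη)

theorem pair_mem (H : Hier P c lv) (hx : x ∈ lv c.ord) (hy : y ∈ lv c.ord) :
    ({x, y} : ZFSet.{u}) ∈ lv c.ord := by
  obtain ⟨γ, hγ, hx'⟩ := H.lim H.isSuccLimit hx
  obtain ⟨δ, hδ, hy'⟩ := H.lim H.isSuccLimit hy
  have := H.sepD0 (n := 2) (Q := fun _ e t => t = e 0 ∨ t = e 1)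
    (by apply_rules [D0.or, D0.eq, IsVar.mk]) ![x, y] (by simp [Fin.forall_fin_succ, hx, hy])
    (H.mem (max_lt hγ hδ))
  convert this using 1
  ext t
  simp only [ZFSet.mem_pair, ZFSet.mem_sep]
  refine ⟨fun h => ⟨?_, h⟩, fun h => h.2⟩
  rcases h with rfl | rfl
  · exact H.mono (le_max_left _ _) hx'
  · exact H.mono (le_max_right _ _) hy'

theorem opair_mem (H : Hier P c lv) (hx : x ∈ lv c.ord) (hy : y ∈ lv c.ord) :
    pair x y ∈ lv c.ord := by
  have := H.pair_mem (H.pair_mem hx hx) (H.pair_mem hx hy)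
  simpa [pair] using this

/-- Being a transitive set of transitive sets is bounded, so the ordinals of a level containing all
η < ξ form an element of the hierarchy. It is an ordinal including ξ, hence equal to ξ or containing
it. -/
theorem toZFSet_mem (H : Hier P c lv) (hξ : ξ < c.ord) : ξ.toZFSet ∈ lv c.ord := by
  induction ξ using WellFoundedLT.induction with
  | ind ξ ih =>
  obtain ⟨γ, hγ, -, hb⟩ := H.exists_bound_iio hξ Ordinal.toZFSet fun η hη => ih η hη (hη.trans hξ)
  have hD := H.sepD0 (n := 0) (Q := fun _ _ t => (∀ z ∈ t, z ⊆ t) ∧ ∀ z ∈ t, ∀ w ∈ z, w ⊆ z)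
    (by apply_rules [D0.sub, D0.ball, D0.and, IsVar.mk]) ![] (by simp) (H.mem hγ)
  set D := ZFSet.sep (fun t => (∀ z ∈ t, z ⊆ t) ∧ ∀ z ∈ t, ∀ w ∈ z, w ⊆ z) (lv γ) with hDdef
  have hDo : D.IsOrdinal := by
    rw [ZFSet.isOrdinal_iff_forall_mem_isTransitive]
    refine ⟨fun t ht z hz => ?_, fun t ht => (ZFSet.mem_sep.1 ht).2.1⟩
    obtain ⟨ht, h1, h2⟩ := ZFSet.mem_sep.1 ht
    exact ZFSet.mem_sep.2 ⟨H.trans _ _ ht hz, h2 z hz, fun w hw => h2 w (h1 z hz hw)⟩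
  have hsub : ξ.toZFSet ⊆ D := by
    intro t ht
    obtain ⟨η, hη, rfl⟩ := Ordinal.mem_toZFSet_iff.1 ht
    have := ZFSet.isOrdinal_iff_forall_mem_isTransitive.1 (ZFSet.isOrdinal_toZFSet η)
    exact ZFSet.mem_sep.2 ⟨hb η hη, this.1, this.2⟩
  rcases ((ZFSet.isOrdinal_toZFSet ξ).subset_iff_eq_or_mem hDo).1 hsub with h | h
  · exact h ▸ hD
  · exact H.trans _ _ hD h

end Hier

/-! ### Recursion in hierarchies -/

/-- The sequence of the values of `b` below `ξ`. -/
noncomputable def seqOf (b : Ordinal.{u} → ZFSet.{u}) (ξ : Ordinal.{u}) : ZFSet.{u} :=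
  ZFSet.range fun η : Set.Iio ξ => pair η.1.toZFSet (b η.1)

theorem mem_seqOf {b : Ordinal.{u} → ZFSet.{u}} {ξ : Ordinal.{u}} {p : ZFSet.{u}} :
    p ∈ seqOf b ξ ↔ ∃ η < ξ, p = pair η.toZFSet (b η) := by
  simp [seqOf, eq_comm]

theorem pair_mem_seqOf {b : Ordinal.{u} → ZFSet.{u}} {ξ η : Ordinal.{u}} {m : ZFSet.{u}} :
    pair η.toZFSet m ∈ seqOf b ξ ↔ η < ξ ∧ m = b η := by
  rw [mem_seqOf]
  constructor
  · rintro ⟨ζ, hζ, h⟩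
    obtain ⟨h1, rfl⟩ := ZFSet.pair_inj.1 h
    obtain rfl := Ordinal.toZFSet_injective h1
    exact ⟨hζ, rfl⟩
  · rintro ⟨h, rfl⟩
    exact ⟨η, h, rfl⟩

/-- The domain of `K` includes `i`. -/
def DomIncl (K i : ZFSet.{u}) : Prop := ∀ k ∈ i, ∃ q ∈ K, ∃ k' m, q = pair k' m ∧ k' = k

theorem D0.domIncl {n : ℕ} {t s : (Fin n → ZFSet.{u}) → ZFSet.{u}} (ht : IsVar t) (hs : IsVar s) :
    D0 (fun _ e => DomIncl (t e) (s e)) := by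
  refine D0.comp2 (P := fun _ => DomIncl) ?_ ht hs
  unfold DomIncl
  apply_rules [D0.bex, D0.ball, D0.expair, D0.eq, IsVar.mk]

/-- Recursion inside a hierarchy. `Ψ` is a bounded description of one step, with a level as
auxiliary parameter. The sequence below ξ is separated from a level by the condition that some
approximation in that level yields the given value; approximations agree with `b` by induction on
the index. -/
theorem Hier.rec_mem {P : ZFSet.{u}} {c : Cardinal.{u}} {lv : Ordinal.{u} → ZFSet.{u}}
    (H : Hier P c lv) (b : Ordinal.{u} → ZFSet.{u})
    {Ψ : ZFSet.{u} → ZFSet.{u} → ZFSet.{u} → ZFSet.{u} → ZFSet.{u} → Prop}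
    (hΨ : D0 (n := 4) fun A e => Ψ A (e 0) (e 1) (e 2) (e 3))
    (hstep : ∀ ξ < c.ord, seqOf b ξ ∈ lv c.ord → b ξ ∈ lv c.ord)
    (hdef : ∀ γ < c.ord, Order.IsSuccLimit γ → ∀ ζ, (∀ η < ζ, b η ∈ lv γ) → ∀ K,
      (∀ η < ζ, ∀ m, pair η.toZFSet m ∈ K ↔ m = b η) → ∀ l ∈ lv γ,
      (Ψ P (lv γ) K ζ.toZFSet l ↔ l = b ζ)) (ξ : Ordinal.{u}) (hξ : ξ < c.ord) :
    seqOf b ξ ∈ lv c.ord ∧ b ξ ∈ lv c.ord := by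
  suffices h : seqOf b ξ ∈ lv c.ord from ⟨h, hstep ξ hξ h⟩
  induction ξ using WellFoundedLT.induction with
  | ind ξ ih =>
  -- The level γ contains not only the entries of the sequence but also all its proper initial
  -- segments, which serve as approximations.
  obtain ⟨γ, hγ, hlim, hb⟩ := H.exists_bound_iio hξ
    (fun η => pair (pair η.toZFSet (b η)) (seqOf b η)) fun η hη =>
      H.opair_mem (H.opair_mem (H.toZFSet_mem (hη.trans hξ))
        (hstep η (hη.trans hξ) (ih η hη (hη.trans hξ)))) (ih η hη (hη.trans hξ))
  have hl : ∀ {a b : ZFSet.{u}}, pair a b ∈ lv γ → a ∈ lv γ ∧ b ∈ lv γ := by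
    intro a b h1
    have ht := H.trans γ
    exact ⟨ht _ (ht _ h1 (by simp [pair] : ({a} : ZFSet) ∈ pair a b)) (by simp),
      ht _ (ht _ h1 (by simp [pair] : ({a, b} : ZFSet) ∈ pair a b)) (by simp)⟩
  let GoodK : ZFSet.{u} → ZFSet.{u} → ZFSet.{u} → Prop := fun A U K =>
    ∀ p ∈ K, ∃ j m, p = pair j m ∧ DomIncl K j ∧ m ∈ U ∧ Ψ A U K j m
  have hgood : ∀ K, GoodK P (lv γ) K → ∀ ζ ≤ ξ, ∀ m, pair ζ.toZFSet m ∈ K → m = b ζ := by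
    intro K hK ζ
    induction ζ using WellFoundedLT.induction with
    | ind ζ ihζ =>
    intro hζ m hm
    obtain ⟨j, m', he, hdom, hU, hm'⟩ := hK _ hm
    obtain ⟨rfl, rfl⟩ := ZFSet.pair_inj.1 he
    refine (hdef γ hγ hlim ζ (fun η hη => (hl (hl (hb η (hη.trans_le hζ))).1).2) K
      (fun η hη m => ⟨ihζ η hη (hη.le.trans hζ) m, ?_⟩) m hU).1 hm'
    rintro rfl
    obtain ⟨q, hq, k', m', rfl, rfl⟩ := hdom _ (Ordinal.toZFSet_mem_toZFSet_iff.2 hη)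
    rw [← ihζ η hη (hη.le.trans hζ) m' hq]
    exact hq
  have hS := H.sepD0 (n := 2) (Q := fun A e p => ∃ i l, p = pair i l ∧ i ∈ e 1 ∧ ∃ K ∈ e 0,
    (∀ p ∈ K, ∃ j m, p = pair j m ∧ DomIncl K j ∧ m ∈ e 0 ∧ Ψ A (e 0) K j m) ∧ DomIncl K i ∧
    l ∈ e 0 ∧ Ψ A (e 0) K i l) (by
      have hΨ' : ∀ {n : ℕ} {t s w t' : (Fin n → ZFSet.{u}) → ZFSet.{u}}, IsVar t → IsVar s →
          IsVar w → IsVar t' → D0 (fun A e => Ψ A (t e) (s e) (w e) (t' e)) :=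
        fun ht hs hw ht' => D0.comp4 hΨ ht hs hw ht'
      apply_rules [hΨ', D0.domIncl, D0.mem, D0.and, D0.bex, D0.ball, D0.expair, IsVar.mk])
    ![lv γ, ξ.toZFSet] (by simp [Fin.forall_fin_succ, H.mem hγ, H.toZFSet_mem hξ]) (H.mem hγ)
  convert hS using 1
  ext p
  simp only [mem_seqOf, ZFSet.mem_sep, Matrix.cons_val_zero, Matrix.cons_val_one]
  constructor
  · rintro ⟨η, hη, rfl⟩
    have hlt : ∀ ζ < η, b ζ ∈ lv γ := fun ζ hζ => (hl (hl (hb ζ (hζ.trans hη))).1).2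
    have hdom : ∀ ζ ≤ η, DomIncl (seqOf b η) ζ.toZFSet := by
      intro ζ hζ k hk
      obtain ⟨δ, hδ, rfl⟩ := Ordinal.mem_toZFSet_iff.1 hk
      exact ⟨_, pair_mem_seqOf.2 ⟨hδ.trans_le hζ, rfl⟩, _, _, rfl, rfl⟩
    have hbη := (hl (hl (hb η hη)).1).2
    refine ⟨(hl (hb η hη)).1, _, _, rfl, Ordinal.toZFSet_mem_toZFSet_iff.2 hη, seqOf b η,
      (hl (hb η hη)).2, ?_, hdom η le_rfl, hbη, ?_⟩
    · intro p hp
      obtain ⟨ζ, hζ, rfl⟩ := mem_seqOf.1 hp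
      refine ⟨_, _, rfl, hdom ζ hζ.le, hlt ζ hζ, ?_⟩
      exact (hdef γ hγ hlim ζ (fun δ hδ => hlt δ (hδ.trans hζ)) _ (fun δ hδ m => by
        rw [pair_mem_seqOf]; exact and_iff_right (hδ.trans hζ)) _ (hlt ζ hζ)).2 rfl
    · exact (hdef γ hγ hlim η hlt _ (fun δ hδ m => by
        rw [pair_mem_seqOf]; exact and_iff_right hδ) _ hbη).2 rfl
  · rintro ⟨hp, i, l, rfl, hi, K, hK, hKg, hdom, hl', hΨl⟩
    obtain ⟨η, hη, rfl⟩ := Ordinal.mem_toZFSet_iff.1 hi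
    refine ⟨η, hη, ?_⟩
    rw [ZFSet.pair_inj]
    refine ⟨rfl, (hdef γ hγ hlim η (fun ζ hζ => (hl (hl (hb ζ (hζ.trans hη))).1).2) K
      (fun ζ hζ m => ⟨hgood K hKg ζ (hζ.trans hη).le m, ?_⟩) l hl').1 hΨl⟩
    rintro rfl
    obtain ⟨q, hq, k', m', rfl, rfl⟩ := hdom _ (Ordinal.toZFSet_mem_toZFSet_iff.2 hζ)
    rw [← hgood K hKg ζ (hζ.trans hη).le m' hq]
    exact hq

open ZFSet (pair)

/-! ### Cardinalities -/

theorem card_le_of_cover {μ : Cardinal.{u}} (hμ : ℵ₀ ≤ μ) {ι : Type u} (hι : #ι ≤ μ)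
    {X Z : ZFSet.{u}} (hX : X.card ≤ μ) (f : ι → ZFSet.{u} → ZFSet.{u} → ZFSet.{u})
    (h : ∀ z ∈ Z, ∃ i, ∃ x ∈ X, ∃ y ∈ X, z = f i x y) : Z.card ≤ μ := by
  have hsub : (Z : Set ZFSet.{u}) ⊆ Set.range fun p : ι × X × X => f p.1 p.2.1.1 p.2.2.1 := by
    intro z hz
    obtain ⟨i, x, hx, y, hy, rfl⟩ := h z hz
    exact ⟨⟨i, ⟨x, hx⟩, ⟨y, hy⟩⟩, rfl⟩
  have h1 : #Z ≤ #(ι × X × X) := by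
    have := (mk_le_mk_of_subset hsub).trans mk_range_le
    simpa using this
  rw [← lift_le.{u + 1}, ← ZFSet.cardinalMk_coe_sort]
  refine h1.trans ?_
  rw [mk_prod, mk_prod, ZFSet.cardinalMk_coe_sort]
  simp only [lift_lift, ← lift_mul]
  have h2 : #ι * (X.card * X.card) ≤ μ :=
    (mul_le_mul' hι (mul_le_mul' hX hX)).trans (by simp [mul_eq_self hμ])
  have := lift_le.{u + 1}.2 h2
  simpa using this

theorem card_iUnion_iio_le {μ : Cardinal.{u}} (hμ : ℵ₀ ≤ μ) {ξ : Ordinal.{u}} (hξ : ξ.card ≤ μ)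
    (f : Ordinal.{u} → ZFSet.{u}) (hf : ∀ η < ξ, (f η).card ≤ μ) :
    (ZFSet.iUnion fun η : Set.Iio ξ => f η.1).card ≤ μ := by
  rw [← lift_le.{u + 1}]
  refine (ZFSet.lift_card_iUnion_le_sum_card).trans ?_
  refine (sum_le_sum _ (fun _ => μ) fun η : Set.Iio ξ => hf η.1 η.2).trans ?_
  rw [sum_const, mk_Iio_ordinal, lift_lift, ← lift_mul.{u, u + 1}, lift_le]
  exact (mul_le_mul' hξ le_rfl).trans (mul_eq_self hμ).le

variable {A P x : ZFSet.{u}} {ξ η : Ordinal.{u}} {c : Cardinal.{u}} {lv : Ordinal.{u} → ZFSet.{u}}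

theorem lev_eq_iUnion : lev A ξ = ZFSet.iUnion fun η : Set.Iio ξ => StepS A (lev A η.1) := by
  ext x
  simp [mem_lev, mem_StepS]

theorem card_lev_le (A : ZFSet.{u}) {μ : Cardinal.{u}} (hμ : ℵ₀ ≤ μ) (hξ : ξ.card ≤ μ) :
    (lev A ξ).card ≤ μ := by
  induction ξ using WellFoundedLT.induction with
  | ind ξ ih =>
  rw [lev_eq_iUnion]
  refine card_iUnion_iio_le hμ hξ (fun η => StepS A (lev A η)) fun η hη => ?_
  -- One step yields the old elements, coded by `none`, and at most ten cuts for each pair of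
  -- parameters from S ∪ {S}.
  refine card_le_of_cover hμ (ι := ULift (Option (Fin 10))) (X := insert (lev A η) (lev A η))
    ((lt_aleph0_of_finite _).le.trans hμ)
    (ZFSet.card_insert_le.trans (add_le_of_le hμ (ih η hη ((Ordinal.card_le_card hη.le).trans hξ))
      (one_le_aleph0.trans hμ)))
    (fun i x y => i.down.elim x fun i => lev A η ∩ G A i x y) fun z hz => ?_
  rcases mem_StepS.1 hz with hz | ⟨i, a, ha, b, hb, hz⟩
  · exact ⟨⟨none⟩, z, by simp [hz], z, by simp [hz], rfl⟩
  · exact ⟨⟨some i⟩, a, by simp [ha.symm], b, by simp [hb.symm], isCut_iff.1 hz⟩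

theorem card_lev_lt (A : ZFSet.{u}) (hc : ℵ₀ < c) (hξ : ξ < c.ord) : (lev A ξ).card < c :=
  (card_lev_le A (le_max_left ℵ₀ ξ.card) (le_max_right _ _)).trans_lt (max_lt hc (lt_ord.1 hξ))

/-! ### Levels belong to hierarchies -/

theorem Hier.cut_mem (H : Hier P c lv) {S a b x : ZFSet.{u}} {i : Fin 10} (hS : S ∈ lv c.ord)
    (ha : a ∈ S ∨ a = S) (hb : b ∈ S ∨ b = S) (hx : IsCut P S i a b x) : x ∈ lv c.ord := by
  have hm : ∀ {a}, (a ∈ S ∨ a = S) → a ∈ lv c.ord := by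
    rintro a (ha | rfl)
    · exact H.trans _ _ hS ha
    · exact hS
  have := H.sepD0 (n := 2) (Q := fun A e z => GMem i A z (e 0) (e 1)) (by
    apply_rules [D0.gmem, IsVar.mk]) ![a, b] (by simp [Fin.forall_fin_succ, hm ha, hm hb]) hS
  convert this using 1
  rw [isCut_iff.1 hx]
  ext z
  simp [mem_G]

theorem Hier.lev_subset (H : Hier P c lv) (h : ∀ η < ξ, lev P η ∈ lv c.ord) :
    lev P ξ ⊆ lv c.ord := by
  intro x hx
  obtain ⟨η, hη, hx | ⟨i, a, ha, b, hb, hx⟩⟩ := mem_lev.1 hx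
  · exact H.trans _ _ (h η hη) hx
  · exact H.cut_mem (h η hη) ha hb hx

theorem Hier.of_pair_mem (H : Hier P c lv) {γ : Ordinal.{u}} {a b : ZFSet.{u}}
    (h : pair a b ∈ lv γ) : a ∈ lv γ ∧ b ∈ lv γ := by
  have ht := H.trans γ
  exact ⟨ht _ (ht _ h (by simp [pair] : ({a} : ZFSet) ∈ pair a b)) (by simp),
    ht _ (ht _ h (by simp [pair] : ({a, b} : ZFSet) ∈ pair a b)) (by simp)⟩

/-- The next level and its order are subsets of the hierarchy with fewer than `c` elements, so by
regularity each is included in a single stage. From there a bounded formula in the sequence of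
earlier levels separates it. -/
theorem Hier.lp_mem_of_seqOf (H : Hier P c lv) (hξ : ξ < c.ord)
    (hK : seqOf (lp P) ξ ∈ lv c.ord) : lp P ξ ∈ lv c.ord := by
  have hlp : ∀ η < ξ, lp P η ∈ lv c.ord := fun η hη =>
    (H.of_pair_mem (H.trans _ _ hK (pair_mem_seqOf.2 ⟨hη, rfl⟩))).2
  have hsub := H.lev_subset fun η hη => (H.of_pair_mem (hlp η hη)).1
  have hcard := card_lev_lt P H.unc hξ
  obtain ⟨γ, hγ, -, hγS⟩ := H.exists_bound hcard hsub
  have hr : levLe P ξ ⊆ lv c.ord := by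
    intro t ht
    obtain ⟨x, hx, y, hy, rfl⟩ := (wo_lev P ξ).field t ht
    exact H.opair_mem (hsub hx) (hsub hy)
  have hrcard : (levLe P ξ).card < c := by
    refine (card_le_of_cover (le_max_left ℵ₀ (lev P ξ).card) (ι := PUnit) (X := lev P ξ) (by simp)
      (le_max_right _ _) (fun _ => pair) fun t ht => ?_).trans_lt (max_lt H.unc hcard)
    obtain ⟨x, hx, y, hy, rfl⟩ := (wo_lev P ξ).field t ht
    exact ⟨⟨⟩, x, hx, y, hy, rfl⟩
  obtain ⟨δ, hδ, -, hδr⟩ := H.exists_bound hrcard hr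
  refine H.opair_mem ?_ ?_
  · have := H.sepD0 (n := 1) (Q := fun A e x => ∃ q ∈ e 0, ∃ i o, q = pair i o ∧
      ∃ S r, o = pair S r ∧ InStep A S x) (by
        apply_rules [D0.inStep, D0.bex, D0.expair, IsVar.mk])
      ![seqOf (lp P) ξ] (by simp [hK]) (H.mem hγ)
    convert this using 1
    ext x
    simp only [ZFSet.mem_sep, Matrix.cons_val_zero]
    constructor
    · intro hx
      obtain ⟨η, hη, hx'⟩ := mem_lev.1 hx
      exact ⟨hγS hx, _, pair_mem_seqOf.2 ⟨hη, rfl⟩, _, _, rfl, _, _, rfl, hx'⟩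
    · rintro ⟨-, q, hq, i, o, rfl, S, r, rfl, hx⟩
      obtain ⟨η, hη, he⟩ := mem_seqOf.1 hq
      have he := (ZFSet.pair_inj.1 (ZFSet.pair_inj.1 he).2).1
      exact InStep.mem_lev (he ▸ hx) hη
  · have := H.sepD0 (n := 1) (Q := fun A e t => ∃ x y, t = pair x y ∧ ∃ q ∈ e 0, ∃ i o,
      q = pair i o ∧ ∃ S r, o = pair S r ∧ StepLe A S r x y) (by
        apply_rules [D0.stepLe, D0.bex, D0.expair, IsVar.mk])
      ![seqOf (lp P) ξ] (by simp [hK]) (H.mem hδ)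
    convert this using 1
    ext t
    simp only [ZFSet.mem_sep, Matrix.cons_val_zero]
    constructor
    · intro ht
      obtain ⟨x, hx, y, hy, rfl⟩ := (wo_lev P ξ).field t ht
      obtain ⟨η, hη, ht'⟩ := mem_levLe.1 ht
      exact ⟨hδr ht, _, _, rfl, _, pair_mem_seqOf.2 ⟨hη, rfl⟩, _, _, rfl, _, _, rfl,
        (wo_lev P η).pair_mem_StepR.1 ht'⟩
    · rintro ⟨-, x, y, rfl, q, hq, i, o, rfl, S, r, rfl, hx⟩
      obtain ⟨η, hη, he⟩ := mem_seqOf.1 hq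
      obtain ⟨rfl, rfl⟩ := ZFSet.pair_inj.1 (ZFSet.pair_inj.1 he).2
      exact mem_levLe.2 ⟨η, hη, (wo_lev P η).pair_mem_StepR.2 hx⟩

theorem isEntry_iff_of_seq {K S r : ZFSet.{u}}
    (hK : ∀ η < ξ, ∀ m, pair η.toZFSet m ∈ K ↔ m = lp P η) :
    IsEntry P K ξ.toZFSet S r ↔ S = lev P ξ ∧ r = levLe P ξ := by
  refine isEntry_iff (Set.Iio ξ) ?_ ?_ (fun η hη => hη) fun η hη => ⟨η, hη, le_rfl⟩
  · intro i hi o ho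
    obtain ⟨η, hη, rfl⟩ := Ordinal.mem_toZFSet_iff.1 hi
    exact ⟨η, hη, (hK η hη o).1 ho⟩
  · intro η hη
    exact ⟨_, Ordinal.toZFSet_mem_toZFSet_iff.2 hη, (hK η hη _).2 rfl⟩

theorem Hier.seq_lp_mem (H : Hier P c lv) (hξ : ξ < c.ord) :
    seqOf (lp P) ξ ∈ lv c.ord ∧ lp P ξ ∈ lv c.ord := by
  refine H.rec_mem (lp P) (Ψ := fun A _ K i l => ∃ S r, l = pair S r ∧ IsEntry A K i S r)
    (by apply_rules [D0.isEntry, D0.expair, IsVar.mk])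
    (fun ξ hξ hK => H.lp_mem_of_seqOf hξ hK) ?_ ξ hξ
  intro γ hγ hlim ζ hζ K hK l hl
  constructor
  · rintro ⟨S, r, rfl, h⟩
    obtain ⟨rfl, rfl⟩ := (isEntry_iff_of_seq hK).1 h
    rfl
  · rintro rfl
    exact ⟨_, _, rfl, (isEntry_iff_of_seq hK).2 ⟨rfl, rfl⟩⟩

theorem Hier.lev_mem (H : Hier P c lv) (hξ : ξ < c.ord) : lev P ξ ∈ lv c.ord :=
  (H.of_pair_mem (H.seq_lp_mem hξ).2).1

theorem exists_common_lev (hξ : Order.IsSuccLimit ξ) {n : ℕ} (v : Fin n → ZFSet.{u})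
    (hv : ∀ i, v i ∈ lev A ξ) : ∃ η < ξ, ∀ i, v i ∈ lev A η := by
  choose f hf hf' using fun i => (mem_lev_of_isSuccLimit hξ).1 (hv i)
  refine ⟨Finset.univ.sup f, (Finset.sup_lt_iff hξ.bot_lt).2 fun i _ => hf i, fun i =>
    lev_mono (Finset.le_sup (Finset.mem_univ i)) (hf' i)⟩

theorem lev_sep (hξ : Order.IsSuccLimit ξ) {n : ℕ} (φ : Fm (n + 1)) (v : Fin n → ZFSet.{u})
    (hv : ∀ i, v i ∈ lev A ξ) (w : ZFSet.{u}) (hw : w ∈ lev A ξ) :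
    ZFSet.sep (fun t => Sat A φ (Fin.snoc (α := fun _ => ZFSet.{u}) v t)) w ∈ lev A ξ := by
  obtain ⟨η, hη, h⟩ := exists_common_lev hξ (Fin.snoc (α := fun _ => ZFSet.{u}) v w)
    (fun i => Fin.lastCases (by simpa) (fun i => by simpa using hv i) i)
  refine section_mem_lev hξ (lev_mem_lev hη) (isSection_sep (isTransitive_lev A η) φ
    (fun i => ?_) ?_)
  · simpa using h i.castSucc
  · simpa using h (Fin.last n)

theorem lev_sepD0 (hξ : Order.IsSuccLimit ξ) {n : ℕ}
    {Q : ZFSet.{u} → (Fin n → ZFSet.{u}) → ZFSet.{u} → Prop}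
    (h : D0 (n := n + 1) (fun A e => Q A (Fst e) (Lst e))) (v : Fin n → ZFSet.{u})
    (hv : ∀ i, v i ∈ lev A ξ) {w : ZFSet.{u}} (hw : w ∈ lev A ξ) :
    ZFSet.sep (Q A v) w ∈ lev A ξ := by
  obtain ⟨φ, hφ⟩ := h
  convert lev_sep hξ φ v hv w hw using 3 with t
  rw [← hφ]
  simp only [fst_snoc, Lst, Fin.snoc_last]

theorem hier_lev (A : ZFSet.{u}) (hc : c.IsRegular) (hc' : ℵ₀ < c) : Hier A c (lev A) where
  reg := hc
  unc := hc'
  trans := isTransitive_lev A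
  mem := lev_mem_lev
  lim h _ hx := (mem_lev_of_isSuccLimit h).1 hx
  sep φ v hv u hu := lev_sep (isSuccLimit_ord hc'.le) φ v hv u hu

open ZFSet (pair)

/-! ### Levels of the constructible hierarchy -/

variable {A m x y : ZFSet.{u}} {ξ η : Ordinal.{u}} {c : Cardinal.{u}}

theorem isSection_of_mem (hm : m.IsTransitive) (hx : x ∈ m) : IsSection A m x := by
  refine (IsRel.mem (A := A) (m := m) (n := 2) 1 0).isSection (v := ![x]) (hm x hx) (by simpa)
    fun y hy => ?_
  have h1 : (Fin.snoc (α := fun _ => ZFSet.{u}) ![x] y : Fin 2 → ZFSet.{u}) 1 = y :=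
    Fin.snoc_last (α := fun _ => ZFSet.{u}) (n := 1) _ _
  have h0 : (Fin.snoc (α := fun _ => ZFSet.{u}) ![x] y : Fin 2 → ZFSet.{u}) 0 = x :=
    Fin.snoc_castSucc (α := fun _ => ZFSet.{u}) (n := 1) (i := 0) _ _
  rw [h1, h0]

theorem isSection_self : IsSection A m m :=
  (IsRel.top (A := A) (m := m) (n := 1)).isSection (v := ![]) subset_rfl (by simp)
    fun y hy => by simp [hy]

/-- A description of L that does not distinguish zero, successor and limit stages. Transitivity is
proved along with it, because an element of a stage is definable over that stage only once it is
also a subset. -/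
theorem mem_L_and_isTransitive_L (A : ZFSet.{u}) (ξ : Ordinal.{u}) :
    (∀ x, x ∈ L A ξ ↔ ∃ η < ξ, IsSection A (L A η) x) ∧ (L A ξ).IsTransitive := by
  induction ξ using WellFoundedLT.induction with
  | ind ξ ih =>
  have hmem : ∀ x, x ∈ L A ξ ↔ ∃ η < ξ, IsSection A (L A η) x := by
    intro x
    rcases Ordinal.zero_or_succ_or_isSuccLimit ξ with rfl | ⟨ζ, rfl⟩ | hl
    · simp [L_zero]
    · have hζ := ih ζ (Order.lt_add_one_iff.2 le_rfl)
      rw [Order.succ_eq_add_one, L_add_one, mem_defPowerset]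
      constructor
      · exact fun h => ⟨ζ, Order.lt_add_one_iff.2 le_rfl, h⟩
      · rintro ⟨η, hη, h⟩
        rcases (Order.lt_add_one_iff.1 hη).eq_or_lt with rfl | hη
        · exact h
        · exact isSection_of_mem hζ.2 ((hζ.1 x).2 ⟨η, hη, h⟩)
    · rw [L_limit A ξ hl]
      simp only [ZFSet.mem_iUnion, Subtype.exists, Set.mem_Iio, exists_prop]
      constructor
      · rintro ⟨η, hη, h⟩
        exact ⟨η, hη, isSection_of_mem (ih η hη).2 h⟩
      · rintro ⟨η, hη, h⟩
        exact ⟨η + 1, hl.add_one_lt hη, by rwa [L_add_one, mem_defPowerset]⟩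
  refine ⟨hmem, fun x hx y hy => ?_⟩
  obtain ⟨η, hη, h⟩ := (hmem x).1 hx
  exact (hmem y).2 ⟨η, hη, isSection_of_mem (ih η hη).2 (h.1 hy)⟩

theorem mem_L : x ∈ L A ξ ↔ ∃ η < ξ, IsSection A (L A η) x :=
  (mem_L_and_isTransitive_L A ξ).1 x

theorem isTransitive_L (A : ZFSet.{u}) (ξ : Ordinal.{u}) : (L A ξ).IsTransitive :=
  (mem_L_and_isTransitive_L A ξ).2

theorem L_mem_L (h : η < ξ) : L A η ∈ L A ξ := mem_L.2 ⟨η, h, isSection_self⟩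

theorem L_mono (h : η ≤ ξ) : L A η ⊆ L A ξ := by
  rcases h.eq_or_lt with rfl | h
  · exact subset_rfl
  · exact isTransitive_L A ξ _ (L_mem_L h)

theorem mem_L_of_isSuccLimit (hξ : Order.IsSuccLimit ξ) : x ∈ L A ξ ↔ ∃ η < ξ, x ∈ L A η := by
  constructor
  · intro h
    obtain ⟨η, hη, h⟩ := mem_L.1 h
    exact ⟨η + 1, hξ.add_one_lt hη, mem_L.2 ⟨η, Order.lt_add_one_iff.2 le_rfl, h⟩⟩
  · rintro ⟨η, hη, h⟩
    exact L_mono hη.le h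

theorem hier_L (A : ZFSet.{u}) (hc : c.IsRegular) (hc' : ℵ₀ < c) : Hier A c (L A) where
  reg := hc
  unc := hc'
  trans := isTransitive_L A
  mem := L_mem_L
  lim h _ hx := (mem_L_of_isSuccLimit h).1 hx
  sep {n} φ v hv u hu := by
    have hξ := isSuccLimit_ord hc'.le
    choose f hf hf' using fun i => (mem_L_of_isSuccLimit hξ).1 (hv i)
    obtain ⟨δ, hδ, hu⟩ := (mem_L_of_isSuccLimit hξ).1 hu
    have hη : max δ (Finset.univ.sup f) < c.ord :=
      max_lt hδ ((Finset.sup_lt_iff hξ.bot_lt).2 fun i _ => hf i)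
    refine mem_L.2 ⟨_, hη, isSection_sep (isTransitive_L A _) φ (fun i => ?_)
      (L_mono (le_max_left _ _) hu)⟩
    exact L_mono ((Finset.le_sup (Finset.mem_univ i)).trans (le_max_right _ _)) (hf' i)

theorem lev_subset_L (A : ZFSet.{u}) (hc : c.IsRegular) (hc' : ℵ₀ < c) :
    lev A c.ord ⊆ L A c.ord :=
  (hier_L A hc hc').lev_subset fun _ hη => (hier_L A hc hc').lev_mem hη

/-! ### Derivations -/

/-- `(E, R)` is obtained from `(E₁, R₁)` and `(E₂, R₂)` by one of the rules generating `Rel`,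
with the operations computed inside `U`. -/
def IsRule (A U m E₁ R₁ E₂ R₂ E R : ZFSet.{u}) : Prop :=
  (E₁ = E ∧ E₂ = E ∧ IsCut A U 1 R₁ R₂ R) ∨
  (IsCut A U 2 m E₁ E ∧ IsCut A U 2 m R₁ R) ∨
  (∃ F ∈ U, IsCut A U 2 m F E₁ ∧ IsCut A U 2 m E₁ E ∧ IsCut A U 4 R₁ m R) ∨
  (IsCut A U 2 m E E₁ ∧ IsCut A U 3 R₁ R₁ R) ∨
  (∃ F ∈ U, ∃ F' ∈ U, IsCut A U 2 m F F' ∧ IsCut A U 2 m F' E ∧ E₁ = E ∧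
    (IsCut A U 5 R₁ R₁ R ∨ IsCut A U 6 R₁ R₁ R ∨ IsCut A U 7 R₁ R₁ R)) ∨
  (∃ F ∈ U, IsCut A U 2 m F E ∧ E₁ = E ∧ IsCut A U 8 R₁ R₁ R)

/-- `h` is a derivation of relations on `m`: it consists of triples `(i, (E, R))` obtained by the
rules from triples with index in `i`. -/
def IsDeriv (A U m h : ZFSet.{u}) : Prop :=
  ∀ p ∈ h, ∃ i o, p = pair i o ∧ ∃ E R, o = pair E R ∧
    ((((∀ z ∈ E, z = ∅) ∧ ∃ z ∈ E, z = ∅) ∧ E = R) ∨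
    ∃ p₁ ∈ h, ∃ i₁ o₁, p₁ = pair i₁ o₁ ∧ i₁ ∈ i ∧ ∃ E₁ R₁, o₁ = pair E₁ R₁ ∧
    ∃ p₂ ∈ h, ∃ i₂ o₂, p₂ = pair i₂ o₂ ∧ i₂ ∈ i ∧ ∃ E₂ R₂, o₂ = pair E₂ R₂ ∧
    IsRule A U m E₁ R₁ E₂ R₂ E R)

theorem D0.isRule : D0 (n := 8) (fun A e =>
    IsRule A (e 0) (e 1) (e 2) (e 3) (e 4) (e 5) (e 6) (e 7)) := by
  unfold IsRule
  refine D0.or ?_ (D0.or ?_ (D0.or ?_ (D0.or ?_ (D0.or ?_ ?_))))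
  all_goals apply_rules [D0.isCut, D0.eq, D0.and, D0.or, D0.bex, IsVar.mk]

theorem D0.isDeriv {n : ℕ} {t s w : (Fin n → ZFSet.{u}) → ZFSet.{u}} (ht : IsVar t)
    (hs : IsVar s) (hw : IsVar w) : D0 (fun A e => IsDeriv A (t e) (s e) (w e)) := by
  refine D0.comp3 (P := IsDeriv) ?_ ht hs hw
  unfold IsDeriv
  refine D0.ball (IsVar.mk _) (D0.expair (IsVar.mk _) (D0.expair (IsVar.mk _) (D0.or ?_ ?_)))
  · apply_rules [D0.isEmpty, D0.ball, D0.bex, D0.and, D0.eq, IsVar.mk]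
  · refine D0.bex (IsVar.mk _) (D0.expair (IsVar.mk _) (D0.and ?_ (D0.expair (IsVar.mk _)
      (D0.bex (IsVar.mk _) (D0.expair (IsVar.mk _) (D0.and ?_ (D0.expair (IsVar.mk _) ?_)))))))
    · apply_rules [D0.mem, IsVar.mk]
    · apply_rules [D0.mem, IsVar.mk]
    · exact D0.isRule.rename ![0, 1, 11, 12, 16, 17, 6, 7]

theorem GClosed.isCut_iff {U a b x : ZFSet.{u}} {k : Fin 10} (hU : GClosed A U)
    (hUt : U.IsTransitive) (ha : a ∈ U) (hb : b ∈ U) : IsCut A U k a b x ↔ x = G A k a b := by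
  rw [RelConstr.isCut_iff]
  have : U ∩ G A k a b = G A k a b := by
    ext z
    rw [ZFSet.mem_inter]
    exact and_iff_right_of_imp fun hz => hUt _ (hU.2 k a ha b hb) hz
  rw [this]

theorem GClosed.upair {U a b : ZFSet.{u}} (hU : GClosed A U) (ha : a ∈ U) (hb : b ∈ U) :
    ({a, b} : ZFSet.{u}) ∈ U := by
  have : G A 0 a b = ({a, b} : ZFSet.{u}) := by ext; simp [mem_G, GMem]
  exact this ▸ hU.2 0 a ha b hb

theorem GClosed.opair {U a b : ZFSet.{u}} (hU : GClosed A U) (ha : a ∈ U) (hb : b ∈ U) :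
    pair a b ∈ U := by
  have := hU.upair (hU.upair ha ha) (hU.upair ha hb)
  simpa [pair] using this

theorem of_pair_mem {U a b : ZFSet.{u}} (hU : U.IsTransitive) (h : pair a b ∈ U) :
    a ∈ U ∧ b ∈ U :=
  ⟨hU _ (hU _ h (by simp [pair] : ({a} : ZFSet) ∈ pair a b)) (by simp),
    hU _ (hU _ h (by simp [pair] : ({a, b} : ZFSet) ∈ pair a b)) (by simp)⟩

/-- ∈-induction on the index replaces induction on the length of a derivation, so indices may be
arbitrary sets. Closure and transitivity of `U` ensure that operations computed inside `U` have
their true values. -/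
theorem IsDeriv.rel {U h : ZFSet.{u}} (hU : GClosed A U) (hUt : U.IsTransitive) (hm : m ∈ U)
    (hh : h ∈ U) (hd : IsDeriv A U m h) (i : ZFSet.{u}) :
    ∀ E R, pair i (pair E R) ∈ h → Rel A m E R := by
  induction i using ZFSet.inductionOn with
  | h i ih =>
  intro E R hp
  have hmem : ∀ {i E R : ZFSet.{u}}, pair i (pair E R) ∈ h → E ∈ U ∧ R ∈ U := fun hp =>
    of_pair_mem hUt (of_pair_mem hUt (hUt _ hh hp)).2
  obtain ⟨hE, hR⟩ := hmem hp
  obtain ⟨i', o, he, E', R', he', hcase⟩ := hd _ hp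
  obtain ⟨e1, e2⟩ := ZFSet.pair_inj.1 he
  rw [he'] at e2
  obtain ⟨e2, e3⟩ := ZFSet.pair_inj.1 e2
  rw [← e1, ← e2, ← e3] at hcase
  clear e1 e2 e3 he he'
  rcases hcase with ⟨⟨h1, z, hz, rfl⟩, rfl⟩ | ⟨_, hp₁, i₁, _, rfl, hi₁, E₁, R₁, rfl,
    _, hp₂, i₂, _, rfl, hi₂, E₂, R₂, rfl, hrule⟩
  · have : E = {∅} := by
      ext z
      rw [ZFSet.mem_singleton]
      exact ⟨h1 z, fun h => h ▸ hz⟩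
    exact this ▸ Rel.base
  · have r₁ := ih _ hi₁ _ _ hp₁
    have r₂ := ih _ hi₂ _ _ hp₂
    obtain ⟨hE₁, hR₁⟩ := hmem hp₁
    obtain ⟨hE₂, hR₂⟩ := hmem hp₂
    rcases hrule with ⟨rfl, rfl, h⟩ | ⟨h, h'⟩ | ⟨F, hF, h1, h2, h3⟩ | ⟨h1, h2⟩ |
      ⟨F, hF, F', hF', h1, h2, rfl, h3⟩ | ⟨F, hF, h1, rfl, h2⟩
    · rw [hU.isCut_iff hUt hR₁ hR₂] at h
      exact h ▸ r₁.diff r₂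
    · rw [hU.isCut_iff hUt hm (by assumption)] at h h'
      exact h ▸ h' ▸ r₁.weak
    · rw [hU.isCut_iff hUt hm (by assumption)] at h1 h2
      rw [hU.isCut_iff hUt hR₁ hm] at h3
      subst h1 h2 h3
      exact r₁.ins
    · rw [hU.isCut_iff hUt hm hE] at h1
      rw [hU.isCut_iff hUt hR₁ hR₁] at h2
      subst h1 h2
      exact r₁.ran
    · rw [hU.isCut_iff hUt hm (by assumption)] at h1 h2
      rw [hU.isCut_iff hUt hR₁ hR₁, hU.isCut_iff hUt hR₁ hR₁, hU.isCut_iff hUt hR₁ hR₁] at h3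
      subst h1 h2
      rcases h3 with rfl | rfl | rfl
      · exact r₁.lt
      · exact r₁.gt
      · exact r₁.eq
    · rw [hU.isCut_iff hUt hm hF] at h1
      rw [hU.isCut_iff hUt hR₁ hR₁] at h2
      subst h1 h2
      exact r₁.pred

/-- The relation `(E, R)` on `m` has a derivation in `U`. -/
def Derivable (A U m E R : ZFSet.{u}) : Prop :=
  ∃ h ∈ U, IsDeriv A U m h ∧ ∃ i, pair i (pair E R) ∈ h

theorem Derivable.rule {E₁ R₁ E₂ R₂ E R : ZFSet.{u}} (hξ : Order.IsSuccLimit ξ)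
    (h₁ : Derivable A (lev A ξ) m E₁ R₁) (h₂ : Derivable A (lev A ξ) m E₂ R₂)
    (hE : E ∈ lev A ξ) (hR : R ∈ lev A ξ) (hr : IsRule A (lev A ξ) m E₁ R₁ E₂ R₂ E R) :
    Derivable A (lev A ξ) m E R := by
  obtain ⟨h, hh, hd, i, hi⟩ := h₁
  obtain ⟨h', hh', hd', i', hi'⟩ := h₂
  have hU := gClosed_lev (A := A) hξ
  have hUt := isTransitive_lev A ξ
  -- The new index {i, i'} is ∈-above the indices of both premises.
  have hp : pair {i, i'} (pair E R) ∈ lev A ξ := hU.opair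
    (hU.upair (of_pair_mem hUt (hUt _ hh hi)).1 (of_pair_mem hUt (hUt _ hh' hi')).1)
    (hU.opair hE hR)
  obtain ⟨η, hη, hv⟩ := exists_common_lev (A := A) hξ ![h, h', pair {i, i'} (pair E R)]
    (by simp [Fin.forall_fin_succ, hh, hh', hp])
  simp only [Fin.forall_fin_succ, Matrix.cons_val_zero, Matrix.cons_val_succ, IsEmpty.forall_iff,
    and_true] at hv
  obtain ⟨hv1, hv2, hv3⟩ := hv
  have hs := lev_sepD0 (A := A) hξ (n := 3) (Q := fun _ e t => t ∈ e 0 ∨ t ∈ e 1 ∨ t = e 2)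
    (by apply_rules [D0.mem, D0.eq, D0.or, IsVar.mk]) ![h, h', pair {i, i'} (pair E R)]
    (by simp [Fin.forall_fin_succ, hh, hh', hp]) (lev_mem_lev hη)
  set H := ZFSet.sep (fun t => t ∈ h ∨ t ∈ h' ∨ t = pair {i, i'} (pair E R)) (lev A η) with hH
  have hmem : ∀ t, t ∈ H ↔ t ∈ h ∨ t ∈ h' ∨ t = pair {i, i'} (pair E R) := by
    intro t
    rw [hH, ZFSet.mem_sep, and_iff_right_iff_imp]
    rintro (ht | ht | rfl)
    · exact isTransitive_lev A η _ hv1 ht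
    · exact isTransitive_lev A η _ hv2 ht
    · exact hv3
  have hsub : h ⊆ H := fun t ht => (hmem t).2 (.inl ht)
  have hsub' : h' ⊆ H := fun t ht => (hmem t).2 (.inr (.inl ht))
  have up : ∀ k ⊆ H, IsDeriv A (lev A ξ) m k → ∀ p ∈ k, ∃ i o, p = pair i o ∧ ∃ E R,
      o = pair E R ∧ ((((∀ z ∈ E, z = ∅) ∧ ∃ z ∈ E, z = ∅) ∧ E = R) ∨
      ∃ p₁ ∈ H, ∃ i₁ o₁, p₁ = pair i₁ o₁ ∧ i₁ ∈ i ∧ ∃ E₁ R₁, o₁ = pair E₁ R₁ ∧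
      ∃ p₂ ∈ H, ∃ i₂ o₂, p₂ = pair i₂ o₂ ∧ i₂ ∈ i ∧ ∃ E₂ R₂, o₂ = pair E₂ R₂ ∧
      IsRule A (lev A ξ) m E₁ R₁ E₂ R₂ E R) := by
    intro k hk hkd p hp
    obtain ⟨i, o, he, E, R, he', hc⟩ := hkd p hp
    refine ⟨i, o, he, E, R, he', hc.imp_right ?_⟩
    rintro ⟨p₁, hp₁, i₁, o₁, h1, h2, E₁, R₁, h3, p₂, hp₂, h4⟩
    exact ⟨p₁, hk hp₁, i₁, o₁, h1, h2, E₁, R₁, h3, p₂, hk hp₂, h4⟩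
  refine ⟨H, hs, fun p hp => ?_, {i, i'}, (hmem _).2 (.inr (.inr rfl))⟩
  rcases (hmem p).1 hp with hp | hp | rfl
  · exact up h hsub hd p hp
  · exact up h' hsub' hd' p hp
  · exact ⟨_, _, rfl, _, _, rfl, .inr ⟨_, hsub hi, _, _, rfl, by simp, _, _, rfl,
      _, hsub' hi', _, _, rfl, by simp, _, _, rfl, hr⟩⟩

theorem Rel.derivable {E R : ZFSet.{u}} (hξ : Order.IsSuccLimit ξ) (hm : m ∈ lev A ξ)
    (hm' : m.Nonempty) (h : Rel A m E R) : Derivable A (lev A ξ) m E R := by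
  have hU := gClosed_lev (A := A) hξ
  have hUt := isTransitive_lev A ξ
  have hi : ∀ {k a b}, a ∈ lev A ξ → b ∈ lev A ξ → IsCut A (lev A ξ) k a b (G A k a b) :=
    fun ha hb => (hU.isCut_iff hUt ha hb).2 rfl
  have hrel : ∀ {E R}, Rel A m E R → E ∈ lev A ξ ∧ R ∈ lev A ξ := fun h => hU.rel hm hm' h
  induction h with
  | base =>
    have h0 : ({∅} : ZFSet.{u}) ∈ lev A ξ := (hrel Rel.base).1
    have hp := hU.opair hU.1 (hU.opair h0 h0)
    have hs := hU.upair hp hp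
    refine ⟨_, hs, fun p hp => ?_, ∅, by simp⟩
    simp only [ZFSet.mem_pair, or_self] at hp
    exact ⟨_, _, hp, _, _, rfl, .inl (by simp)⟩
  | diff r r' ih ih' =>
    exact ih.rule hξ ih' (hrel (r.diff r')).1 (hrel (r.diff r')).2
      (.inl ⟨rfl, rfl, hi (hrel r).2 (hrel r').2⟩)
  | weak r ih =>
    exact ih.rule hξ ih (hrel r.weak).1 (hrel r.weak).2
      (.inr (.inl ⟨hi hm (hrel r).1, hi hm (hrel r).2⟩))
  | @ins E R r ih =>
    -- `r.ran` serves only to show that the factor `E` is in the level; the later cases use the same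
    -- device.
    exact ih.rule hξ ih (hrel r.ins).1 (hrel r.ins).2
      (.inr (.inr (.inl ⟨E, (hrel r.ran).1, hi hm (hrel r.ran).1, hi hm (hrel r).1,
        hi (hrel r).2 hm⟩)))
  | ran r ih =>
    exact ih.rule hξ ih (hrel r.ran).1 (hrel r.ran).2
      (.inr (.inr (.inr (.inl ⟨hi hm (hrel r.ran).1, hi (hrel r).2 (hrel r).2⟩))))
  | @lt E R r ih =>
    exact ih.rule hξ ih (hrel r.lt).1 (hrel r.lt).2
      (.inr (.inr (.inr (.inr (.inl ⟨E, (hrel r.ran.ran).1, _, (hrel r.ran).1,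
        hi hm (hrel r.ran.ran).1, hi hm (hrel r.ran).1, rfl, .inl (hi (hrel r).2 (hrel r).2)⟩)))))
  | @gt E R r ih =>
    exact ih.rule hξ ih (hrel r.gt).1 (hrel r.gt).2
      (.inr (.inr (.inr (.inr (.inl ⟨E, (hrel r.ran.ran).1, _, (hrel r.ran).1,
        hi hm (hrel r.ran.ran).1, hi hm (hrel r.ran).1, rfl,
        .inr (.inl (hi (hrel r).2 (hrel r).2))⟩)))))
  | @eq E R r ih =>
    exact ih.rule hξ ih (hrel r.eq).1 (hrel r.eq).2
      (.inr (.inr (.inr (.inr (.inl ⟨E, (hrel r.ran.ran).1, _, (hrel r.ran).1,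
        hi hm (hrel r.ran.ran).1, hi hm (hrel r.ran).1, rfl,
        .inr (.inr (hi (hrel r).2 (hrel r).2))⟩)))))
  | @pred E R r ih =>
    exact ih.rule hξ ih (hrel r.pred).1 (hrel r.pred).2
      (.inr (.inr (.inr (.inr (.inr ⟨E, (hrel r.ran).1, hi hm (hrel r.ran).1, rfl,
        hi (hrel r).2 (hrel r).2⟩)))))

/-- `x` is a section of a relation on `m` with a derivation in `U`. -/
def DefIn (A U m x : ZFSet.{u}) : Prop :=
  x ⊆ m ∧ (m = ∅ ∨ ∃ h ∈ U, IsDeriv A U m h ∧ ∃ p ∈ h, ∃ i o, p = pair i o ∧ ∃ E R, o = pair E R ∧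
    ∃ t ∈ U, (∃ y ∈ m, pair y t ∈ E) ∧ ∀ y ∈ m, y ∈ x ↔ pair y t ∈ R)

theorem D0.defIn {n : ℕ} {t s w : (Fin n → ZFSet.{u}) → ZFSet.{u}} (ht : IsVar t)
    (hs : IsVar s) (hw : IsVar w) : D0 (fun A e => DefIn A (t e) (s e) (w e)) := by
  refine D0.comp3 (P := DefIn) ?_ ht hs hw
  unfold DefIn
  refine D0.and (D0.sub (IsVar.mk _) (IsVar.mk _)) (D0.or (D0.isEmpty (IsVar.mk _))
    (D0.bex (IsVar.mk _) (D0.and ?_ (D0.bex (IsVar.mk _) (D0.expair (IsVar.mk _) (D0.expair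
      (IsVar.mk _) (D0.bex (IsVar.mk _) (D0.and ?_ ?_))))))))
  all_goals apply_rules [D0.isDeriv, D0.opair_mem, D0.mem, D0.iff, D0.ball, D0.bex, IsVar.mk]

/-- Definability over `m` is bounded with a limit level containing `m` as a parameter, since all
relations generated on `m` have derivations in that level. In `DefIn`, the pair of some y with t in
E says that E is a positive power and that t is a tuple of the remaining length. -/
theorem defIn_iff (hξ : Order.IsSuccLimit ξ) (hm : m ∈ lev A ξ) :
    DefIn A (lev A ξ) m x ↔ IsSection A m x := by
  have hU := gClosed_lev (A := A) hξ
  have hUt := isTransitive_lev A ξ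
  constructor
  · rintro ⟨hx, rfl | ⟨h, hh, hd, p, hp, i, o, rfl, E, R, rfl, t, ht, ⟨y, hy, hyt⟩, hR⟩⟩
    · exact ⟨hx, {∅}, _, ∅, Rel.base.weak, by simp, fun y hy => absurd hy (ZFSet.notMem_empty y)⟩
    · have r := hd.rel hU hUt hm hh i E R hp
      obtain ⟨k, rfl⟩ := r.exists_eq_pw ⟨y, hy⟩
      cases k with
      | zero =>
        simp only [pw, ZFSet.mem_singleton] at hyt
        exact absurd (hyt ▸ (by simp [pair] : ({y} : ZFSet.{u}) ∈ pair y t)) (ZFSet.notMem_empty _)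
      | succ k =>
        rw [pw_succ A] at r hyt
        exact ⟨hx, _, R, t, r, (mem_G_two.1 hyt).2, hR⟩
  · rintro ⟨hx, E, R, t, r, ht, hR⟩
    refine ⟨hx, ?_⟩
    rcases m.eq_empty_or_nonempty with rfl | hne
    · exact .inl rfl
    obtain ⟨h, hh, hd, i, hi⟩ := r.derivable hξ hm hne
    have hE := (hU.rel hm hne r.ran).1
    obtain ⟨y, hy⟩ := hne
    exact .inr ⟨h, hh, hd, _, hi, _, _, rfl, _, _, rfl, t, hUt _ hE ht, ⟨y, hy, mem_G_two.2 ⟨hy, ht⟩⟩,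
      hR⟩

/-- The recursion defining L is bounded when the definable power set is computed by `DefIn` in a
limit level containing all earlier stages. -/
theorem L_mem_lev (A : ZFSet.{u}) (hc : c.IsRegular) (hc' : ℵ₀ < c) (hξ : ξ < c.ord) :
    L A ξ ∈ lev A c.ord := by
  have H := hier_lev A hc hc'
  refine (H.rec_mem (L A) (Ψ := fun A U K i l => (∀ x ∈ l, ∃ q ∈ K, ∃ j m, q = pair j m ∧ j ∈ i ∧
    DefIn A U m x) ∧ ∀ x ∈ U, ∀ q ∈ K, ∀ j m, q = pair j m → j ∈ i → DefIn A U m x → x ∈ l)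
    (by apply_rules [D0.defIn, D0.mem, D0.and, D0.imp, D0.bex, D0.ball, D0.expair, D0.allpair,
      IsVar.mk]) ?_ ?_ ξ hξ).2
  · intro ξ hξ hK
    obtain ⟨γ, hγ, hlim, hb⟩ := H.exists_bound_iio hξ (L A) fun η hη =>
      (H.of_pair_mem (H.trans _ _ hK (pair_mem_seqOf.2 ⟨hη, rfl⟩))).2
    have hs := H.sepD0 (n := 2) (Q := fun A e x => ∃ q ∈ e 0, ∃ j m, q = pair j m ∧
      DefIn A (e 1) m x) (by apply_rules [D0.defIn, D0.bex, D0.expair, IsVar.mk])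
      ![seqOf (L A) ξ, lev A γ] (by simp [Fin.forall_fin_succ, hK, H.mem hγ]) (H.mem hγ)
    convert hs using 1
    ext x
    simp only [ZFSet.mem_sep, Matrix.cons_val_zero, Matrix.cons_val_one]
    rw [mem_L]
    constructor
    · rintro ⟨η, hη, h⟩
      exact ⟨section_mem_lev hlim (hb η hη) h, _, pair_mem_seqOf.2 ⟨hη, rfl⟩, _, _, rfl,
        (defIn_iff hlim (hb η hη)).2 h⟩
    · rintro ⟨-, q, hq, j, m, rfl, h⟩
      obtain ⟨η, hη, he⟩ := mem_seqOf.1 hq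
      obtain ⟨rfl, rfl⟩ := ZFSet.pair_inj.1 he
      exact ⟨η, hη, (defIn_iff hlim (hb η hη)).1 h⟩
  · intro γ hγ hlim ζ hζ K hK l hl
    have hmem : ∀ x, x ∈ L A ζ ↔ x ∈ lev A γ ∧ ∃ q ∈ K, ∃ j m, q = pair j m ∧ j ∈ ζ.toZFSet ∧
        DefIn A (lev A γ) m x := by
      intro x
      rw [mem_L]
      constructor
      · rintro ⟨η, hη, h⟩
        exact ⟨section_mem_lev hlim (hζ η hη) h, _, (hK η hη _).2 rfl, _, _, rfl,
          Ordinal.toZFSet_mem_toZFSet_iff.2 hη, (defIn_iff hlim (hζ η hη)).2 h⟩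
      · rintro ⟨-, q, hq, j, m, rfl, hj, h⟩
        obtain ⟨η, hη, rfl⟩ := Ordinal.mem_toZFSet_iff.1 hj
        obtain rfl := (hK η hη m).1 hq
        exact ⟨η, hη, (defIn_iff hlim (hζ η hη)).1 h⟩
    constructor
    · rintro ⟨h1, h2⟩
      ext x
      rw [hmem]
      constructor
      · exact fun hx => ⟨isTransitive_lev A γ _ hl hx, h1 x hx⟩
      · rintro ⟨hx, q, hq, j, m, he, hj, h⟩
        exact h2 x hx q hq j m he hj h
    · rintro rfl
      exact ⟨fun x hx => ((hmem x).1 hx).2, fun x hx q hq j m he hj h =>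
        (hmem x).2 ⟨hx, q, hq, j, m, he, hj, h⟩⟩

/-- Each hierarchy contains the proper initial stages of the other as elements, so they have the
same union. Through this equality results on `lev` apply to L_κ[A]. -/
theorem lev_eq_L (A : ZFSet.{u}) (hc : c.IsRegular) (hc' : ℵ₀ < c) : lev A c.ord = L A c.ord := by
  refine subset_antisymm (lev_subset_L A hc hc') fun x hx => ?_
  obtain ⟨η, hη, hx⟩ := (mem_L_of_isSuccLimit (isSuccLimit_ord hc'.le)).1 hx
  exact isTransitive_lev A _ _ (L_mem_lev A hc hc' hη) hx

open ZFSet (pair)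

/-! ### Transitive collapses -/

section
universe v
variable {α : Type v} [Small.{u} α] {r : α → α → Prop} (wf : WellFounded r)

/-- The Mostowski collapse of a well-founded relation. -/
noncomputable def mcol : α → ZFSet.{u} :=
  wf.fix fun a ih => ZFSet.range fun b : {b // r b a} => ih b.1 b.2

theorem mem_mcol {a : α} {x : ZFSet.{u}} : x ∈ mcol wf a ↔ ∃ b, r b a ∧ mcol wf b = x := by
  rw [mcol, wf.fix_eq]
  simp

end

variable {A P x y : ZFSet.{u}} {ξ η : Ordinal.{u}} {c : Cardinal.{u}}

/-- A transitive set that is closed under the operations and all of whose elements belong to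
levels with sequences in the set is a level. -/
theorem eq_lev_of_closed {T : ZFSet.{u}} (hT : T.IsTransitive) (hne : T.Nonempty)
    (hcut : ∀ S ∈ T, ∀ a ∈ T, ∀ b ∈ T, ∀ i, ∃ w ∈ T, IsCut A S i a b w)
    (hup : ∀ x ∈ T, ∃ K i S r, IsSeq A K ∧ pair i (pair S r) ∈ K ∧ x ∈ S ∧ S ∈ T) :
    ∃ β, Order.IsSuccLimit β ∧ T = lev A β := by
  have hup' : ∀ x ∈ T, ∃ ξ, x ∈ lev A ξ ∧ lev A ξ ∈ T := by
    intro x hx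
    obtain ⟨K, i, S, r, hK, hp, hxS, hS⟩ := hup x hx
    obtain ⟨ξ, hξ⟩ := hK.eq_lp i _ hp
    rw [lp, ZFSet.pair_inj] at hξ
    exact ⟨ξ, hξ.1 ▸ hxS, hξ.1 ▸ hS⟩
  -- The least strict upper bound of the ordinals whose levels belong to `T`.
  obtain ⟨β, hβ, hmin⟩ := WellFounded.has_min (wellFounded_lt (α := Ordinal.{u}))
    {β | ∀ ξ, lev A ξ ∈ T → ξ < β} ⟨T.rank, fun ξ hξ =>
      (le_rank_lev A ξ).trans_lt (ZFSet.rank_lt_of_mem hξ)⟩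
  have hβ' : ∀ η < β, ∃ ξ, η ≤ ξ ∧ lev A ξ ∈ T := by
    intro η hη
    by_contra hn
    push Not at hn
    exact hmin η (fun ξ hξ => lt_of_not_ge fun h => hn ξ h hξ) hη
  have hcut' : ∀ ξ, lev A ξ ∈ T → lev A (ξ + 1) ⊆ T := by
    intro ξ hξ x hx
    have hm : ∀ a, a ∈ lev A ξ ∨ a = lev A ξ → a ∈ T := by
      rintro a (ha | rfl)
      · exact hT _ hξ ha
      · exact hξ
    rcases mem_lev_add_one.1 hx with hx | ⟨i, a, ha, b, hb, hx⟩
    · exact hT _ hξ hx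
    · obtain ⟨w, hw, hw'⟩ := hcut _ hξ a (hm a ha) b (hm b hb) i
      rw [isCut_iff] at hx hw'
      rw [hx, ← hw']
      exact hw
  have hT' : T = lev A β := by
    ext x
    constructor
    · intro hx
      obtain ⟨ξ, hxξ, hξ⟩ := hup' x hx
      exact lev_mono (hβ ξ hξ).le hxξ
    · intro hx
      obtain ⟨η, hη, hx⟩ := mem_lev.1 hx
      obtain ⟨ξ, hle, hξ⟩ := hβ' η hη
      exact hcut' ξ hξ (hx.mem_lev (Order.lt_add_one_iff.2 hle))
  refine ⟨β, ?_, hT'⟩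
  rw [Ordinal.isSuccLimit_iff, Order.isSuccPrelimit_iff_succ_lt]
  constructor
  · rintro rfl
    obtain ⟨x, hx⟩ := hne
    obtain ⟨ξ, -, hξ⟩ := hup' x hx
    exact absurd (hβ ξ hξ) (by simp)
  -- A level in `T` is an element of a further level in `T`, so β is not a successor.
  · intro η hη
    obtain ⟨ξ, hle, hξ⟩ := hβ' η hη
    obtain ⟨ζ, hζ, hζT⟩ := hup' _ hξ
    have := lev_mem_lev_iff.1 hζ
    exact (Order.succ_le_of_lt (hle.trans_lt this)).trans_lt (hβ ζ hζT)

/-- Closed sets: the domains of the elementary embeddings considered. -/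
structure Cl (A X : ZFSet.{u}) : Prop where
  gClosed : GClosed A X
  meet : ∀ x ∈ X, x.Nonempty → ∃ z ∈ x, z ∈ X
  seq : ∀ x ∈ X, ∃ K ∈ X, ∃ i ∈ X, ∃ S ∈ X, ∃ r ∈ X, IsSeq A K ∧ pair i (pair S r) ∈ K ∧ x ∈ S

namespace Cl

variable {X : ZFSet.{u}}

theorem exists_lev (h : Cl A X) (hx : x ∈ X) : ∃ ξ, x ∈ lev A ξ ∧ lev A ξ ∈ X := by
  obtain ⟨K, -, i, -, S, hS, r, -, hK, hp, hxS⟩ := h.seq x hx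
  obtain ⟨ξ, hξ⟩ := hK.eq_lp i _ hp
  rw [lp, ZFSet.pair_inj] at hξ
  exact ⟨ξ, hξ.1 ▸ hxS, hξ.1 ▸ hS⟩

theorem exists_lev_vec (h : Cl A X) {n : ℕ} (v : Fin n → ZFSet.{u}) (hv : ∀ i, v i ∈ X) :
    ∃ ξ, (∀ i, v i ∈ lev A ξ) ∧ lev A ξ ∈ X := by
  induction n with
  | zero =>
    obtain ⟨ξ, -, hξ⟩ := h.exists_lev h.gClosed.1
    exact ⟨ξ, fun i => i.elim0, hξ⟩
  | succ n ih =>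
    obtain ⟨ξ, hξ, hξX⟩ := ih (Fst v) (fun i => hv _)
    obtain ⟨η, hη, hηX⟩ := h.exists_lev (hv (Fin.last n))
    rcases le_total ξ η with hle | hle
    · exact ⟨η, fun i => Fin.lastCases hη (fun i => lev_mono hle (hξ i)) i, hηX⟩
    · exact ⟨ξ, fun i => Fin.lastCases (lev_mono hle hη) hξ i, hξX⟩

theorem tup_mem {n : ℕ} (h : GClosed A X) {v : Fin n → ZFSet.{u}} (hv : ∀ i, v i ∈ X) :
    tup v ∈ X := by
  induction n with
  | zero => exact h.1
  | succ n ih => exact h.opair (hv _) (ih fun i => hv _)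

/-- The Tarski–Vaught criterion for bounded formulas: the set of all witnesses is a section of a
generated relation on a level in `X`, so it is an element of `X` and, being nonempty, meets `X`. -/
theorem exists_mem (h : Cl A X) {n : ℕ} (φ : Fm (n + 1)) {v : Fin n → ZFSet.{u}}
    (hv : ∀ i, v i ∈ X) (i : Fin n)
    (hz : ∃ z ∈ v i, Sat A φ (Fin.snoc (α := fun _ => ZFSet.{u}) v z)) :
    ∃ z ∈ v i, z ∈ X ∧ Sat A φ (Fin.snoc (α := fun _ => ZFSet.{u}) v z) := by
  obtain ⟨ξ, hξ, hξX⟩ := h.exists_lev_vec v hv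
  have hne : (lev A ξ).Nonempty := ⟨v i, hξ i⟩
  obtain ⟨R, hR, hR'⟩ := (IsRel.mem (A := A) (m := lev A ξ) (Fin.last n) i.castSucc).and
    (IsRel.sat (isTransitive_lev A ξ) φ)
  have hw := h.gClosed.2 9 R (h.gClosed.rel hξX hne hR).2 (tup v) (tup_mem h.gClosed hv)
  have hmem : ∀ z, z ∈ G A 9 R (tup v) ↔
      z ∈ v i ∧ Sat A φ (Fin.snoc (α := fun _ => ZFSet.{u}) v z) := by
    intro z
    rw [mem_G]
    change pair z (tup v) ∈ R ↔ _
    rw [← tup_snoc]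
    by_cases hz : z ∈ lev A ξ
    · rw [hR' _ (fun i => Fin.lastCases (by simpa) (fun i => by simpa using hξ i) i)]
      simp
    · constructor
      · intro hp
        have := hR.subset hp
        rw [tup_snoc, pw_succ A, mem_G_two] at this
        exact absurd this.1 hz
      · intro hp
        exact absurd (isTransitive_lev A ξ _ (hξ i) hp.1) hz
  obtain ⟨z, hz⟩ := hz
  obtain ⟨z, hz, hzX⟩ := h.meet _ hw ⟨z, (hmem z).2 hz⟩
  exact ⟨z, ((hmem z).1 hz).1, hzX, ((hmem z).1 hz).2⟩

open Classical in
/-- The transitive collapse of `X`. -/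
noncomputable def col (X : ZFSet.{u}) (x : ZFSet.{u}) : ZFSet.{u} :=
  if hx : x ∈ X then mcol (r := fun a b : X => a.1 ∈ b.1)
    (InvImage.wf (fun a : X => a.1) ZFSet.mem_wf) ⟨x, hx⟩ else ∅

theorem mem_col (hx : x ∈ X) : y ∈ col X x ↔ ∃ z ∈ x, z ∈ X ∧ col X z = y := by
  rw [col, dif_pos hx, mem_mcol]
  constructor
  · rintro ⟨⟨z, hz⟩, hzx, rfl⟩
    exact ⟨z, hzx, hz, by rw [col, dif_pos hz]⟩
  · rintro ⟨z, hzx, hz, rfl⟩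
    exact ⟨⟨z, hz⟩, hzx, by rw [col, dif_pos hz]⟩

/-- The image of `Z ∩ X` under the collapse of `X`. -/
noncomputable def colImage (X Z : ZFSet.{u}) : ZFSet.{u} :=
  ZFSet.range fun z : {z : X // z.1 ∈ Z} => col X z.1.1

theorem mem_colImage {Z : ZFSet.{u}} : y ∈ colImage X Z ↔ ∃ z ∈ X, z ∈ Z ∧ col X z = y := by
  simp only [colImage, ZFSet.mem_range, Subtype.exists, exists_prop]

/-- `X` is extensional though not transitive: if x is not included in y, then the difference is a
nonempty element of `X` and so meets `X`. -/
theorem col_injOn (h : Cl A X) : ∀ x ∈ X, ∀ y ∈ X, col X x = col X y → x = y := by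
  have key : ∀ x y, x ∈ X → y ∈ X → col X x = col X y →
      (∀ z ∈ x, z ∈ X → ∀ w ∈ X, col X z = col X w → z = w) → x ⊆ y := by
    intro x y hx hy he ih
    by_contra hn
    rw [ZFSet.subset_def] at hn
    push Not at hn
    obtain ⟨z, hz, hz'⟩ := hn
    obtain ⟨z, hz, hzX⟩ := h.meet _ (h.gClosed.2 1 x hx y hy) ⟨z, mem_G.2 ⟨hz, hz'⟩⟩
    obtain ⟨hzx, hzy⟩ := mem_G.1 hz
    have : col X z ∈ col X y := he ▸ (mem_col hx).2 ⟨z, hzx, hzX, rfl⟩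
    obtain ⟨w, hw, hwX, hwz⟩ := (mem_col hy).1 this
    exact hzy (ih z hzx hzX w hwX hwz.symm ▸ hw)
  intro x
  induction x using ZFSet.inductionOn with
  | h x ih =>
  intro hx y hy he
  refine subset_antisymm (key x y hx hy he fun z hz hzX w hw => ih z hz hzX w hw) ?_
  intro w hw
  refine key y x hy hx he.symm (fun w hw hwX z hz hwz => ?_) hw
  have : col X w ∈ col X x := he ▸ (mem_col hy).2 ⟨w, hw, hwX, rfl⟩
  obtain ⟨z', hz', hzX', hz'w⟩ := (mem_col hx).1 this
  have h1 := ih z' hz' hzX' w hwX hz'w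
  have h2 := ih z' hz' hzX' z hz (hz'w.trans hwz)
  exact h1.symm.trans h2

theorem sat_col (h : Cl A X) {n : ℕ} (φ : Fm n) {v : Fin n → ZFSet.{u}} (hv : ∀ i, v i ∈ X) :
    Sat A φ v ↔ Sat (colImage X A) φ (fun i => col X (v i)) := by
  induction φ with
  | mem i j =>
    simp only [Sat]
    rw [mem_col (hv j)]
    exact ⟨fun hm => ⟨_, hm, hv i, rfl⟩, fun ⟨z, hz, hzX, he⟩ => h.col_injOn z hzX _ (hv i) he ▸ hz⟩
  | pred i =>
    simp only [Sat]
    rw [mem_colImage]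
    exact ⟨fun hm => ⟨_, hv i, hm, rfl⟩, fun ⟨z, hzX, hz, he⟩ => h.col_injOn z hzX _ (hv i) he ▸ hz⟩
  | neg φ ih => simp only [Sat, ih hv]
  | and φ ψ ih ih' => simp only [Sat, ih hv, ih' hv]
  | bex i φ ih =>
    simp only [Sat]
    have hs : ∀ z ∈ X, (Sat A φ (Fin.snoc (α := fun _ => ZFSet.{u}) v z) ↔
        Sat (colImage X A) φ (Fin.snoc (α := fun _ => ZFSet.{u}) (fun i => col X (v i)) (col X z))) := by
      intro z hz
      rw [ih (v := Fin.snoc (α := fun _ => ZFSet.{u}) v z)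
        (fun i => Fin.lastCases (by simpa) (fun i => by simpa using hv i) i)]
      refine iff_of_eq (congrArg _ (funext fun i => ?_))
      refine Fin.lastCases ?_ (fun i => ?_) i <;> simp
    constructor
    · intro hz
      obtain ⟨z, hz, hzX, hs'⟩ := h.exists_mem φ hv i hz
      exact ⟨col X z, (mem_col (hv i)).2 ⟨z, hz, hzX, rfl⟩, (hs z hzX).1 hs'⟩
    · rintro ⟨_, hz, hs'⟩
      obtain ⟨z, hzv, hzX, rfl⟩ := (mem_col (hv i)).1 hz
      exact ⟨z, hzv, (hs z hzX).2 hs'⟩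

theorem d0_col (h : Cl A X) {n : ℕ} {Q : ZFSet.{u} → (Fin n → ZFSet.{u}) → Prop} (hQ : D0 Q)
    {v : Fin n → ZFSet.{u}} (hv : ∀ i, v i ∈ X) :
    Q A v ↔ Q (colImage X A) (fun i => col X (v i)) := by
  obtain ⟨φ, hφ⟩ := hQ
  rw [hφ, hφ, h.sat_col φ hv]

/-- Condensation. Closure under cuts and the existence of codes of levels are bounded statements and
so pass to the collapse, where the image of `A` is the predicate. -/
theorem colImage_self_eq_lev (h : Cl A X) :
    ∃ β, Order.IsSuccLimit β ∧ colImage X X = lev (colImage X A) β := by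
  have hmem : ∀ {y}, y ∈ colImage X X ↔ ∃ x ∈ X, col X x = y := by
    intro y
    rw [mem_colImage]
    exact ⟨fun ⟨z, hz, _, h⟩ => ⟨z, hz, h⟩, fun ⟨z, hz, h⟩ => ⟨z, hz, hz, h⟩⟩
  refine eq_lev_of_closed ?_ ⟨_, hmem.2 ⟨∅, h.gClosed.1, rfl⟩⟩ ?_ ?_
  · intro y hy z hz
    obtain ⟨x, hx, rfl⟩ := hmem.1 hy
    obtain ⟨w, -, hw, rfl⟩ := (mem_col hx).1 hz
    exact hmem.2 ⟨w, hw, rfl⟩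
  · intro S' hS' a' ha' b' hb' i
    obtain ⟨S, hS, rfl⟩ := hmem.1 hS'
    obtain ⟨a, ha, rfl⟩ := hmem.1 ha'
    obtain ⟨b, hb, rfl⟩ := hmem.1 hb'
    -- The double difference S ∖ (S ∖ G) is S ∩ G, which expresses the cut by operations under which
    -- `X` is closed.
    have hw := h.gClosed.2 1 S hS _ (h.gClosed.2 1 S hS _ (h.gClosed.2 i a ha b hb))
    have hcut : IsCut A S i a b (G A 1 S (G A 1 S (G A i a b))) := by
      rw [isCut_iff]
      ext z
      simp only [mem_G, GMem, ZFSet.mem_inter]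
      tauto
    generalize G A 1 S (G A 1 S (G A i a b)) = w at hw hcut
    refine ⟨_, hmem.2 ⟨w, hw, rfl⟩, ?_⟩
    have hD : D0 (n := 4) (fun A e => IsCut A (e 0) i (e 1) (e 2) (e 3)) := by
      apply_rules [D0.isCut, IsVar.mk]
    exact (h.d0_col hD (v := ![S, a, b, w]) (by simp [Fin.forall_fin_succ, hS, ha, hb, hw])).1 hcut
  · intro y hy
    obtain ⟨x, hx, rfl⟩ := hmem.1 hy
    obtain ⟨K, hK, i, hi, S, hS, r, hr, h1, h2, h3⟩ := h.seq x hx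
    have hD : D0 (n := 5) (fun A e => IsSeq A (e 0) ∧ (∃ q ∈ e 0, ∃ b d, q = pair b d ∧ b = e 1 ∧
        d = pair (e 2) (e 3)) ∧ e 4 ∈ e 2) := by
      apply_rules [D0.isSeq, D0.opair, D0.mem, D0.and, D0.bex, D0.expair, D0.eq, IsVar.mk]
    have := (h.d0_col hD (v := ![K, i, S, r, x])
      (by simp [Fin.forall_fin_succ, hK, hi, hS, hr, hx])).1 (by
        simp only [Matrix.cons_val]
        exact ⟨h1, ⟨_, h2, _, _, rfl, rfl, rfl⟩, h3⟩)
    simp only [Matrix.cons_val] at this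
    obtain ⟨h1, ⟨_, h2, b, d, rfl, rfl, rfl⟩, h3⟩ := this
    exact ⟨_, _, _, _, h1, h2, h3, hmem.2 ⟨S, hS, rfl⟩⟩

theorem col_eq_self {Y : ZFSet.{u}} (hY : Y.IsTransitive) (hYX : Y ⊆ X) (hx : x ∈ Y) :
    col X x = x := by
  induction x using ZFSet.inductionOn with
  | h x ih =>
  ext z
  rw [mem_col (hYX hx)]
  constructor
  · rintro ⟨w, hw, -, rfl⟩
    rwa [ih w hw (hY x hx hw)]
  · intro hz
    exact ⟨z, hz, hYX (hY x hx hz), ih z hz (hY x hx hz)⟩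

end Cl
open ZFSet (pair)

/-! ### Hulls -/

variable {A P x y : ZFSet.{u}} {ξ η : Ordinal.{u}} {c d : Cardinal.{u}}

theorem le_card_lev (A : ZFSet.{u}) (h : c.ord ≤ ξ) : c ≤ (lev A ξ).card := by
  have hle : lift.{u + 1} c ≤ #(lev A ξ) := by
    have := mk_le_of_injective (α := Set.Iio c.ord) (β := lev A ξ)
      (f := fun η => ⟨lev A η.1, lev_mem_lev (η.2.trans_le h)⟩) (fun a b hab =>
        Subtype.ext (lev_injective A (Subtype.ext_iff.1 hab)))
    rwa [mk_Iio_ordinal, card_ord] at this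
  rwa [ZFSet.cardinalMk_coe_sort, lift_le] at hle

theorem isSeq_seqOf (P : ZFSet.{u}) (ξ : Ordinal.{u}) : IsSeq P (seqOf (lp P) ξ) := by
  intro p hp
  obtain ⟨η, hη, rfl⟩ := mem_seqOf.1 hp
  refine ⟨_, _, rfl, _, _, rfl, (isEntry_iff_of_seq fun ζ hζ m => ?_).2 ⟨rfl, rfl⟩⟩
  rw [pair_mem_seqOf, and_iff_right (hζ.trans hη)]

theorem cl_lev (P : ZFSet.{u}) (hd : d.IsRegular) (hd' : ℵ₀ < d) : Cl P (lev P d.ord) where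
  gClosed := gClosed_lev (isSuccLimit_ord hd'.le)
  meet := by
    rintro x hx ⟨z, hz⟩
    exact ⟨z, hz, isTransitive_lev P _ _ hx hz⟩
  seq := by
    intro x hx
    have hl := isSuccLimit_ord hd'.le
    obtain ⟨η, hη, hx⟩ := (mem_lev_of_isSuccLimit hl).1 hx
    have hK := ((hier_lev P hd hd').seq_lp_mem (hl.add_one_lt hη)).1
    have hp : pair η.toZFSet (pair (lev P η) (levLe P η)) ∈ seqOf (lp P) (η + 1) :=
      pair_mem_seqOf.2 ⟨Order.lt_add_one_iff.2 le_rfl, rfl⟩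
    have ht := isTransitive_lev P d.ord
    have h1 := of_pair_mem ht (ht _ hK hp)
    have h2 := of_pair_mem ht h1.2
    exact ⟨_, hK, _, h1.1, _, h2.1, _, h2.2, isSeq_seqOf P _, hp, hx⟩

/-- One step in the construction of a hull. -/
structure HullStep (P : ZFSet.{u}) (c : Cardinal.{u}) (Y Y' : ZFSet.{u}) : Prop where
  sub : Y ⊆ Y'
  op : ∀ i, ∀ x ∈ Y, ∀ y ∈ Y, G P i x y ∈ Y'
  meet : ∀ x ∈ Y, x.Nonempty → ∃ z ∈ x, z ∈ Y'
  seq : ∀ x ∈ Y, ∃ K ∈ Y', ∃ i ∈ Y', ∃ S ∈ Y', ∃ r ∈ Y', IsSeq P K ∧ pair i (pair S r) ∈ K ∧ x ∈ S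
  lev : ∃ γ < c.ord, (∀ x ∈ Y, x ∈ lev P c.ord → x ∈ lev P γ) ∧ RelConstr.lev P γ ⊆ Y'

theorem card_union_lt (hc : ℵ₀ ≤ c) (hx : x.card < c) (hy : y.card < c) : (x ∪ y).card < c :=
  (ZFSet.card_union_le).trans_lt (add_lt_of_lt hc hx hy)

theorem exists_hullStep (hc : c.IsRegular) (hc' : ℵ₀ < c) (hd : d.IsRegular) (hcd : c ≤ d)
    {Y : ZFSet.{u}} (hY : Y ⊆ lev P d.ord) (hYc : Y.card < c) :
    ∃ Y', Y' ⊆ lev P d.ord ∧ Y'.card < c ∧ HullStep P c Y Y' := by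
  have hcl := cl_lev P hd (hc'.trans_le hcd)
  have hm : ∀ x, ∃ z, x ∈ lev P d.ord → z ∈ lev P d.ord ∧ (x.Nonempty → z ∈ x) := by
    intro x
    rcases x.eq_empty_or_nonempty with rfl | ⟨z, hz⟩
    · exact ⟨∅, fun h => ⟨h, fun h' => absurd h' (by simp)⟩⟩
    · exact ⟨z, fun hx => ⟨isTransitive_lev P _ _ hx hz, fun _ => hz⟩⟩
  choose ch hch using hm
  have hs : ∀ x, ∃ K i S r, x ∈ lev P d.ord → K ∈ lev P d.ord ∧ i ∈ lev P d.ord ∧ S ∈ lev P d.ord ∧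
      r ∈ lev P d.ord ∧ IsSeq P K ∧ pair i (pair S r) ∈ K ∧ x ∈ S := by
    intro x
    by_cases hx : x ∈ lev P d.ord
    · obtain ⟨K, hK, i, hi, S, hS, r, hr, h⟩ := hcl.seq x hx
      exact ⟨K, i, S, r, fun _ => ⟨hK, hi, hS, hr, h⟩⟩
    · exact ⟨∅, ∅, ∅, ∅, fun h => absurd h hx⟩
  choose fK fi fS fr hf using hs
  -- Besides the ten operations: the identity, a chosen element, and the four components of a code
  -- of a level containing x.
  let f : Fin 10 ⊕ Fin 6 → ZFSet.{u} → ZFSet.{u} → ZFSet.{u} := fun k x y =>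
    match k with
    | .inl i => G P i x y
    | .inr j => ![x, ch x, fK x, fi x, fS x, fr x] j
  have hfmem : ∀ k, ∀ x ∈ lev P d.ord, ∀ y ∈ lev P d.ord, f k x y ∈ lev P d.ord := by
    rintro (i | j) x hx y hy
    · exact hcl.gClosed.2 i x hx y hy
    · have := hf x hx
      have := hch x hx
      fin_cases j <;> simp [f] <;> tauto
  -- A whole level around the part of `Y` below `c.ord` is added, which makes that part a level in
  -- the limit.
  obtain ⟨γ, hγ, -, hγY⟩ := (hier_lev P hc hc').exists_bound (Z := Y ∩ lev P c.ord)
    ((ZFSet.card_mono fun z hz => (ZFSet.mem_inter.1 hz).1).trans_lt hYc)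
    fun z hz => (ZFSet.mem_inter.1 hz).2
  set H : ZFSet.{u} := ZFSet.range fun p : (Fin 10 ⊕ Fin 6) × Y × Y => f p.1 p.2.1.1 p.2.2.1
    with hH
  have hmem : ∀ k, ∀ x ∈ Y, ∀ y ∈ Y, f k x y ∈ H ∪ lev P γ := by
    intro k x hx y hy
    simp only [hH, ZFSet.mem_union, ZFSet.mem_range]
    exact .inl ⟨⟨k, ⟨x, hx⟩, ⟨y, hy⟩⟩, rfl⟩
  have hHc : H.card < c := by
    refine (card_le_of_cover (ι := ULift (Fin 10 ⊕ Fin 6)) (μ := max ℵ₀ Y.card) (X := Y)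
      (le_max_left _ _) ?_ (le_max_right _ _) (fun k => f k.down) ?_).trans_lt (max_lt hc' hYc)
    · exact (lt_aleph0_of_finite _).le.trans (le_max_left _ _)
    · intro z hz
      simp only [hH, ZFSet.mem_range] at hz
      obtain ⟨⟨k, ⟨x, hx⟩, ⟨y, hy⟩⟩, rfl⟩ := hz
      exact ⟨⟨k⟩, x, hx, y, hy, rfl⟩
  refine ⟨H ∪ lev P γ, ?_, card_union_lt hc'.le hHc (card_lev_lt P hc' hγ), ?_⟩
  · intro z hz
    rcases ZFSet.mem_union.1 hz with hz | hz
    · simp only [hH, ZFSet.mem_range] at hz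
      obtain ⟨⟨k, ⟨x, hx⟩, ⟨y, hy⟩⟩, rfl⟩ := hz
      exact hfmem k x (hY hx) y (hY hy)
    · exact lev_mono (hγ.le.trans (ord_le_ord.2 hcd)) hz
  · refine ⟨fun x hx => hmem (.inr 0) x hx x hx, fun i x hx y hy => hmem (.inl i) x hx y hy,
      fun x hx hne => ⟨ch x, (hch x (hY hx)).2 hne, hmem (.inr 1) x hx x hx⟩, fun x hx => ?_,
      γ, hγ, fun x hx hx' => hγY (ZFSet.mem_inter.2 ⟨hx, hx'⟩), fun z hz => ZFSet.mem_union.2 (.inr hz)⟩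
    exact ⟨_, hmem (.inr 2) x hx x hx, _, hmem (.inr 3) x hx x hx, _, hmem (.inr 4) x hx x hx, _,
      hmem (.inr 5) x hx x hx, (hf x (hY hx)).2.2.2.2⟩

/-- Iterate the step ω times. The levels added on the way are cofinal in the part of the hull below
`c.ord`, so that part is exactly the level δ, the supremum of their heights; regularity and
uncountability of `c` keep δ and the size of the hull small. -/
theorem exists_closed (hc : c.IsRegular) (hc' : ℵ₀ < c) (hd : d.IsRegular) (hcd : c ≤ d)
    {B : ZFSet.{u}} (hB : B ⊆ lev P d.ord) (hBc : B.card < c) :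
    ∃ Y, B ⊆ Y ∧ Y ⊆ lev P d.ord ∧ Y.card < c ∧ Cl P Y ∧
      ∃ δ < c.ord, ∀ x, x ∈ lev P δ ↔ x ∈ Y ∧ x ∈ lev P c.ord := by
  have hcl := cl_lev P hd (hc'.trans_le hcd)
  have hstep : ∀ Y : {Y : ZFSet.{u} // Y ⊆ lev P d.ord ∧ Y.card < c}, ∃ Y' :
      {Y : ZFSet.{u} // Y ⊆ lev P d.ord ∧ Y.card < c}, HullStep P c Y.1 Y'.1 := by
    rintro ⟨Y, hY, hYc⟩
    obtain ⟨Y', h1, h2, h3⟩ := exists_hullStep hc hc' hd hcd hY hYc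
    exact ⟨⟨Y', h1, h2⟩, h3⟩
  choose F hF using hstep
  let Y0 : {Y : ZFSet.{u} // Y ⊆ lev P d.ord ∧ Y.card < c} := ⟨insert ∅ B, by
    intro z hz
    rcases ZFSet.mem_insert_iff.1 hz with rfl | hz
    · exact hcl.gClosed.1
    · exact hB hz, ZFSet.card_insert_le.trans_lt (add_lt_of_lt hc'.le hBc (one_lt_aleph0.trans hc'))⟩
  let Z : ℕ → {Y : ZFSet.{u} // Y ⊆ lev P d.ord ∧ Y.card < c} := fun n => F^[n] Y0
  have hZ : ∀ n, HullStep P c (Z n).1 (Z (n + 1)).1 := by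
    intro n
    simp only [Z, Function.iterate_succ_apply']
    exact hF _
  have hmono : ∀ n k, n ≤ k → (Z n).1 ⊆ (Z k).1 := by
    intro n k h
    induction h with
    | refl => exact subset_rfl
    | step _ ih => exact ih.trans (hZ _).sub
  set Y : ZFSet.{u} := ZFSet.iUnion fun n : ULift.{u} ℕ => (Z n.down).1 with hY
  have hmem : ∀ {x}, x ∈ Y ↔ ∃ n, x ∈ (Z n).1 := by
    intro x
    simp [hY]
  choose γ hγ hγ1 hγ2 using fun n => (hZ n).lev
  have hlt : ⨆ n : ULift.{u} ℕ, γ n.down < c.ord := by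
    refine Ordinal.iSup_lt_of_lt_cof ?_ fun n => hγ n.down
    rwa [hc.cof_ord, mk_uLift, mk_nat, lift_aleph0]
  refine ⟨Y, fun x hx => hmem.2 ⟨0, ZFSet.mem_insert_iff.2 (.inr hx)⟩, ?_, ?_, ?_, _, hlt, ?_⟩
  · intro x hx
    obtain ⟨n, hn⟩ := hmem.1 hx
    exact (Z n).2.1 hn
  · rw [← lift_id Y.card]
    refine ZFSet.lift_card_iUnion_le_sum_card.trans_lt ((sum_le_mk_mul_iSup _).trans_lt
      (mul_lt_of_lt hc'.le ?_ (iSup_lt_of_lt_cof_ord ?_ fun n => (Z n.down).2.2)))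
    · rwa [mk_uLift, mk_nat, lift_aleph0]
    · rwa [hc.cof_ord, mk_uLift, mk_nat, lift_aleph0]
  · refine ⟨⟨hmem.2 ⟨0, ZFSet.mem_insert_iff.2 (.inl rfl)⟩, fun i x hx y hy => ?_⟩,
      fun x hx hne => ?_, fun x hx => ?_⟩
    · obtain ⟨n, hn⟩ := hmem.1 hx
      obtain ⟨k, hk⟩ := hmem.1 hy
      exact hmem.2 ⟨_, (hZ (max n k)).op i x (hmono _ _ (le_max_left _ _) hn) y
        (hmono _ _ (le_max_right _ _) hk)⟩
    · obtain ⟨n, hn⟩ := hmem.1 hx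
      obtain ⟨z, hz, hz'⟩ := (hZ n).meet x hn hne
      exact ⟨z, hz, hmem.2 ⟨_, hz'⟩⟩
    · obtain ⟨n, hn⟩ := hmem.1 hx
      obtain ⟨K, hK, i, hi, S, hS, r, hr, h⟩ := (hZ n).seq x hn
      exact ⟨K, hmem.2 ⟨_, hK⟩, i, hmem.2 ⟨_, hi⟩, S, hmem.2 ⟨_, hS⟩, r, hmem.2 ⟨_, hr⟩, h⟩
  · intro x
    constructor
    · intro hx
      obtain ⟨η, hη, hx⟩ := mem_lev.1 hx
      obtain ⟨n, hn⟩ := Ordinal.lt_iSup_iff.1 hη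
      have hx' := hx.mem_lev hn
      exact ⟨hmem.2 ⟨_, hγ2 _ hx'⟩, lev_mono (hγ _).le hx'⟩
    · rintro ⟨hx, hx'⟩
      obtain ⟨n, hn⟩ := hmem.1 hx
      exact lev_mono (Ordinal.le_iSup (fun n : ULift.{u} ℕ => γ n.down) ⟨n⟩) (hγ1 n x hn hx')

theorem card_le_of_image (F : ZFSet.{u} → ZFSet.{u}) (h : ∀ z ∈ y, ∃ w ∈ x, F w = z) :
    y.card ≤ x.card := by
  have : #y ≤ #x := (mk_subtype_mono (p := fun z => z ∈ y)
    (q := fun z => z ∈ Set.range fun w : x => F w.1) fun z hz => by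
      obtain ⟨w, hw, rfl⟩ := h z hz
      exact ⟨⟨w, hw⟩, rfl⟩).trans mk_range_le
  rwa [ZFSet.cardinalMk_coe_sort, ZFSet.cardinalMk_coe_sort, lift_le] at this

theorem card_colImage_le (X Z : ZFSet.{u}) : (Cl.colImage X Z).card ≤ X.card :=
  card_le_of_image (Cl.col X) fun y hy => by
    obtain ⟨z, hz, -, he⟩ := Cl.mem_colImage.1 hy
    exact ⟨z, hz, he⟩

/-- Small sets are contained in closed sets whose transitive collapse belongs to the hierarchy. -/
theorem exists_hull (hc : c.IsRegular) (hc' : ℵ₀ < c) (hd : d.IsRegular) (hcd : c ≤ d)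
    (hP : P ⊆ lev P c.ord) {B : ZFSet.{u}} (hB : B ⊆ lev P d.ord) (hBc : B.card < c) :
    ∃ Y δ, B ⊆ Y ∧ Cl P Y ∧ δ < c.ord ∧ (∀ x, x ∈ lev P δ ↔ x ∈ Y ∧ x ∈ lev P c.ord) ∧
      Cl.colImage Y P = P ∩ lev P δ ∧ (∀ x ∈ lev P δ, Cl.col Y x = x) ∧
      Cl.colImage Y Y ∈ lev P c.ord := by
  obtain ⟨Y, hBY, hYd, hYc, hcl, δ, hδ, h⟩ := exists_closed hc hc' hd hcd hB hBc
  have hcol : ∀ x ∈ lev P δ, Cl.col Y x = x := fun x hx =>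
    Cl.col_eq_self (isTransitive_lev P δ) (fun z hz => ((h z).1 hz).1) hx
  have hP' : Cl.colImage Y P = P ∩ lev P δ := by
    ext x
    rw [Cl.mem_colImage, ZFSet.mem_inter]
    constructor
    · rintro ⟨z, hz, hzP, rfl⟩
      have := (h z).2 ⟨hz, hP hzP⟩
      rw [hcol z this]
      exact ⟨hzP, this⟩
    · rintro ⟨hx, hx'⟩
      exact ⟨x, ((h x).1 hx').1, hx, hcol x hx'⟩
  refine ⟨Y, δ, hBY, hcl, hδ, h, hP', hcol, ?_⟩
  have H := hier_lev P hc hc'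
  obtain ⟨β, -, hβ⟩ := hcl.colImage_self_eq_lev
  -- A level of height at least `c.ord` has at least `c` elements, more than the hull.
  have hβc : β < c.ord := by
    by_contra hn
    exact absurd ((le_card_lev (Cl.colImage Y P) (not_lt.1 hn)).trans
      (hβ ▸ card_colImage_le Y Y)) (not_le.2 hYc)
  rw [hβ]
  -- The collapse is a level built from P ∩ `lev P δ`, which is an element of the hierarchy of `P`,
  -- so this level can be constructed there.
  refine (H.param ?_).lev_mem hβc
  rw [hP']
  have := H.sepD0 (n := 0) (Q := fun A _ z => z ∈ A) (by apply_rules [D0.pred, IsVar.mk]) ![]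
    (by simp) (H.mem hδ)
  convert this using 1
  ext z
  simp [and_comm]

/-- As in Gödel's proof of GCH: a hull of x and the level ξ has its collapse in `lev P c.ord`, and
the collapse fixes every element of x, hence x itself. This makes the ultrafilters below decide sets
constructed only before `d.ord`. -/
theorem mem_lev_of_subset_lev (hc : c.IsRegular) (hc' : ℵ₀ < c) (hd : d.IsRegular) (hcd : c ≤ d)
    (hP : P ⊆ lev P c.ord) (hx : x ∈ lev P d.ord) (hξ : ξ < c.ord) (hxξ : x ⊆ lev P ξ) :
    x ∈ lev P c.ord := by
  obtain ⟨Y, δ, hBY, hcl, hδ, h, -, hcol, hmem⟩ := exists_hull hc hc' hd hcd hP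
    (B := insert x (lev P ξ)) (by
      intro z hz
      rcases ZFSet.mem_insert_iff.1 hz with rfl | hz
      · exact hx
      · exact lev_mono (hξ.le.trans (ord_le_ord.2 hcd)) hz)
    (ZFSet.card_insert_le.trans_lt
      (add_lt_of_lt hc'.le (card_lev_lt P hc' hξ) (one_lt_aleph0.trans hc')))
  have hxY : x ∈ Y := hBY (by simp)
  have hsub : ∀ z ∈ x, z ∈ lev P δ := fun z hz =>
    (h z).2 ⟨hBY (ZFSet.mem_insert_iff.2 (.inr (hxξ hz))), lev_mono hξ.le (hxξ hz)⟩
  have hcx : Cl.col Y x = x := by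
    ext z
    rw [Cl.mem_col hxY]
    constructor
    · rintro ⟨w, hw, -, rfl⟩
      rwa [hcol w (hsub w hw)]
    · intro hz
      exact ⟨z, hz, ((h z).1 (hsub z hz)).1, hcol z (hsub z hz)⟩
  exact isTransitive_lev P _ _ hmem (Cl.mem_colImage.2 ⟨x, hxY, hxY, hcx⟩)

open ZFSet (pair)

/-! ### Values of functions -/

variable {A B P x y z f u : ZFSet.{u}} {ξ η : Ordinal.{u}} {c d : Cardinal.{u}} {n : ℕ}

/-- `z` belongs to the value of the function `f` at `x`. -/
def MemApp (f x z : ZFSet.{u}) : Prop := ∃ p ∈ f, ∃ b y, p = pair b y ∧ b = x ∧ z ∈ y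

theorem D0.memApp {t s w : (Fin n → ZFSet.{u}) → ZFSet.{u}} (ht : IsVar t) (hs : IsVar s)
    (hw : IsVar w) : D0 (fun _ e => MemApp (t e) (s e) (w e)) := by
  refine D0.comp3 (P := fun _ => MemApp) ?_ ht hs hw
  unfold MemApp
  apply_rules [D0.expair, D0.bex, D0.mem, D0.and, D0.eq, IsVar.mk]

/-- The value of the function `f` at `x`. -/
noncomputable def app (f x : ZFSet.{u}) : ZFSet.{u} :=
  ZFSet.sep (MemApp f x) f.sUnion.sUnion.sUnion

theorem mem_app_iff : z ∈ app f x ↔ MemApp f x z := by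
  rw [app, ZFSet.mem_sep, and_iff_right_iff_imp]
  rintro ⟨p, hp, b, y, rfl, -, hz⟩
  exact ZFSet.mem_sUnion.2 ⟨y, right_mem_sUnion_sUnion hp, hz⟩

theorem mem_app : z ∈ app f x ↔ ∃ y, pair x y ∈ f ∧ z ∈ y := by
  rw [mem_app_iff]
  constructor
  · rintro ⟨p, hp, b, y, rfl, rfl, hz⟩
    exact ⟨y, hp, hz⟩
  · rintro ⟨y, hy, hz⟩
    exact ⟨_, hy, _, _, rfl, rfl, hz⟩

theorem app_eq (h : ∀ y, pair x y ∈ f ↔ y = z) : app f x = z := by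
  ext w
  simp [mem_app, h]

/-- `v` is the value of the function `f` at `x`. -/
def IsApp (f x v : ZFSet.{u}) : Prop :=
  (∀ z ∈ v, MemApp f x z) ∧ ∀ p ∈ f, ∀ b y, p = pair b y → b = x → ∀ z ∈ y, z ∈ v

theorem D0.isApp {t s w : (Fin n → ZFSet.{u}) → ZFSet.{u}} (ht : IsVar t) (hs : IsVar s)
    (hw : IsVar w) : D0 (fun _ e => IsApp (t e) (s e) (w e)) := by
  refine D0.comp3 (P := fun _ => IsApp) ?_ ht hs hw
  unfold IsApp
  apply_rules [D0.memApp, D0.allpair, D0.ball, D0.mem, D0.and, D0.imp, D0.eq, IsVar.mk]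

theorem isApp_iff : IsApp f x y ↔ y = app f x := by
  constructor
  · intro h
    ext z
    rw [mem_app]
    exact ⟨fun hz => mem_app.1 (mem_app_iff.2 (h.1 z hz)), fun ⟨w, hw, hz⟩ => h.2 _ hw _ _ rfl rfl z hz⟩
  · rintro rfl
    exact ⟨fun z hz => mem_app_iff.1 hz, fun p hp b y hpy hb z hz => mem_app.2 ⟨y, hb ▸ hpy ▸ hp, hz⟩⟩

/-- No assumption on x is needed, since outside the domain the value is the empty set. -/
theorem app_mem_lev (hξ : Order.IsSuccLimit ξ) (hf : f ∈ lev B ξ) (x : ZFSet.{u}) :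
    app f x ∈ lev B ξ := by
  obtain ⟨η, hη, hf'⟩ := (mem_lev_of_isSuccLimit hξ).1 hf
  have ht := isTransitive_lev B η
  have hsub : ∀ z ∈ app f x, x ∈ lev B η ∧ z ∈ lev B η := by
    intro z hz
    obtain ⟨y, hy, hz⟩ := mem_app.1 hz
    have := of_pair_mem ht (ht _ hf' hy)
    exact ⟨this.1, ht _ this.2 hz⟩
  by_cases hx : x ∈ lev B ξ
  · have := lev_sepD0 (A := B) hξ (n := 2) (Q := fun _ e z => MemApp (e 0) (e 1) z)
      (by apply_rules [D0.memApp, IsVar.mk]) ![f, x] (by simp [Fin.forall_fin_succ, hf, hx])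
      (lev_mem_lev hη)
    convert this using 1
    ext z
    simp only [ZFSet.mem_sep, Matrix.cons_val, ← mem_app_iff]
    exact ⟨fun h => ⟨(hsub z h).2, h⟩, fun h => h.2⟩
  · have : app f x = ∅ := by
      rw [ZFSet.eq_empty]
      intro z hz
      exact hx (lev_mono hη.le (hsub z hz).1)
    rw [this]
    exact (gClosed_lev hξ).1

theorem D0.exVec {k m : ℕ} (i : Fin k)
    {Φ : ZFSet.{u} → (Fin k → ZFSet.{u}) → (Fin m → ZFSet.{u}) → Prop}
    (h : D0 (n := k + m) fun A e => Φ A (fun l => e (Fin.castAdd m l)) (fun l => e (Fin.natAdd k l))) :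
    D0 (fun A e => ∃ v : Fin m → ZFSet.{u}, (∀ l, v l ∈ e i) ∧ Φ A e v) := by
  induction m with
  | zero =>
    refine D0.congr h fun A e => ?_
    constructor
    · rintro ⟨v, -, hv⟩
      have : v = fun l : Fin 0 => e (Fin.natAdd k l) := funext fun l => l.elim0
      exact this ▸ hv
    · exact fun h => ⟨_, fun l => l.elim0, h⟩
  | succ m ih =>
    have := ih (Φ := fun A e v => ∃ z ∈ e i, Φ A e (Fin.snoc (α := fun _ => ZFSet.{u}) v z)) (by
      refine D0.bex (IsVar.mk (Fin.castAdd m i)) (Q := fun A e z => Φ A (fun l => e (Fin.castAdd m l))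
        (Fin.snoc (α := fun _ => ZFSet.{u}) (fun l => e (Fin.natAdd k l)) z)) ?_
      refine D0.congr h fun A e => iff_of_eq ?_
      congr 1
      funext l
      refine Fin.lastCases ?_ (fun l => ?_) l <;> simp
      rfl)
    refine this.congr fun A e => ?_
    constructor
    · rintro ⟨v, hv, hΦ⟩
      exact ⟨Fst v, fun l => hv _, Lst v, hv _, by rwa [snoc_fst_lst]⟩
    · rintro ⟨v, hv, z, hz, hΦ⟩
      exact ⟨_, fun l => Fin.lastCases (by simpa) (fun l => by simpa using hv l) l, hΦ⟩

theorem D0.sat (φ : Fm n) : D0 (fun A e => Sat A φ e) := ⟨φ, fun _ _ => Iff.rfl⟩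

theorem D0.allFin' {k : ℕ} (j : Fin n) {Q : Fin k → ZFSet.{u} → (Fin n → ZFSet.{u}) → Prop}
    (h : ∀ i, D0 (Q i)) : D0 (fun A e => ∀ i, Q i A e) := by
  cases n with
  | zero => exact j.elim0
  | succ n => exact D0.allFin h

theorem exists_limit_lev (hd : d.IsRegular) (hd' : ℵ₀ < d) (v : Fin n → ZFSet.{u})
    (hv : ∀ i, v i ∈ lev B d.ord) :
    ∃ η < d.ord, Order.IsSuccLimit η ∧ ∀ i, v i ∈ lev B η := by
  obtain ⟨η, hη, h⟩ := exists_common_lev (isSuccLimit_ord hd'.le) v hv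
  exact ⟨η + Ordinal.omega0, Ordinal.isPrincipal_add_ord hd.aleph0_le hη (omega0_lt_ord.2 hd'),
    Ordinal.isSuccLimit_add _ Ordinal.isSuccLimit_omega0,
    fun i => lev_mono (le_self_add) (h i)⟩

theorem snoc_mem {v : Fin n → ZFSet.{u}} {m : ZFSet.{u}} (hv : ∀ i, v i ∈ m) (hx : x ∈ m) (i) :
    Fin.snoc (α := fun _ => ZFSet.{u}) v x i ∈ m :=
  Fin.lastCases (by simpa) (fun i => by simpa using hv i) i

/-- The values of the functions all lie in one limit level, which as a parameter bounds the
quantifiers over these values. -/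
theorem sep_sat_app_mem (hd : d.IsRegular) (hd' : ℵ₀ < d) (φ : Fm n) {f : Fin n → ZFSet.{u}}
    (hf : ∀ i, f i ∈ lev B d.ord) (hu : u ∈ lev B d.ord) :
    ZFSet.sep (fun x => Sat B φ fun i => app (f i) x) u ∈ lev B d.ord := by
  obtain ⟨η, hη, hl, hf'⟩ := exists_limit_lev hd hd' f hf
  have := lev_sepD0 (A := B) (isSuccLimit_ord hd'.le) (n := n + 1)
    (Q := fun A e x => ∃ v : Fin n → ZFSet.{u},
      (∀ l, v l ∈ Lst e) ∧ (∀ l, IsApp (Fst e l) x (v l)) ∧ Sat A φ v) (by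
      refine D0.exVec (Fin.last n).castSucc (Φ := fun A e v =>
        (∀ l, IsApp (Fst (Fst e) l) (Lst e) (v l)) ∧ Sat A φ v) (D0.and ?_ ?_)
      · exact D0.allFin' ⟨0, by omega⟩ fun l => D0.isApp (IsVar.mk _) (IsVar.mk _) (IsVar.mk _)
      · exact (D0.sat φ).rename _)
    (Fin.snoc (α := fun _ => ZFSet.{u}) f (lev B η)) (snoc_mem hf (lev_mem_lev hη)) hu
  convert this using 1
  ext x
  rw [fst_snoc]
  simp only [ZFSet.mem_sep, isApp_iff, Lst, Fin.snoc_last]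
  refine and_congr_right fun _ => ?_
  constructor
  · intro h
    exact ⟨_, fun l => app_mem_lev hl (hf' l) x, fun _ => rfl, h⟩
  · rintro ⟨v, -, hv, h⟩
    rwa [funext hv] at h

/-- Skolem functions. -/
theorem exists_skolem (hd : d.IsRegular) (hd' : ℵ₀ < d) (φ : Fm (n + 1)) (i : Fin n)
    {f : Fin n → ZFSet.{u}} (hf : ∀ i, f i ∈ lev B d.ord) (hu : u ∈ lev B d.ord) :
    ∃ h ∈ lev B d.ord, ∀ x ∈ u,
      (∃ z ∈ app (f i) x, Sat B φ (Fin.snoc (α := fun _ => ZFSet.{u}) (fun i => app (f i) x) z)) →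
      app h x ∈ app (f i) x ∧
        Sat B φ (Fin.snoc (α := fun _ => ZFSet.{u}) (fun i => app (f i) x) (app h x)) := by
  obtain ⟨η, hη, hl, hf'⟩ := exists_limit_lev hd hd' f hf
  have hlim := isSuccLimit_ord hd'.le
  have hr : levLe B η ∈ lev B d.ord :=
    (of_pair_mem (isTransitive_lev B _) ((hier_lev B hd hd').seq_lp_mem hη).2).2
  have hP : ZFSet.prod u (lev B η) ∈ lev B d.ord :=
    G_two (A := B) ▸ (gClosed_lev hlim).2 2 u hu _ (lev_mem_lev hη)
  -- The Skolem function takes the least witness in the order of a level containing all candidates.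
  set T : (Fin n → ZFSet.{u}) → ZFSet.{u} → Prop := fun v y =>
    y ∈ v i ∧ Sat B φ (Fin.snoc (α := fun _ => ZFSet.{u}) v y) ∧ ∀ z ∈ v i,
      Sat B φ (Fin.snoc (α := fun _ => ZFSet.{u}) v z) → pair y z ∈ levLe B η with hT
  have hs : ∀ {k} (a : Fin n → Fin k) (b : Fin k), D0 (n := k) fun A e =>
      Sat A φ (Fin.snoc (α := fun _ => ZFSet.{u}) (fun i => e (a i)) (e b)) := fun a b =>
    ((D0.sat φ).rename (Fin.snoc (α := fun _ => Fin _) a b)).congr fun A e => by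
      refine iff_of_eq (congrArg _ (funext fun l => ?_))
      refine Fin.lastCases ?_ (fun l => ?_) l <;> simp
  have := lev_sepD0 (A := B) hlim (n := n + 2)
    (Q := fun A e p => ∃ x y, p = pair x y ∧ ∃ v : Fin n → ZFSet.{u},
      (∀ l, v l ∈ Lst (Fst e)) ∧ (∀ l, IsApp (Fst (Fst e) l) x (v l)) ∧
      y ∈ v i ∧ Sat A φ (Fin.snoc (α := fun _ => ZFSet.{u}) v y) ∧ ∀ z ∈ v i,
      Sat A φ (Fin.snoc (α := fun _ => ZFSet.{u}) v z) → pair y z ∈ Lst e) (by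
      refine D0.expair (IsVar.mk _) ?_
      refine D0.exVec (Fin.last n).castSucc.castSucc.castSucc.castSucc (Φ := fun A e v =>
        (∀ l, IsApp (e l.castSucc.castSucc.castSucc.castSucc.castSucc) (Lst (Fst e)) (v l)) ∧
        Lst e ∈ v i ∧ Sat A φ (Fin.snoc (α := fun _ => ZFSet.{u}) v (Lst e)) ∧ ∀ z ∈ v i,
        Sat A φ (Fin.snoc (α := fun _ => ZFSet.{u}) v z) →
          pair (Lst e) z ∈ e (Fin.last (n + 1)).castSucc.castSucc.castSucc) (D0.and ?_ ?_)
      · exact D0.allFin' ⟨0, by omega⟩ fun l => D0.isApp (IsVar.mk _) (IsVar.mk _) (IsVar.mk _)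
      · refine D0.and (D0.mem (IsVar.mk _) (IsVar.mk _)) (D0.and (hs _ _)
          (D0.ball (IsVar.mk _) (D0.imp (hs _ _)
          (D0.opair_mem (IsVar.mk _) (IsVar.mk _) (IsVar.mk _))))))
    (Fin.snoc (α := fun _ => ZFSet.{u}) (Fin.snoc (α := fun _ => ZFSet.{u}) f (lev B η)) (levLe B η))
    (snoc_mem (snoc_mem hf (lev_mem_lev hη)) hr) hP
  obtain ⟨h, hh, hmem⟩ : ∃ h ∈ lev B d.ord, ∀ x ∈ u, ∀ y, pair x y ∈ h ↔
      y ∈ lev B η ∧ T (fun i => app (f i) x) y := by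
    refine ⟨_, this, fun x hx y => ?_⟩
    simp only [ZFSet.mem_sep, Fst, isApp_iff, Lst, Fin.snoc_castSucc, Fin.snoc_last,
      ZFSet.pair_mem_prod, hx, true_and]
    refine and_congr_right fun _ => ?_
    constructor
    · rintro ⟨x', y', he, v, -, hv, h⟩
      obtain ⟨rfl, rfl⟩ := ZFSet.pair_inj.1 he
      rw [← funext hv]
      exact h
    · exact fun h => ⟨x, y, rfl, _, fun l => app_mem_lev hl (hf' l) x, fun _ => rfl, h⟩
  clear this
  refine ⟨h, hh, fun x hx hz => ?_⟩
  have hsub : ∀ z ∈ app (f i) x, z ∈ lev B η := fun z hz =>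
    isTransitive_lev B η _ (app_mem_lev hl (hf' i) x) hz
  obtain ⟨m, hm, hmin⟩ := (wo_lev B η).lwo.least {z | z ∈ app (f i) x ∧
    Sat B φ (Fin.snoc (α := fun _ => ZFSet.{u}) (fun i => app (f i) x) z)} hz
    fun z hz => hsub z hz.1
  have happ : app h x = m := app_eq fun y => by
    rw [hmem x hx]
    constructor
    · rintro ⟨hy, hy1, hy2, hy3⟩
      exact (wo_lev B η).lwo.anti y hy m (hsub m hm.1) (hy3 m hm.1 hm.2) (hmin y ⟨hy1, hy2⟩)
    · rintro rfl
      exact ⟨hsub y hm.1, hm.1, hm.2, fun z hz hz' => hmin z ⟨hz, hz'⟩⟩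
  rw [happ]
  exact hm

open ZFSet (pair)
open Filter

/-! ### Embeddings and ultrafilters -/

variable {A B a b s x y z f u : ZFSet.{u}} {ξ η : Ordinal.{u}} {c d : Cardinal.{u}} {n : ℕ}
  {j : ZFSet.{u} → ZFSet.{u}}

/-- `j` is a cofinal embedding of `lev B c.ord` into `lev A c.ord` that preserves bounded formulas,
and `d` is a larger regular cardinal. -/
structure Emb (A B : ZFSet.{u}) (c d : Cardinal.{u}) (j : ZFSet.{u} → ZFSet.{u}) : Prop where
  reg : c.IsRegular
  unc : ℵ₀ < c
  regd : d.IsRegular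
  lt : c < d
  subA : A ⊆ lev A c.ord
  subB : B ⊆ lev B c.ord
  mem : ∀ {x}, x ∈ lev B c.ord → j x ∈ lev A c.ord
  sat : ∀ {n} (φ : Fm n) (v : Fin n → ZFSet.{u}), (∀ i, v i ∈ lev B c.ord) →
    (Sat B φ v ↔ Sat A φ fun i => j (v i))
  cof : ∀ {a}, a ∈ lev A c.ord → ∃ u ∈ lev B c.ord, a ∈ j u

theorem of_prod_mem {x y p : ZFSet.{u}} (h : p ∈ ZFSet.prod x y) :
    ∃ b ∈ x, ∃ c ∈ y, p = pair b c := ZFSet.mem_prod.1 h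

namespace Emb

theorem uncd (h : Emb A B c d j) : ℵ₀ < d := h.unc.trans h.lt

theorem d0 (h : Emb A B c d j) {Q : ZFSet.{u} → (Fin n → ZFSet.{u}) → Prop} (hQ : D0 Q)
    {v : Fin n → ZFSet.{u}} (hv : ∀ i, v i ∈ lev B c.ord) : Q B v ↔ Q A fun i => j (v i) := by
  obtain ⟨φ, hφ⟩ := hQ
  rw [hφ, hφ, h.sat φ v hv]

theorem gB (h : Emb A B c d j) : GClosed B (lev B c.ord) := gClosed_lev (isSuccLimit_ord h.unc.le)

theorem gA (h : Emb A B c d j) : GClosed A (lev A c.ord) := gClosed_lev (isSuccLimit_ord h.unc.le)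

theorem lt_ord (h : Emb A B c d j) : c.ord < d.ord := ord_lt_ord.2 h.lt

theorem mem_d (h : Emb A B c d j) (hx : x ∈ lev B c.ord) : x ∈ lev B d.ord :=
  lev_mono h.lt_ord.le hx

theorem map_mem (h : Emb A B c d j) (hx : x ∈ lev B c.ord) (hy : y ∈ lev B c.ord) :
    j x ∈ j y ↔ x ∈ y :=
  (h.d0 (n := 2) (Q := fun _ e => e 0 ∈ e 1) (D0.mem (IsVar.mk _) (IsVar.mk _)) (v := ![x, y])
    (by simp [Fin.forall_fin_succ, hx, hy])).symm

theorem map_sub (h : Emb A B c d j) (hx : x ∈ lev B c.ord) (hy : y ∈ lev B c.ord) :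
    j x ⊆ j y ↔ x ⊆ y :=
  (h.d0 (n := 2) (Q := fun _ e => e 0 ⊆ e 1) (D0.sub (IsVar.mk _) (IsVar.mk _)) (v := ![x, y])
    (by simp [Fin.forall_fin_succ, hx, hy])).symm

theorem map_empty (h : Emb A B c d j) : j ∅ = ∅ :=
  (h.d0 (n := 1) (Q := fun _ e => e 0 = ∅) (D0.isEmpty (IsVar.mk _)) (v := ![∅])
    (by simp [h.gB.1])).1 rfl

theorem sep_mem (h : Emb A B c d j) {Q : ZFSet.{u} → (Fin n → ZFSet.{u}) → ZFSet.{u} → Prop}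
    (hQ : D0 (n := n + 1) fun A e => Q A (Fst e) (Lst e)) {v : Fin n → ZFSet.{u}}
    (hv : ∀ i, v i ∈ lev B c.ord) (hu : u ∈ lev B c.ord) :
    ZFSet.sep (Q B v) u ∈ lev B c.ord :=
  lev_sepD0 (isSuccLimit_ord h.unc.le) hQ v hv hu

/-- That a set is separated from u by a bounded formula is itself bounded, so j carries it to the
set separated from j u by the same formula, now read with the predicate `A`. -/
theorem mem_map_sep (h : Emb A B c d j)
    {Q : ZFSet.{u} → (Fin n → ZFSet.{u}) → ZFSet.{u} → Prop}
    (hQ : D0 (n := n + 1) fun A e => Q A (Fst e) (Lst e)) {v : Fin n → ZFSet.{u}}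
    (hv : ∀ i, v i ∈ lev B c.ord) (hu : u ∈ lev B c.ord) (a : ZFSet.{u}) :
    a ∈ j (ZFSet.sep (Q B v) u) ↔ a ∈ j u ∧ Q A (fun i => j (v i)) a := by
  have := (h.d0 (n := n + 1 + 1) (Q := fun A e => (∀ t ∈ Lst e, t ∈ Lst (Fst e) ∧
    Q A (Fst (Fst e)) t) ∧ ∀ t ∈ Lst (Fst e), Q A (Fst (Fst e)) t → t ∈ Lst e) (by
      have hq : D0 (n := n + 1 + 1 + 1) fun A e => Q A (Fst (Fst (Fst e))) (Lst e) :=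
        (hQ.rename (Fin.snoc (α := fun _ => Fin (n + 3))
          (fun i : Fin n => i.castSucc.castSucc.castSucc) (Fin.last _))).congr
          fun A e => by rw [fst_comp_snoc]; simp [Lst]
      exact D0.and (D0.ball (IsVar.mk _) (D0.and (D0.mem (IsVar.mk _) (IsVar.mk _)) hq))
        (D0.ball (IsVar.mk _) (D0.imp hq (D0.mem (IsVar.mk _) (IsVar.mk _)))))
    (v := Fin.snoc (α := fun _ => ZFSet.{u}) (Fin.snoc (α := fun _ => ZFSet.{u}) v u)
      (ZFSet.sep (Q B v) u)) (snoc_mem (snoc_mem hv hu) (h.sep_mem hQ hv hu))).1 (by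
        rw [fst_snoc, fst_snoc]
        simp only [Lst, Fin.snoc_last, ZFSet.mem_sep]
        exact ⟨fun t ht => ht, fun t h1 h2 => ⟨h1, h2⟩⟩)
  have hv' : Fst (Fst fun i => j (Fin.snoc (α := fun _ => ZFSet.{u})
      (Fin.snoc (α := fun _ => ZFSet.{u}) v u) (ZFSet.sep (Q B v) u) i)) = fun i => j (v i) := by
    funext i; simp [Fst]
  rw [hv'] at this
  simp only [Lst, Fst, Fin.snoc_last, Fin.snoc_castSucc] at this
  exact ⟨this.1 a, fun ha => this.2 a ha.1 ha.2⟩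

theorem prod_mem (h : Emb A B c d j) (hx : x ∈ lev B c.ord) (hy : y ∈ lev B c.ord) :
    ZFSet.prod x y ∈ lev B c.ord := G_two (A := B) ▸ h.gB.2 2 x hx y hy

theorem pair_mem_map_prod (h : Emb A B c d j) (hx : x ∈ lev B c.ord) (hy : y ∈ lev B c.ord) :
    pair a b ∈ j (ZFSet.prod x y) ↔ a ∈ j x ∧ b ∈ j y := by
  have := (h.d0 (n := 3) (Q := fun _ e => (∀ p ∈ e 2, ∃ b c, p = pair b c ∧ b ∈ e 0 ∧ c ∈ e 1) ∧
    ∀ b ∈ e 0, ∀ c ∈ e 1, pair b c ∈ e 2) (by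
      apply_rules [D0.opair_mem, D0.ball, D0.expair, D0.mem, D0.and, IsVar.mk])
    (v := ![x, y, ZFSet.prod x y]) (by simp [Fin.forall_fin_succ, hx, hy, h.prod_mem])).1 (by
      simp only [Matrix.cons_val]
      refine ⟨fun p hp => ?_, fun b hb c hc => ZFSet.pair_mem_prod.2 ⟨hb, hc⟩⟩
      obtain ⟨b, hb, c, hc, rfl⟩ := of_prod_mem hp
      exact ⟨b, c, rfl, hb, hc⟩)
  simp only [Matrix.cons_val] at this
  refine ⟨fun hp => ?_, fun hab => this.2 a hab.1 b hab.2⟩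
  obtain ⟨b', c', he, hb, hc⟩ := this.1 _ hp
  obtain ⟨rfl, rfl⟩ := ZFSet.pair_inj.1 he
  exact ⟨hb, hc⟩

theorem cof2 (h : Emb A B c d j) (ha : a ∈ lev A c.ord) (hb : b ∈ lev A c.ord) :
    ∃ u ∈ lev B c.ord, a ∈ j u ∧ b ∈ j u := by
  obtain ⟨u, hu, hau⟩ := h.cof ha
  obtain ⟨v, hv, hbv⟩ := h.cof hb
  have hl := isSuccLimit_ord h.unc.le
  obtain ⟨η, hη, huv⟩ := exists_common_lev (A := B) hl ![u, v] (by simp [Fin.forall_fin_succ, hu, hv])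
  have hη' := lev_mem_lev (A := B) hη
  have hsub : ∀ w, w ∈ lev B c.ord → w ∈ lev B η → j w ⊆ j (lev B η) := fun w hw hw' =>
    (h.map_sub hw hη').2 (isTransitive_lev B η _ hw')
  exact ⟨_, hη', hsub u hu (huv 0) hau, hsub v hv (huv 1) hbv⟩

/-- The ultrafilter generated by a seed. -/
def filter (h : Emb A B c d j) (ha : a ∈ lev A c.ord) : Filter ZFSet.{u} where
  sets := {T | ∃ Z ∈ lev B c.ord, a ∈ j Z ∧ ∀ x ∈ Z, x ∈ T}
  univ_sets := by
    obtain ⟨u, hu, hau⟩ := h.cof ha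
    exact ⟨u, hu, hau, fun _ _ => trivial⟩
  sets_of_superset := fun ⟨Z, h1, h2, h3⟩ hT => ⟨Z, h1, h2, fun x hx => hT (h3 x hx)⟩
  inter_sets := by
    rintro T T' ⟨Z, h1, h2, h3⟩ ⟨Z', h1', h2', h3'⟩
    have hQ : D0 (n := 1 + 1) fun _ e => (Lst e : ZFSet.{u}) ∈ (Fst e) 0 :=
      D0.mem (IsVar.mk _) (IsVar.mk _)
    have hv : ∀ i, ![Z'] i ∈ lev B c.ord := by simpa
    refine ⟨_, h.sep_mem (Q := fun _ e t => t ∈ e 0) hQ hv h1,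
      (h.mem_map_sep (Q := fun _ e t => t ∈ e 0) hQ hv h1 a).2 ⟨h2, h2'⟩, fun x hx => ?_⟩
    rw [ZFSet.mem_sep] at hx
    exact ⟨h3 x hx.1, h3' x hx.2⟩

variable (h : Emb A B c d j) {ha : a ∈ lev A c.ord} {hb : b ∈ lev A c.ord}
  {hs : s ∈ lev A c.ord}

include h

theorem eventually_mem (hu : u ∈ lev B c.ord) (hau : a ∈ j u) : ∀ᶠ x in h.filter ha, x ∈ u :=
  ⟨u, hu, hau, fun _ hx => hx⟩

theorem neBot : (h.filter ha).NeBot := by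
  rw [neBot_iff]
  intro hbot
  have : ∀ᶠ x in h.filter ha, False := by rw [hbot]; trivial
  obtain ⟨Z, hZ, haZ, hF⟩ := this
  have : Z = ∅ := (ZFSet.eq_empty _).2 hF
  rw [this, h.map_empty] at haZ
  exact ZFSet.notMem_empty _ haZ

/-- The set is at first only constructed before `d.ord`; as a subset of an element of `lev B c.ord`
it belongs there, and j can be applied to it. -/
theorem sep_app_mem (φ : Fm n) {f : Fin n → ZFSet.{u}} (hf : ∀ i, f i ∈ lev B d.ord)
    (hu : u ∈ lev B c.ord) :
    ZFSet.sep (fun x => Sat B φ fun i => app (f i) x) u ∈ lev B c.ord := by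
  have h1 := sep_sat_app_mem h.regd h.uncd φ hf (h.mem_d hu)
  obtain ⟨η, hη, hu'⟩ := (mem_lev_of_isSuccLimit (isSuccLimit_ord h.unc.le)).1 hu
  refine mem_lev_of_subset_lev h.reg h.unc h.regd h.lt.le h.subB h1 hη fun x hx => ?_
  exact isTransitive_lev B η _ hu' (ZFSet.mem_sep.1 hx).1

/-- The filter need not be an ultrafilter on all sets, but it decides every bounded condition on
values of functions from `lev B d.ord`, and no more is needed for Łoś's theorem. -/
theorem em (φ : Fm n) {f : Fin n → ZFSet.{u}} (hf : ∀ i, f i ∈ lev B d.ord) :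
    (∀ᶠ x in h.filter ha, Sat B φ fun i => app (f i) x) ∨
      ∀ᶠ x in h.filter ha, ¬ Sat B φ fun i => app (f i) x := by
  obtain ⟨u, hu, hau⟩ := h.cof ha
  have hZ := h.sep_app_mem φ hf hu
  set Z := ZFSet.sep (fun x => Sat B φ fun i => app (f i) x) u with hZ'
  by_cases haZ : a ∈ j Z
  · exact .inl ⟨Z, hZ, haZ, fun x hx => (ZFSet.mem_sep.1 hx).2⟩
  · have hQ : D0 (n := 1 + 1) fun _ e => ¬ (Lst e : ZFSet.{u}) ∈ (Fst e) 0 :=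
      D0.neg (D0.mem (IsVar.mk _) (IsVar.mk _))
    have hv : ∀ i, ![Z] i ∈ lev B c.ord := by simpa
    refine .inr ⟨_, h.sep_mem (Q := fun _ e t => ¬ t ∈ e 0) hQ hv hu,
      (h.mem_map_sep (Q := fun _ e t => ¬ t ∈ e 0) hQ hv hu a).2 ⟨hau, haZ⟩, fun x hx hx' => ?_⟩
    obtain ⟨hxu, hxZ⟩ := ZFSet.mem_sep.1 hx
    exact hxZ (show x ∈ Z from ZFSet.mem_sep.2 ⟨hxu, hx'⟩)

theorem eventually_not_iff (φ : Fm n) {f : Fin n → ZFSet.{u}} (hf : ∀ i, f i ∈ lev B d.ord) :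
    (∀ᶠ x in h.filter ha, ¬ Sat B φ fun i => app (f i) x) ↔
      ¬ ∀ᶠ x in h.filter ha, Sat B φ fun i => app (f i) x := by
  constructor
  · intro h1 h2
    have := h.neBot (ha := ha)
    exact (h1.and h2).exists.elim fun x hx => hx.1 hx.2
  · intro h1
    exact (h.em φ hf).resolve_left h1

end Emb

/-! ### Maps between seeds -/

/-- The first component of a pair. -/
noncomputable def fst (p : ZFSet.{u}) : ZFSet.{u} := Classical.epsilon fun x => ∃ y, p = pair x y

/-- The second component of a pair. -/
noncomputable def snd (p : ZFSet.{u}) : ZFSet.{u} := Classical.epsilon fun y => ∃ x, p = pair x y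

@[simp] theorem fst_pair (x y : ZFSet.{u}) : fst (pair x y) = x := by
  obtain ⟨z, hz⟩ := Classical.epsilon_spec (p := fun x' => ∃ y', pair x y = pair x' y') ⟨x, y, rfl⟩
  exact (ZFSet.pair_inj.1 hz).1.symm

@[simp] theorem snd_pair (x y : ZFSet.{u}) : snd (pair x y) = y := by
  obtain ⟨z, hz⟩ := Classical.epsilon_spec (p := fun y' => ∃ x', pair x y = pair x' y') ⟨y, x, rfl⟩
  exact (ZFSet.pair_inj.1 hz).2.symm

/-- The function `e` sends the seed `s` to the seed `a`. -/
def SeedMap (B : ZFSet.{u}) (c : Cardinal.{u}) (j e : ZFSet.{u} → ZFSet.{u}) (s a : ZFSet.{u}) :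
    Prop :=
  ∃ E ∈ lev B c.ord, pair s a ∈ j E ∧ ∀ t x, pair t x ∈ E → x = e t

namespace Emb

variable (h : Emb A B c d j) {e e' : ZFSet.{u} → ZFSet.{u}}
include h

theorem seedMap_of_sep (hs : s ∈ lev A c.ord) (ha : a ∈ lev A c.ord)
    {Q : ZFSet.{u} → (Fin n → ZFSet.{u}) → ZFSet.{u} → Prop}
    (hQ : D0 (n := n + 1) fun A e => Q A (Fst e) (Lst e)) {v : Fin n → ZFSet.{u}}
    (hv : ∀ i, v i ∈ lev B c.ord) (hsa : Q A (fun i => j (v i)) (pair s a))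
    (he : ∀ t x, Q B v (pair t x) → x = e t) : SeedMap B c j e s a := by
  obtain ⟨u, hu, hsu, hau⟩ := h.cof2 hs ha
  have hp := h.prod_mem hu hu
  exact ⟨_, h.sep_mem hQ hv hp, (h.mem_map_sep hQ hv hp _).2 ⟨(h.pair_mem_map_prod hu hu).2
    ⟨hsu, hau⟩, hsa⟩, fun t x htx => he t x (ZFSet.mem_sep.1 htx).2⟩

theorem seedMap_id (hs : s ∈ lev A c.ord) : SeedMap B c j id s s := by
  refine h.seedMap_of_sep (n := 1) hs hs (v := ![∅]) (Q := fun _ _ p => ∃ x y, p = pair x y ∧ x = y)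
    (by apply_rules [D0.expair, D0.eq, IsVar.mk]) (by simp [h.gB.1]) ⟨s, s, rfl, rfl⟩ ?_
  rintro t x ⟨t', x', he, rfl⟩
  obtain ⟨rfl, rfl⟩ := ZFSet.pair_inj.1 he
  rfl

theorem seedMap_pair (hs : s ∈ lev A c.ord) (ha : a ∈ lev A c.ord) (hb : b ∈ lev A c.ord)
    (he : SeedMap B c j e s a) (he' : SeedMap B c j e' s b) :
    SeedMap B c j (fun t => pair (e t) (e' t)) s (pair a b) := by
  obtain ⟨E, hE, h1, h2⟩ := he
  obtain ⟨E', hE', h1', h2'⟩ := he'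
  refine h.seedMap_of_sep (n := 2) hs (h.gA.opair ha hb) (v := ![E, E'])
    (Q := fun _ e p => ∃ t y, p = pair t y ∧ ∃ x z, y = pair x z ∧ pair t x ∈ e 0 ∧ pair t z ∈ e 1)
    (by apply_rules [D0.expair, D0.opair_mem, D0.and, IsVar.mk])
    (by simp [Fin.forall_fin_succ, hE, hE']) ⟨_, _, rfl, _, _, rfl, h1, h1'⟩ ?_
  rintro t x ⟨t', x', hp, y, z, rfl, hy, hz⟩
  obtain ⟨rfl, rfl⟩ := ZFSet.pair_inj.1 hp
  rw [h2 _ _ hy, h2' _ _ hz]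

theorem seedMap_fst (hs : s ∈ lev A c.ord) (ha : a ∈ lev A c.ord)
    (he : SeedMap B c j e s (pair a b)) : SeedMap B c j (fun t => fst (e t)) s a := by
  obtain ⟨E, hE, h1, h2⟩ := he
  refine h.seedMap_of_sep (n := 1) hs ha (v := ![E])
    (Q := fun _ e p => ∃ t x, p = pair t x ∧ ∃ q ∈ e 0, ∃ t' w, q = pair t' w ∧ t' = t ∧
      ∃ x' z, w = pair x' z ∧ x' = x)
    (by apply_rules [D0.expair, D0.bex, D0.eq, D0.and, IsVar.mk])
    (by simp [hE]) ⟨_, _, rfl, _, h1, _, _, rfl, rfl, _, _, rfl, rfl⟩ ?_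
  rintro t x ⟨t', x', hp, q, hq, t'', w, rfl, rfl, x'', z, rfl, rfl⟩
  obtain ⟨rfl, rfl⟩ := ZFSet.pair_inj.1 hp
  rw [← h2 _ _ hq, fst_pair]

theorem seedMap_snd (hs : s ∈ lev A c.ord) (hb : b ∈ lev A c.ord)
    (he : SeedMap B c j e s (pair a b)) : SeedMap B c j (fun t => snd (e t)) s b := by
  obtain ⟨E, hE, h1, h2⟩ := he
  refine h.seedMap_of_sep (n := 1) hs hb (v := ![E])
    (Q := fun _ e p => ∃ t x, p = pair t x ∧ ∃ q ∈ e 0, ∃ t' w, q = pair t' w ∧ t' = t ∧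
      ∃ z x', w = pair z x' ∧ x' = x)
    (by apply_rules [D0.expair, D0.bex, D0.eq, D0.and, IsVar.mk])
    (by simp [hE]) ⟨_, _, rfl, _, h1, _, _, rfl, rfl, _, _, rfl, rfl⟩ ?_
  rintro t x ⟨t', x', hp, q, hq, t'', w, rfl, rfl, z, x'', rfl, rfl⟩
  obtain ⟨rfl, rfl⟩ := ZFSet.pair_inj.1 hp
  rw [← h2 _ _ hq, snd_pair]

/-- The preimage of Z under the graph `E` is separated by a bounded formula, and since the pair of s
and a lies in j E, its image under j contains s as soon as a ∈ j Z. -/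
theorem tendsto (hs : s ∈ lev A c.ord) (ha : a ∈ lev A c.ord) (he : SeedMap B c j e s a) :
    Tendsto e (h.filter hs) (h.filter ha) := by
  rintro T ⟨Z, hZ, haZ, hT⟩
  obtain ⟨E, hE, h1, h2⟩ := he
  obtain ⟨u, hu, hsu⟩ := h.cof hs
  have hQ : D0 (n := 2 + 1) fun _ e => ∃ q ∈ (Fst e) 0, ∃ t x : ZFSet.{u}, q = pair t x ∧
      t = Lst e ∧ x ∈ (Fst e) 1 := by
    apply_rules [D0.expair, D0.bex, D0.eq, D0.and, D0.mem, IsVar.mk]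
  have hv : ∀ i, ![E, Z] i ∈ lev B c.ord := by simp [Fin.forall_fin_succ, hE, hZ]
  refine ⟨_, h.sep_mem (Q := fun _ e t' => ∃ q ∈ e 0, ∃ t x : ZFSet.{u}, q = pair t x ∧
      t = t' ∧ x ∈ e 1) hQ hv hu,
    (h.mem_map_sep (Q := fun _ e t' => ∃ q ∈ e 0, ∃ t x : ZFSet.{u}, q = pair t x ∧
      t = t' ∧ x ∈ e 1) hQ hv hu s).2 ⟨hsu, _, h1, _, _, rfl, rfl, haZ⟩, fun t ht => ?_⟩
  obtain ⟨-, q, hq, t', x, rfl, rfl, hx⟩ := ZFSet.mem_sep.1 ht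
  have := hT x hx
  rwa [h2 _ _ hq] at this

/-- Composition with the graph `E` moves a function to a finer seed without leaving `lev B d.ord`,
so that finitely many points can be given one seed. -/
theorem exists_comp (hs : s ∈ lev A c.ord) (he : SeedMap B c j e s a)
    (hf : f ∈ lev B d.ord) :
    ∃ g ∈ lev B d.ord, ∀ᶠ t in h.filter hs, app g t = app f (e t) := by
  obtain ⟨E, hE, h1, h2⟩ := he
  obtain ⟨u, hu, hsu⟩ := h.cof hs
  obtain ⟨η, hη, hl, hf'⟩ := exists_limit_lev h.regd h.uncd ![f] (by simpa)
  have hg := lev_sepD0 (A := B) (isSuccLimit_ord h.uncd.le) (n := 2)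
    (Q := fun _ e p => ∃ t y, p = pair t y ∧ ∃ q ∈ e 0, ∃ t' x, q = pair t' x ∧ t' = t ∧
      IsApp (e 1) x y)
    (by apply_rules [D0.isApp, D0.expair, D0.bex, D0.eq, D0.and, IsVar.mk])
    ![E, f] (by simp [Fin.forall_fin_succ, hf, h.mem_d hE])
    (G_two (A := B) ▸ (gClosed_lev (isSuccLimit_ord h.uncd.le)).2 2 u (h.mem_d hu) _
      (lev_mem_lev hη))
  refine ⟨_, hg, ?_⟩
  have hQ : D0 (n := 1 + 1) fun _ e => ∃ q ∈ (Fst e) 0, ∃ t x : ZFSet.{u}, q = pair t x ∧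
      t = Lst e := by
    apply_rules [D0.expair, D0.bex, D0.eq, D0.and, D0.mem, IsVar.mk]
  have hv : ∀ i, ![E] i ∈ lev B c.ord := by simpa
  refine ⟨_, h.sep_mem (Q := fun _ e t' => ∃ q ∈ e 0, ∃ t x : ZFSet.{u}, q = pair t x ∧
      t = t') hQ hv hu,
    (h.mem_map_sep (Q := fun _ e t' => ∃ q ∈ e 0, ∃ t x : ZFSet.{u}, q = pair t x ∧
      t = t') hQ hv hu s).2 ⟨hsu, _, h1, _, _, rfl, rfl⟩, fun t ht => ?_⟩
  obtain ⟨htu, q, hq, t', x, rfl, rfl⟩ := ZFSet.mem_sep.1 ht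
  refine app_eq fun y => ?_
  simp only [ZFSet.mem_sep, Matrix.cons_val, ZFSet.pair_mem_prod, isApp_iff]
  constructor
  · rintro ⟨-, t, y', hp, q, hq', t'', x', rfl, rfl, rfl⟩
    obtain ⟨rfl, rfl⟩ := ZFSet.pair_inj.1 hp
    rw [h2 _ _ hq']
  · rintro rfl
    refine ⟨⟨htu, app_mem_lev hl (hf' 0) _⟩, _, _, rfl, _, hq, _, _, rfl, rfl, ?_⟩
    rw [h2 _ _ hq]

end Emb

open ZFSet (pair)
open Filter

/-! ### The ultrapower -/

variable {A B a b s x y z f g u : ZFSet.{u}} {ξ η : Ordinal.{u}} {c d : Cardinal.{u}} {n : ℕ}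
  {j e e' : ZFSet.{u} → ZFSet.{u}} {R : ZFSet.{u} → ZFSet.{u} → Prop}

/-- The elements of the ultrapower: a function and a seed. -/
abbrev Pt (A B : ZFSet.{u}) (c d : Cardinal.{u}) : Type (u + 1) := lev B d.ord × lev A c.ord

/-- `app f x ∈ app g y`. -/
def AppMem (f x g y : ZFSet.{u}) : Prop :=
  ∃ p ∈ g, ∃ b w, p = pair b w ∧ b = y ∧ ∃ v ∈ w, IsApp f x v

theorem D0.appMem {t s w t' : (Fin n → ZFSet.{u}) → ZFSet.{u}} (ht : IsVar t) (hs : IsVar s)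
    (hw : IsVar w) (ht' : IsVar t') : D0 (fun _ e => AppMem (t e) (s e) (w e) (t' e)) := by
  refine D0.comp4 (P := fun _ => AppMem) ?_ ht hs hw ht'
  unfold AppMem
  apply_rules [D0.isApp, D0.expair, D0.bex, D0.eq, D0.and, IsVar.mk]

theorem appMem_iff : AppMem f x g y ↔ app f x ∈ app g y := by
  rw [mem_app (f := g)]
  constructor
  · rintro ⟨p, hp, b, w, rfl, rfl, v, hv, hv'⟩
    exact ⟨w, hp, isApp_iff.1 hv' ▸ hv⟩
  · rintro ⟨w, hw, hv⟩
    exact ⟨_, hw, _, _, rfl, rfl, _, hv, isApp_iff.2 rfl⟩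

theorem d0_mem : D0 (n := 2) fun _ e => (e 0 : ZFSet.{u}) ∈ e 1 := D0.mem (IsVar.mk _) (IsVar.mk _)

theorem d0_eq : D0 (n := 2) fun _ e => (e 0 : ZFSet.{u}) = e 1 := D0.eq (IsVar.mk _) (IsVar.mk _)

namespace Emb

theorem pair_mem (h : Emb A B c d j) (p q : Pt A B c d) : pair p.2.1 q.2.1 ∈ lev A c.ord :=
  h.gA.opair p.2.2 q.2.2

/-- The relation `R` holds between `p` and `q` in the ultrapower. -/
def Tr (h : Emb A B c d j) (R : ZFSet.{u} → ZFSet.{u} → Prop) (p q : Pt A B c d) : Prop :=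
  ∀ᶠ t in h.filter (h.pair_mem p q), R (app p.1.1 (fst t)) (app q.1.1 (snd t))

variable (h : Emb A B c d j) {p q r : Pt A B c d}
include h

theorem em_comp (hR : D0 (n := 2) fun _ e => R (e 0) (e 1)) (hs : s ∈ lev A c.ord)
    (he : SeedMap B c j e s p.2.1) (he' : SeedMap B c j e' s q.2.1) :
    (∀ᶠ t in h.filter hs, R (app p.1.1 (e t)) (app q.1.1 (e' t))) ∨
      ∀ᶠ t in h.filter hs, ¬ R (app p.1.1 (e t)) (app q.1.1 (e' t)) := by
  obtain ⟨f, hf, hf'⟩ := h.exists_comp hs he p.1.2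
  obtain ⟨g, hg, hg'⟩ := h.exists_comp hs he' q.1.2
  obtain ⟨φ, hφ⟩ := hR
  have := h.em (ha := hs) φ (f := ![f, g]) (by simp [Fin.forall_fin_succ, hf, hg])
  simp only [← hφ, Matrix.cons_val] at this
  refine this.imp (fun this => ?_) fun this => ?_
  all_goals
    filter_upwards [this, hf', hg'] with t ht h1 h2
    rwa [← h1, ← h2]

/-- Truth may be computed at any seed refining both seeds. One direction pushes the filter forward
to the pair of seeds; the other also uses that the filter of that pair decides `R`. -/
theorem tr_iff (hR : D0 (n := 2) fun _ e => R (e 0) (e 1)) (hs : s ∈ lev A c.ord)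
    (he : SeedMap B c j e s p.2.1) (he' : SeedMap B c j e' s q.2.1) :
    h.Tr R p q ↔ ∀ᶠ t in h.filter hs, R (app p.1.1 (e t)) (app q.1.1 (e' t)) := by
  have hp := h.pair_mem p q
  have ht := h.tendsto hs hp (h.seedMap_pair hs p.2.2 q.2.2 he he')
  constructor
  · intro h1
    simpa using ht.eventually h1
  · intro h1
    refine (h.em_comp hR hp (h.seedMap_fst hp p.2.2 (h.seedMap_id hp))
      (h.seedMap_snd hp q.2.2 (h.seedMap_id hp))).resolve_right fun h2 => ?_
    have h3 := ht.eventually h2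
    simp only [id, fst_pair, snd_pair] at h3
    have := h.neBot (ha := hs)
    exact (h1.and h3).exists.elim fun x hx => hx.2 hx.1

theorem tr_iff_same (hR : D0 (n := 2) fun _ e => R (e 0) (e 1)) (hs : s ∈ lev A c.ord)
    {f g : lev B d.ord} : h.Tr R (f, ⟨s, hs⟩) (g, ⟨s, hs⟩) ↔
      ∀ᶠ t in h.filter hs, R (app f.1 t) (app g.1 t) :=
  h.tr_iff hR hs (p := (f, ⟨s, hs⟩)) (q := (g, ⟨s, hs⟩)) (h.seedMap_id hs) (h.seedMap_id hs)

theorem exists_seed (p q r : Pt A B c d) : ∃ s, ∃ _ : s ∈ lev A c.ord, ∃ e₁ e₂ e₃,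
    SeedMap B c j e₁ s p.2.1 ∧ SeedMap B c j e₂ s q.2.1 ∧ SeedMap B c j e₃ s r.2.1 := by
  have hs := h.gA.opair p.2.2 (h.pair_mem q r)
  have h1 := h.seedMap_snd hs (h.pair_mem q r) (h.seedMap_id hs)
  exact ⟨_, hs, _, _, _, h.seedMap_fst hs p.2.2 (h.seedMap_id hs), h.seedMap_fst hs q.2.2 h1,
    h.seedMap_snd hs r.2.2 h1⟩

theorem tr_symm (h1 : h.Tr (· = ·) p q) : h.Tr (· = ·) q p := by
  obtain ⟨s, hs, e₁, e₂, -, he₁, he₂, -⟩ := h.exists_seed p q q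
  rw [h.tr_iff d0_eq hs he₁ he₂] at h1
  rw [h.tr_iff d0_eq hs he₂ he₁]
  filter_upwards [h1] with t ht using ht.symm

theorem tr_congr_left (hR : D0 (n := 2) fun _ e => R (e 0) (e 1)) (h1 : h.Tr (· = ·) p q)
    (h2 : h.Tr R q r) : h.Tr R p r := by
  obtain ⟨s, hs, e₁, e₂, e₃, he₁, he₂, he₃⟩ := h.exists_seed p q r
  rw [h.tr_iff d0_eq hs he₁ he₂] at h1
  rw [h.tr_iff hR hs he₂ he₃] at h2
  rw [h.tr_iff hR hs he₁ he₃]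
  filter_upwards [h1, h2] with t h1 h2
  rwa [h1]

theorem tr_congr_right (hR : D0 (n := 2) fun _ e => R (e 0) (e 1)) (h1 : h.Tr (· = ·) q r)
    (h2 : h.Tr R p q) : h.Tr R p r := by
  obtain ⟨s, hs, e₁, e₂, e₃, he₁, he₂, he₃⟩ := h.exists_seed p q r
  rw [h.tr_iff d0_eq hs he₂ he₃] at h1
  rw [h.tr_iff hR hs he₁ he₂] at h2
  rw [h.tr_iff hR hs he₁ he₃]
  filter_upwards [h1, h2] with t h1 h2
  rwa [← h1]

/-- If two points differ, then almost everywhere the value of one fails to be included in that of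
the other. A Skolem function choosing from the difference is a point belonging to one but not to the
other. -/
theorem tr_ext (hext : ∀ r, h.Tr (· ∈ ·) r p ↔ h.Tr (· ∈ ·) r q) : h.Tr (· = ·) p q := by
  have hs := h.pair_mem p q
  have he := h.seedMap_fst hs p.2.2 (h.seedMap_id hs)
  have he' := h.seedMap_snd hs q.2.2 (h.seedMap_id hs)
  by_contra hn
  have h1 := ((h.em_comp d0_eq hs he he').resolve_left hn)
  obtain ⟨f, hf, hf'⟩ := h.exists_comp hs he p.1.2
  obtain ⟨g, hg, hg'⟩ := h.exists_comp hs he' q.1.2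
  obtain ⟨u, hu, hsu⟩ := h.cof hs
  have key : ∀ f ∈ lev B d.ord, ∀ g ∈ lev B d.ord, ∃ w ∈ lev B d.ord, ∀ x ∈ u,
      (∃ z ∈ app f x, z ∉ app g x) → app w x ∈ app f x ∧ app w x ∉ app g x := by
    intro f hf g hg
    obtain ⟨w, hw, hw'⟩ := exists_skolem h.regd h.uncd (.neg (.mem (Fin.last 2) (1 : Fin 3)))
      (0 : Fin 2) (f := ![f, g]) (by simp [Fin.forall_fin_succ, hf, hg]) (h.mem_d hu)
    have h1 : ∀ (v : Fin 2 → ZFSet.{u}) z, Fin.snoc (α := fun _ => ZFSet.{u}) v z 1 = v 1 :=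
      fun v z => Fin.snoc_castSucc (α := fun _ => ZFSet.{u}) z v 1
    simp only [Sat, Fin.snoc_last, h1, Matrix.cons_val] at hw'
    exact ⟨w, hw, hw'⟩
  have key2 : ∀ (f g : lev B d.ord), (∀ᶠ t in h.filter hs, ∃ z ∈ app f.1 t, z ∉ app g.1 t) →
      ∃ r : Pt A B c d, h.Tr (· ∈ ·) r (f, ⟨_, hs⟩) ∧ ¬ h.Tr (· ∈ ·) r (g, ⟨_, hs⟩) := by
    intro f g hfg
    obtain ⟨w, hw, hw'⟩ := key f.1 f.2 g.1 g.2
    refine ⟨(⟨w, hw⟩, ⟨_, hs⟩), ?_, ?_⟩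
    · rw [h.tr_iff_same d0_mem]
      filter_upwards [hfg, h.eventually_mem hu hsu] with t h1 h2 using (hw' t h2 h1).1
    · rw [h.tr_iff_same d0_mem]
      intro h3
      have := h.neBot (ha := hs)
      obtain ⟨t, h1, h2, h3⟩ := (hfg.and ((h.eventually_mem hu hsu).and h3)).exists
      exact (hw' t h2 h1).2 h3
  have hp : h.Tr (· = ·) (⟨f, hf⟩, ⟨_, hs⟩) p := (h.tr_iff d0_eq hs (p := (⟨f, hf⟩, ⟨_, hs⟩))
    (h.seedMap_id hs) he).2 hf'
  have hq : h.Tr (· = ·) (⟨g, hg⟩, ⟨_, hs⟩) q := (h.tr_iff d0_eq hs (p := (⟨g, hg⟩, ⟨_, hs⟩))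
    (h.seedMap_id hs) he').2 hg'
  obtain ⟨φ, hφ⟩ : D0 (n := 2) fun _ e => ∃ z ∈ (e 0 : ZFSet.{u}), z ∉ e 1 := by
    apply_rules [D0.bex, D0.neg, D0.mem, IsVar.mk]
  have hem := h.em (ha := hs) φ (f := ![f, g]) (by simp [Fin.forall_fin_succ, hf, hg])
  simp only [← hφ, Matrix.cons_val] at hem
  rcases hem with h2 | h2
  · obtain ⟨r, hr, hr'⟩ := key2 ⟨f, hf⟩ ⟨g, hg⟩ h2
    exact hr' (h.tr_congr_right d0_mem (h.tr_symm hq)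
      ((hext r).1 (h.tr_congr_right d0_mem hp hr)))
  · obtain ⟨r, hr, hr'⟩ := key2 ⟨g, hg⟩ ⟨f, hf⟩ (by
      filter_upwards [h1, h2, hf', hg'] with t h1 h2 h3 h4
      by_contra hn
      push Not at hn h2
      refine h1 ?_
      rw [← h3, ← h4]
      exact subset_antisymm h2 hn)
    exact hr' (h.tr_congr_right d0_mem (h.tr_symm hp)
      ((hext r).2 (h.tr_congr_right d0_mem hq hr)))

/-- For functions in `lev B c.ord` membership of values on a set Z is a bounded statement about
elements in the domain of j, so it can be moved by j and evaluated at the seeds. -/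
theorem tr_mem_iff (hf : f ∈ lev B c.ord) (hg : g ∈ lev B c.ord) (a b : lev A c.ord) :
    h.Tr (· ∈ ·) (⟨f, h.mem_d hf⟩, a) (⟨g, h.mem_d hg⟩, b) ↔ app (j f) a.1 ∈ app (j g) b.1 := by
  constructor
  · rintro ⟨Z, hZ, hab, hZ'⟩
    have := (h.d0 (n := 3) (Q := fun _ e => ∀ p ∈ e 2, ∀ x y, p = pair x y →
      AppMem (e 0) x (e 1) y) (by apply_rules [D0.appMem, D0.allpair, D0.ball, IsVar.mk])
      (v := ![f, g, Z]) (by simp [Fin.forall_fin_succ, hf, hg, hZ])).1 (by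
        rintro p hp x y rfl
        simpa [appMem_iff] using hZ' _ hp)
    exact appMem_iff.1 (this _ hab _ _ rfl)
  · intro hab
    obtain ⟨u, hu, hau, hbu⟩ := h.cof2 a.2 b.2
    have hQ : D0 (n := 2 + 1) fun _ e => ∃ x y, (Lst e : ZFSet.{u}) = pair x y ∧
      AppMem ((Fst e) 0) x ((Fst e) 1) y := by apply_rules [D0.appMem, D0.expair, IsVar.mk]
    have hv : ∀ i, ![f, g] i ∈ lev B c.ord := by simp [Fin.forall_fin_succ, hf, hg]
    refine ⟨_, h.sep_mem (Q := fun _ e p => ∃ x y, p = pair x y ∧ AppMem (e 0) x (e 1) y) hQ hv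
      (h.prod_mem hu hu),
      (h.mem_map_sep (Q := fun _ e p => ∃ x y, p = pair x y ∧ AppMem (e 0) x (e 1) y) hQ hv
      (h.prod_mem hu hu) _).2 ⟨(h.pair_mem_map_prod hu hu).2 ⟨hau, hbu⟩, _, _, rfl,
      appMem_iff.2 hab⟩, fun p hp => ?_⟩
    obtain ⟨-, x, y, rfl, hxy⟩ := ZFSet.mem_sep.1 hp
    simpa [appMem_iff] using hxy

theorem card_lt_of_mem (hu : u ∈ lev B c.ord) : u.card < c := by
  obtain ⟨η, hη, hu'⟩ := (mem_lev_of_isSuccLimit (isSuccLimit_ord h.unc.le)).1 hu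
  exact (ZFSet.card_mono (isTransitive_lev B η _ hu')).trans_lt (card_lev_lt B h.unc hη)

/-- A descending sequence involves countably many functions and witnessing sets. Collapsing a small
hull of them replaces the functions by ones in `lev B c.ord`; applying j and evaluating at the seeds
gives a descending ∈-sequence of sets. -/
theorem wellFounded_tr : WellFounded (h.Tr (· ∈ ·)) := by
  rw [wellFounded_iff_isEmpty_descending_chain]
  refine ⟨fun ⟨p, hp⟩ => ?_⟩
  choose Z hZ hpZ hZ' using hp
  set S : ZFSet.{u} := ZFSet.range fun n : ℕ ⊕ ℕ => Sum.elim (fun n => (p n).1.1) Z n with hS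
  have hSmem : ∀ {x}, x ∈ S ↔ (∃ n, (p n).1.1 = x) ∨ ∃ n, Z n = x := by simp [hS]
  have hcard : S.card < c := by
    have : #S ≤ ℵ₀ := by
      refine (mk_le_of_surjective (α := ULift.{u + 1} (ℕ ⊕ ℕ)) (f := fun n =>
        ⟨Sum.elim (fun n => (p n).1.1) Z n.down, by simp [hS]⟩) ?_).trans (mk_le_aleph0)
      rintro ⟨x, hx⟩
      rcases hSmem.1 hx with ⟨n, rfl⟩ | ⟨n, rfl⟩
      · exact ⟨⟨.inl n⟩, rfl⟩
      · exact ⟨⟨.inr n⟩, rfl⟩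
    rw [ZFSet.cardinalMk_coe_sort, lift_le_aleph0] at this
    exact this.trans_lt h.unc
  obtain ⟨Y, δ, hSY, hcl, -, hδ, -, hcol, hY⟩ := exists_hull h.reg h.unc h.regd h.lt.le h.subB
    (B := S) (by
      intro x hx
      rcases hSmem.1 hx with ⟨n, rfl⟩ | ⟨n, rfl⟩
      · exact (p n).1.2
      · exact h.mem_d (hZ n)) hcard
  have hfY : ∀ n, (p n).1.1 ∈ Y := fun n => hSY (hSmem.2 (.inl ⟨n, rfl⟩))
  have hZY : ∀ n, Z n ∈ Y := fun n => hSY (hSmem.2 (.inr ⟨n, rfl⟩))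
  have hf : ∀ n, Cl.col Y (p n).1.1 ∈ lev B c.ord := fun n =>
    isTransitive_lev B _ _ hY (Cl.mem_colImage.2 ⟨_, hfY n, hfY n, rfl⟩)
  -- The witnessing sets lie in the part of the hull fixed by the collapse, so the collapsed
  -- functions descend on the same sets of measure one.
  have hZc : ∀ n, Cl.col Y (Z n) = Z n := fun n => hcol _ ((hδ _).2 ⟨hZY n, hZ n⟩)
  have hD : D0 (n := 3) fun _ e => ∀ p ∈ (e 2 : ZFSet.{u}), ∀ x y, p = pair x y →
      AppMem (e 0) x (e 1) y := by apply_rules [D0.appMem, D0.allpair, D0.ball, IsVar.mk]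
  have hdesc : ∀ n, app (j (Cl.col Y (p (n + 1)).1.1)) (p (n + 1)).2.1 ∈
      app (j (Cl.col Y (p n).1.1)) (p n).2.1 := by
    intro n
    have h1 := (hcl.d0_col hD (v := ![(p (n + 1)).1.1, (p n).1.1, Z n])
      (by simp [Fin.forall_fin_succ, hfY, hZY])).1 (by
        rintro q hq x y rfl
        simpa [appMem_iff] using hZ' _ _ hq)
    simp only [Matrix.cons_val, hZc] at h1
    have h2 := (h.d0 hD (v := ![Cl.col Y (p (n + 1)).1.1, Cl.col Y (p n).1.1, Z n])
      (by simp [Fin.forall_fin_succ, hf, hZ])).1 h1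
    exact appMem_iff.1 (h2 _ (hpZ n) _ _ rfl)
  exact (wellFounded_iff_isEmpty_descending_chain.1 ZFSet.mem_wf).elim
    ⟨fun n => app (j (Cl.col Y (p n).1.1)) (p n).2.1, hdesc⟩

end Emb

/-- The transitive collapse of the ultrapower. -/
noncomputable def Emb.val (h : Emb A B c d j) : Pt A B c d → ZFSet.{u} := mcol h.wellFounded_tr

namespace Emb

variable (h : Emb A B c d j) {p q r : Pt A B c d}
include h

theorem mem_val : x ∈ h.val p ↔ ∃ q, h.Tr (· ∈ ·) q p ∧ h.val q = x := mem_mcol _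

theorem val_congr (hpq : h.Tr (· = ·) p q) : h.val p = h.val q := by
  ext x
  rw [mem_val, mem_val]
  exact exists_congr fun r => and_congr_left fun _ =>
    ⟨h.tr_congr_right d0_mem hpq, h.tr_congr_right d0_mem (h.tr_symm hpq)⟩

theorem val_eq_iff : h.val p = h.val q ↔ h.Tr (· = ·) p q := by
  refine ⟨?_, h.val_congr⟩
  induction p using h.wellFounded_tr.induction generalizing q with
  | h p ih =>
  intro hpq
  refine h.tr_ext fun r => ⟨fun hr => ?_, fun hr => ?_⟩
  · obtain ⟨r', hr', he⟩ := h.mem_val.1 (hpq ▸ h.mem_val.2 ⟨r, hr, rfl⟩)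
    exact h.tr_congr_left d0_mem (ih r hr he.symm) hr'
  · obtain ⟨r', hr', he⟩ := h.mem_val.1 (hpq ▸ h.mem_val.2 ⟨r, hr, rfl⟩)
    exact h.tr_congr_left d0_mem (h.tr_symm (ih r' hr' he)) hr'

theorem val_mem_iff : h.val p ∈ h.val q ↔ h.Tr (· ∈ ·) p q := by
  rw [mem_val]
  refine ⟨fun ⟨r, hr, he⟩ => ?_, fun hp => ⟨p, hp, rfl⟩⟩
  exact h.tr_congr_left d0_mem (h.tr_symm (h.val_eq_iff.1 he)) hr

/-! ### Functions with values in the small hierarchy -/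

theorem eventually_of_fst {T : ZFSet.{u} → Prop} (ha : a ∈ lev A c.ord) (hb : b ∈ lev A c.ord)
    (hT : ∀ᶠ t in h.filter (h.gA.opair ha hb), T (fst t)) : ∀ᶠ x in h.filter ha, T x := by
  obtain ⟨Z, hZ, hab, hZ'⟩ := hT
  obtain ⟨u, hu, hau⟩ := h.cof ha
  have hQ : D0 (n := 1 + 1) fun _ e => ∃ p ∈ (Fst e) 0, ∃ x y : ZFSet.{u}, p = pair x y ∧
      x = Lst e := by apply_rules [D0.expair, D0.bex, D0.eq, IsVar.mk]
  have hv : ∀ i, ![Z] i ∈ lev B c.ord := by simpa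
  refine ⟨_, h.sep_mem (Q := fun _ e x' => ∃ p ∈ e 0, ∃ x y, p = pair x y ∧ x = x') hQ hv hu,
    (h.mem_map_sep (Q := fun _ e x' => ∃ p ∈ e 0, ∃ x y, p = pair x y ∧ x = x') hQ hv hu a).2
    ⟨hau, _, hab, _, _, rfl, rfl⟩, fun x hx => ?_⟩
  obtain ⟨-, p, hp, x, y, rfl, rfl⟩ := ZFSet.mem_sep.1 hx
  simpa using hZ' _ hp

/-- On a set of measure one, which has fewer than `c` elements, the values are bounded in one level
by regularity. The restriction of the function is then a subset of an element of `lev B c.ord`,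
hence belongs to it. -/
theorem exists_trunc (ha : a ∈ lev A c.ord) (hg : g ∈ lev B d.ord)
    (hN : ∀ᶠ x in h.filter ha, app g x ∈ lev B c.ord) :
    ∃ g' ∈ lev B c.ord, ∃ V ∈ lev B c.ord, ∀ᶠ x in h.filter ha, app g' x = app g x ∧ app g x ∈ V := by
  obtain ⟨Z, hZ, haZ, hZ'⟩ := hN
  have hl := isSuccLimit_ord h.unc.le
  have : ∀ x ∈ Z, ∃ η < c.ord, app g x ∈ lev B η := fun x hx =>
    (mem_lev_of_isSuccLimit hl).1 (hZ' x hx)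
  choose! o ho ho' using this
  obtain ⟨γ, hγ, -, hb⟩ := exists_isSuccLimit_bound h.reg h.unc (h.card_lt_of_mem hZ) o ho
  have hV := lev_mem_lev (A := B) hγ
  have happ : ∀ x ∈ Z, app g x ∈ lev B γ := fun x hx => lev_mono (hb x hx).le (ho' x hx)
  have hp := h.prod_mem hZ hV
  have hg' := lev_sepD0 (A := B) (isSuccLimit_ord h.uncd.le) (n := 1)
    (Q := fun _ e p => ∃ x y, p = pair x y ∧ IsApp (e 0) x y)
    (by apply_rules [D0.isApp, D0.expair, IsVar.mk]) ![g] (by simpa) (h.mem_d hp)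
  obtain ⟨η, hη, hpη⟩ := (mem_lev_of_isSuccLimit hl).1 hp
  refine ⟨_, mem_lev_of_subset_lev h.reg h.unc h.regd h.lt.le h.subB hg' hη fun x hx =>
    isTransitive_lev B η _ hpη (ZFSet.mem_sep.1 hx).1, _, hV, Z, hZ, haZ, fun x hx =>
    ⟨app_eq fun y => ?_, happ x hx⟩⟩
  simp only [ZFSet.mem_sep, Matrix.cons_val, ZFSet.pair_mem_prod, isApp_iff]
  constructor
  · rintro ⟨-, x', y', hp, rfl⟩
    obtain ⟨rfl, rfl⟩ := ZFSet.pair_inj.1 hp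
    rfl
  · rintro rfl
    exact ⟨⟨hx, happ x hx⟩, _, _, rfl, rfl⟩

theorem exists_id (ha : a ∈ lev A c.ord) : ∃ i ∈ lev B c.ord, app (j i) a = a ∧
    ∀ᶠ x in h.filter ha, app i x = x := by
  obtain ⟨u, hu, hau⟩ := h.cof ha
  have hp := h.prod_mem hu hu
  have hQ : D0 (n := 1 + 1) fun _ e => ∃ x y, (Lst e : ZFSet.{u}) = pair x y ∧ x = y := by
    apply_rules [D0.expair, D0.eq, IsVar.mk]
  have hv : ∀ i, ![(∅ : ZFSet.{u})] i ∈ lev B c.ord := by simp [h.gB.1]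
  refine ⟨_, h.sep_mem (Q := fun _ _ p => ∃ x y, p = pair x y ∧ x = y) hQ hv hp, ?_, u, hu, hau, ?_⟩
  · refine app_eq fun y => ?_
    rw [h.mem_map_sep (Q := fun _ _ p => ∃ x y, p = pair x y ∧ x = y) hQ hv hp,
      h.pair_mem_map_prod hu hu]
    constructor
    · rintro ⟨-, x', y', hp, rfl⟩
      obtain ⟨rfl, rfl⟩ := ZFSet.pair_inj.1 hp
      rfl
    · rintro rfl
      exact ⟨⟨hau, hau⟩, _, _, rfl, rfl⟩
  · intro x hx
    refine app_eq fun y => ?_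
    simp only [ZFSet.mem_sep, ZFSet.pair_mem_prod]
    constructor
    · rintro ⟨-, x', y', hp, rfl⟩
      obtain ⟨rfl, rfl⟩ := ZFSet.pair_inj.1 hp
      rfl
    · rintro rfl
      exact ⟨⟨hx, hx⟩, _, _, rfl, rfl⟩

/-- ∈-induction on the value. A point below one given by f ∈ `lev B c.ord` takes values in `lev B
c.ord` and can be truncated; conversely an element w of the value is represented by an identity
function at the seed w. -/
theorem val_eq_app (hf : f ∈ lev B c.ord) (a : lev A c.ord) :
    h.val (⟨f, h.mem_d hf⟩, a) = app (j f) a.1 := by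
  generalize hX : app (j f) a.1 = X
  induction X using ZFSet.inductionOn generalizing f a with
  | h X ih =>
  subst hX
  ext w
  rw [h.mem_val]
  constructor
  · rintro ⟨⟨⟨g, hg⟩, b⟩, hq, rfl⟩
    have hN : ∀ᶠ x in h.filter b.2, app g x ∈ lev B c.ord := by
      refine h.eventually_of_fst b.2 a.2 (hq.mono fun t ht => ?_)
      exact isTransitive_lev B _ _ (app_mem_lev (isSuccLimit_ord h.unc.le) hf _) ht
    obtain ⟨g', hg', _, _, he⟩ := h.exists_trunc b.2 hg hN
    have he' : h.Tr (· = ·) (⟨g', h.mem_d hg'⟩, b) (⟨g, hg⟩, b) :=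
      (h.tr_iff_same d0_eq b.2).2 (he.mono fun x hx => hx.1)
    have := (h.tr_mem_iff hg' hf b a).1 (h.tr_congr_left d0_mem he' hq)
    rw [← h.val_congr he', ih _ this hg' b rfl]
    exact this
  · intro hw
    have hwM : w ∈ lev A c.ord := isTransitive_lev A _ _
      (app_mem_lev (isSuccLimit_ord h.unc.le) (h.mem hf) _) hw
    obtain ⟨i, hi, hiw, -⟩ := h.exists_id hwM
    refine ⟨(⟨i, h.mem_d hi⟩, ⟨w, hwM⟩), (h.tr_mem_iff hi hf _ _).2 ?_, ih w hw hi ⟨w, hwM⟩ hiw⟩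
    rw [hiw]
    exact hw

/-- As `A` and `B` are included in `lev A c.ord` and `lev B c.ord`, the predicate concerns only
points represented by functions in `lev B c.ord`, whose values are known explicitly. -/
theorem val_mem_pred_iff : h.val p ∈ A ↔ ∀ᶠ t in h.filter p.2.2, app p.1.1 t ∈ B := by
  constructor
  · intro hp
    have hm := h.subA hp
    generalize hw : h.val p = w at hp hm
    obtain ⟨i, hi, hiw, hi'⟩ := h.exists_id hm
    have h1 : h.val p = h.val (⟨i, h.mem_d hi⟩, ⟨w, hm⟩) :=
      hw.trans (hiw.symm.trans (h.val_eq_app hi ⟨w, hm⟩).symm)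
    have h2 : ∀ᶠ x in h.filter hm, x ∈ B := by
      obtain ⟨u, hu, hau⟩ := h.cof hm
      have hQ : D0 (n := 0 + 1) fun A e => (Lst e : ZFSet.{u}) ∈ A := D0.pred (IsVar.mk _)
      have hv : ∀ i, ![] i ∈ lev B c.ord := fun i => i.elim0
      exact ⟨_, h.sep_mem (Q := fun A _ x => x ∈ A) hQ hv hu,
        (h.mem_map_sep (Q := fun A _ x => x ∈ A) hQ hv hu _).2 ⟨hau, hp⟩,
        fun x hx => (ZFSet.mem_sep.1 hx).2⟩
    have hs := h.pair_mem p (⟨i, h.mem_d hi⟩, ⟨w, hm⟩)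
    refine h.eventually_of_fst p.2.2 hm ?_
    have h3 := (h.tendsto hs hm (h.seedMap_snd hs hm (h.seedMap_id hs))).eventually (hi'.and h2)
    have h4 : ∀ᶠ t in h.filter hs, app p.1.1 (fst t) = app i (snd t) := h.val_eq_iff.1 h1
    refine (h4.and h3).mono fun t ht => ?_
    rw [ht.1]
    exact ht.2.1.symm ▸ ht.2.2
  · intro hp
    obtain ⟨g', hg', V, hV, he⟩ := h.exists_trunc p.2.2 p.1.2 (hp.mono fun x hx => h.subB hx)
    have he' : h.Tr (· = ·) (⟨g', h.mem_d hg'⟩, p.2) p :=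
      (h.tr_iff_same d0_eq p.2.2 (f := ⟨g', _⟩) (g := p.1)).2 (he.mono fun x hx => hx.1)
    rw [← h.val_congr he', h.val_eq_app hg']
    obtain ⟨Z, hZ, haZ, hZ'⟩ := he.and hp
    have := (h.d0 (n := 3) (Q := fun A e => ∀ x ∈ e 0, ∃ v ∈ e 1, IsApp (e 2) x v ∧ v ∈ A)
      (by apply_rules [D0.isApp, D0.ball, D0.bex, D0.and, D0.pred, IsVar.mk]) (v := ![Z, V, g'])
      (by simp [Fin.forall_fin_succ, hZ, hV, hg'])).1 (by
        intro x hx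
        obtain ⟨⟨h1, h2⟩, h3⟩ := hZ' x hx
        exact ⟨_, h2, isApp_iff.2 h1.symm, h3⟩)
    obtain ⟨v, -, hv, hvA⟩ := this _ haZ
    exact isApp_iff.1 hv ▸ hvA

end Emb

open ZFSet (pair)
open Filter

/-! ### Łoś's theorem -/

variable {A B a b s x y z f g u M X w : ZFSet.{u}} {ξ η : Ordinal.{u}} {c d : Cardinal.{u}} {n : ℕ}
  {j : ZFSet.{u} → ZFSet.{u}}

theorem comp_snoc {α : Type*} (F : α → ZFSet.{u}) (v : Fin n → α) (x : α) :
    (fun i => F (Fin.snoc (α := fun _ => α) v x i)) =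
      Fin.snoc (α := fun _ => ZFSet.{u}) (fun i => F (v i)) (F x) := by
  funext i
  refine Fin.lastCases ?_ (fun i => ?_) i <;> simp

namespace Emb

variable (h : Emb A B c d j) {p q r : Pt A B c d}
include h

theorem los (φ : Fm n) (hs : s ∈ lev A c.ord) (f : Fin n → lev B d.ord) :
    Sat A φ (fun i => h.val (f i, ⟨s, hs⟩)) ↔
      ∀ᶠ t in h.filter hs, Sat B φ fun i => app (f i).1 t := by
  induction φ generalizing s with
  | mem i k => exact h.val_mem_iff.trans (h.tr_iff_same d0_mem hs)
  | pred i => exact h.val_mem_pred_iff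
  | neg φ ih =>
    have := h.eventually_not_iff (ha := hs) φ (f := fun i => (f i).1) (fun i => (f i).2)
    simp only [Sat, ih hs f, this]
  | and φ ψ ih ih' => simp only [Sat, ih hs f, ih' hs f, eventually_and]
  | bex i φ ih =>
    constructor
    · rintro ⟨z, hz, hsat⟩
      obtain ⟨q, hq, rfl⟩ := h.mem_val.1 hz
      by_contra hn
      have hn' := (h.eventually_not_iff (ha := hs) (.bex i φ) (f := fun i => (f i).1)
        (fun i => (f i).2)).2 hn
      -- The witness comes with its own seed, so all functions are moved to the seed paired with it.
      have hs' := h.gA.opair hs q.2.2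
      have he := h.seedMap_fst hs' hs (h.seedMap_id hs')
      have he' := h.seedMap_snd hs' q.2.2 (h.seedMap_id hs')
      choose f' hf' hff using fun i => h.exists_comp hs' he (f i).2
      obtain ⟨g, hg, hgg⟩ := h.exists_comp hs' he' q.1.2
      have h1 : ∀ i, h.val (⟨f' i, hf' i⟩, ⟨_, hs'⟩) = h.val (f i, ⟨s, hs⟩) := fun i =>
        h.val_congr ((h.tr_iff d0_eq hs' (p := (⟨f' i, hf' i⟩, ⟨_, hs'⟩)) (q := (f i, ⟨s, hs⟩))
          (h.seedMap_id hs') he).2 (hff i))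
      have h2 : h.val (⟨g, hg⟩, ⟨_, hs'⟩) = h.val q :=
        h.val_congr ((h.tr_iff d0_eq hs' (p := (⟨g, hg⟩, ⟨_, hs'⟩)) (q := q)
          (h.seedMap_id hs') he').2 hgg)
      have h3 := ih hs' (Fin.snoc (α := fun _ => lev B d.ord) (fun i => ⟨f' i, hf' i⟩) ⟨g, hg⟩)
      simp only [comp_snoc (fun k : lev B d.ord => h.val (k, ⟨_, hs'⟩)), h1, h2] at h3
      have h4 := h3.1 hsat
      have h5 : ∀ᶠ t in h.filter hs', app q.1.1 (snd t) ∈ app (f i).1 (fst t) :=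
        (h.tr_iff d0_mem hs' he' he).1 hq
      have h6 := (h.tendsto hs' hs he).eventually hn'
      have := h.neBot (ha := hs')
      obtain ⟨t, h4, h5, h6, h7, h8⟩ := (h4.and (h5.and (h6.and
        ((eventually_all.2 hff).and hgg)))).exists
      refine h6 ⟨_, h5, ?_⟩
      rw [comp_snoc (fun k : lev B d.ord => app k.1 t)] at h4
      simp only [h7, h8] at h4
      exact h4
    · intro hsat
      obtain ⟨u, hu, hsu⟩ := h.cof hs
      -- A Skolem function needs no further seed.
      obtain ⟨g, hg, hg'⟩ := exists_skolem h.regd h.uncd φ i (f := fun i => (f i).1)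
        (fun i => (f i).2) (h.mem_d hu)
      have h1 := hsat.and (h.eventually_mem (ha := hs) hu hsu)
      have h2 : ∀ᶠ t in h.filter hs, _ := h1.mono fun t ht => hg' t ht.2 ht.1
      refine ⟨h.val (⟨g, hg⟩, ⟨s, hs⟩), h.val_mem_iff.2 ((h.tr_iff_same d0_mem hs).2
        (h2.mono fun t ht => ht.1)), ?_⟩
      have h3 := ih hs (Fin.snoc (α := fun _ => lev B d.ord) f ⟨g, hg⟩)
      rw [comp_snoc (fun k : lev B d.ord => h.val (k, ⟨_, hs⟩))] at h3
      refine h3.2 (h2.mono fun t ht => ?_)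
      rw [comp_snoc (fun k : lev B d.ord => app k.1 t)]
      exact ht.2

theorem los_d0 {Q : ZFSet.{u} → (Fin n → ZFSet.{u}) → Prop} (hQ : D0 Q) (hs : s ∈ lev A c.ord)
    (f : Fin n → lev B d.ord) : Q A (fun i => h.val (f i, ⟨s, hs⟩)) ↔
      ∀ᶠ t in h.filter hs, Q B fun i => app (f i).1 t := by
  obtain ⟨φ, hφ⟩ := hQ
  simp only [hφ]
  exact h.los φ hs f

theorem exists_const (hs : s ∈ lev A c.ord) (hw : w ∈ lev B d.ord) :
    ∃ k : lev B d.ord, ∀ᶠ t in h.filter hs, app k.1 t = w := by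
  obtain ⟨u, hu, hsu⟩ := h.cof hs
  have hg := gClosed_lev (A := B) (isSuccLimit_ord h.uncd.le)
  have hw' : ({w} : ZFSet.{u}) ∈ lev B d.ord := by simpa using hg.upair hw hw
  refine ⟨⟨ZFSet.prod u {w}, G_two (A := B) ▸ hg.2 2 u (h.mem_d hu) _ hw'⟩, ?_⟩
  refine (h.eventually_mem hu hsu).mono fun t ht => app_eq fun y => ?_
  simp [ht]

/-- The embedding of `lev B d.ord` into the ultrapower given by constant functions. -/
theorem exists_up : ∃ J : ZFSet.{u} → ZFSet.{u}, ∀ w ∈ lev B d.ord, ∀ s, ∀ hs : s ∈ lev A c.ord,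
    ∃ k : lev B d.ord, h.val (k, ⟨s, hs⟩) = J w ∧ ∀ᶠ t in h.filter hs, app k.1 t = w := by
  have h0 := h.gA.1
  have : Nonempty (lev B d.ord) := ⟨⟨∅, h.mem_d h.gB.1⟩⟩
  choose! k hk using fun w (hw : w ∈ lev B d.ord) => h.exists_const h0 hw
  refine ⟨fun w => h.val (k w, ⟨∅, h0⟩), fun w hw s hs => ?_⟩
  obtain ⟨k', hk'⟩ := h.exists_const hs hw
  refine ⟨k', h.val_congr ?_, hk'⟩
  have hs' := h.gA.opair hs h0
  have he := h.seedMap_fst hs' hs (h.seedMap_id hs')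
  have he' := h.seedMap_snd hs' h0 (h.seedMap_id hs')
  refine (h.tr_iff d0_eq hs' (p := (k', ⟨s, hs⟩)) (q := (k w, ⟨∅, h0⟩)) he he').2 ?_
  filter_upwards [(h.tendsto hs' hs he).eventually hk',
    (h.tendsto hs' h0 he').eventually (hk w hw)] with t h1 h2
  exact h1.trans h2.symm

end Emb

/-- The embedding of `lev B d.ord` into the ultrapower. -/
noncomputable def Emb.up (h : Emb A B c d j) : ZFSet.{u} → ZFSet.{u} := h.exists_up.choose

namespace Emb

variable (h : Emb A B c d j) {p q r : Pt A B c d}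
include h

theorem exists_up_eq (hw : w ∈ lev B d.ord) (hs : s ∈ lev A c.ord) :
    ∃ k : lev B d.ord, h.val (k, ⟨s, hs⟩) = h.up w ∧ ∀ᶠ t in h.filter hs, app k.1 t = w :=
  h.exists_up.choose_spec w hw s hs

/-- Łoś's theorem with constants. -/
theorem los_up {m : ℕ} {Q : ZFSet.{u} → (Fin m → ZFSet.{u}) → (Fin n → ZFSet.{u}) → Prop}
    (hQ : D0 (n := m + n) fun A e => Q A (fun i => e (Fin.castAdd n i)) fun i => e (Fin.natAdd m i))
    (hs : s ∈ lev A c.ord) {w : Fin m → ZFSet.{u}} (hw : ∀ i, w i ∈ lev B d.ord)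
    (f : Fin n → lev B d.ord) :
    Q A (fun i => h.up (w i)) (fun i => h.val (f i, ⟨s, hs⟩)) ↔
      ∀ᶠ t in h.filter hs, Q B w fun i => app (f i).1 t := by
  choose k hk hk' using fun i => h.exists_up_eq (hw i) hs
  have := h.los_d0 hQ hs (Fin.append k f)
  simp only [Fin.append_left, Fin.append_right, hk] at this
  rw [this]
  refine eventually_congr ((eventually_all.2 hk').mono fun t ht => ?_)
  rw [funext ht]

theorem d0_up {Q : ZFSet.{u} → (Fin n → ZFSet.{u}) → Prop} (hQ : D0 Q) {w : Fin n → ZFSet.{u}}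
    (hw : ∀ i, w i ∈ lev B d.ord) : Q B w ↔ Q A fun i => h.up (w i) := by
  have := h.los_up (n := 0) (Q := fun A v _ => Q A v) hQ h.gA.1 hw Fin.elim0
  rw [this]
  have := h.neBot (ha := h.gA.1)
  simp

/-- The constant function w truncates to some g in `lev B c.ord`; that g takes the value w on Z is
bounded, so j g takes the value j w at the seed. -/
theorem up_eq (hw : w ∈ lev B c.ord) : h.up w = j w := by
  obtain ⟨k, hk, hk'⟩ := h.exists_up_eq (h.mem_d hw) h.gA.1
  obtain ⟨g, hg, V, hV, he⟩ := h.exists_trunc h.gA.1 k.2 (hk'.mono fun t ht => ht ▸ hw)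
  have he' : h.Tr (· = ·) (⟨g, h.mem_d hg⟩, ⟨_, h.gA.1⟩) (k, ⟨_, h.gA.1⟩) :=
    (h.tr_iff_same d0_eq h.gA.1 (f := ⟨g, _⟩) (g := k)).2 (he.mono fun x hx => hx.1)
  rw [← hk, ← h.val_congr he', h.val_eq_app hg]
  obtain ⟨Z, hZ, haZ, hZ'⟩ := he.and hk'
  have := (h.d0 (n := 3) (Q := fun _ e => ∀ x ∈ e 0, IsApp (e 1) x (e 2))
    (by apply_rules [D0.isApp, D0.ball, IsVar.mk]) (v := ![Z, g, w])
    (by simp [Fin.forall_fin_succ, hZ, hg, hw])).1 fun x hx => by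
      obtain ⟨⟨h1, -⟩, h3⟩ := hZ' x hx
      exact isApp_iff.2 (h3.symm.trans h1.symm)
  exact (isApp_iff.1 (this _ haZ)).symm

/-- The ultrapower does not enlarge the image of `lev B c.ord`: functions into it truncate to
elements of it, whose values are computed by j. Conversely each element of `lev A c.ord` is given by
an identity function at its own seed. -/
theorem up_lev : h.up (lev B c.ord) = lev A c.ord := by
  have hN : lev B c.ord ∈ lev B d.ord := lev_mem_lev h.lt_ord
  ext m
  constructor
  · intro hm
    obtain ⟨k, hk, -⟩ := h.exists_up_eq hN h.gA.1
    rw [← hk] at hm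
    obtain ⟨⟨⟨g, hg⟩, b⟩, -, rfl⟩ := h.mem_val.1 hm
    rw [hk] at hm
    have h1 := (h.los_up (m := 1) (n := 1) (Q := fun _ v w => w 0 ∈ v 0)
      (D0.mem (IsVar.mk _) (IsVar.mk _)) b.2 (w := ![lev B c.ord]) (by simpa) ![⟨g, hg⟩]).1
      (by simpa using hm)
    obtain ⟨g', hg', _, _, he⟩ := h.exists_trunc b.2 hg (by simpa using h1)
    have he' : h.Tr (· = ·) (⟨g', h.mem_d hg'⟩, b) (⟨g, hg⟩, b) :=
      (h.tr_iff_same d0_eq b.2).2 (he.mono fun x hx => hx.1)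
    rw [← h.val_congr he', h.val_eq_app hg']
    exact app_mem_lev (isSuccLimit_ord h.unc.le) (h.mem hg') _
  · intro hm
    obtain ⟨i, hi, him, -⟩ := h.exists_id hm
    have h1 := h.val_eq_app hi ⟨m, hm⟩
    rw [him] at h1
    rw [← h1]
    have := (h.los_up (m := 1) (n := 1) (Q := fun _ v w => w 0 ∈ v 0)
      (D0.mem (IsVar.mk _) (IsVar.mk _)) hm (w := ![lev B c.ord]) (by simpa)
      ![⟨i, h.mem_d hi⟩]).2 (Eventually.of_forall fun t => by
        simpa using app_mem_lev (isSuccLimit_ord h.unc.le) hi t)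
    simpa using this

/-- The transitive collapse of the ultrapower is a level. -/
theorem exists_lev_eq_range : ∃ β, d.ord ≤ β ∧ ∀ x, x ∈ lev A β ↔ ∃ p, h.val p = x := by
  have hT : ∀ x, x ∈ ZFSet.range h.val ↔ ∃ p, h.val p = x := by simp
  have hlim := isSuccLimit_ord h.uncd.le
  obtain ⟨β, -, hβ⟩ := eq_lev_of_closed (A := A) (T := ZFSet.range h.val) (by
      intro y hy z hz
      obtain ⟨p, rfl⟩ := (hT _).1 hy
      obtain ⟨q, -, rfl⟩ := h.mem_val.1 hz
      exact (hT _).2 ⟨q, rfl⟩) ⟨_, (hT _).2 ⟨(⟨∅, (gClosed_lev hlim).1⟩, ⟨∅, h.gA.1⟩), rfl⟩⟩ (by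
      intro S hS a ha b hb i
      obtain ⟨p, rfl⟩ := (hT _).1 hS
      obtain ⟨q, rfl⟩ := (hT _).1 ha
      obtain ⟨r, rfl⟩ := (hT _).1 hb
      obtain ⟨s, hs, e₁, e₂, e₃, he₁, he₂, he₃⟩ := h.exists_seed p q r
      obtain ⟨f₁, hf₁, hff₁⟩ := h.exists_comp hs he₁ p.1.2
      obtain ⟨f₂, hf₂, hff₂⟩ := h.exists_comp hs he₂ q.1.2
      obtain ⟨f₃, hf₃, hff₃⟩ := h.exists_comp hs he₃ r.1.2
      rw [← h.val_congr ((h.tr_iff d0_eq hs (p := (⟨f₁, hf₁⟩, ⟨s, hs⟩)) (h.seedMap_id hs) he₁).2 hff₁),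
        ← h.val_congr ((h.tr_iff d0_eq hs (p := (⟨f₂, hf₂⟩, ⟨s, hs⟩)) (h.seedMap_id hs) he₂).2 hff₂),
        ← h.val_congr ((h.tr_iff d0_eq hs (p := (⟨f₃, hf₃⟩, ⟨s, hs⟩)) (h.seedMap_id hs) he₃).2 hff₃)]
      -- A limit level containing all values of the three functions contains the cuts of these
      -- values, so its image bounds the cut sought in the ultrapower.
      obtain ⟨η, hη, hl, hf⟩ := exists_limit_lev (B := B) h.regd h.uncd ![f₁, f₂, f₃]
        (by simp [Fin.forall_fin_succ, hf₁, hf₂, hf₃])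
      have hG := gClosed_lev (A := B) hl
      obtain ⟨z, hz, hcut⟩ := (h.los_up (m := 1) (n := 3) (Q := fun A v w => ∃ z ∈ v 0,
        IsCut A (w 0) i (w 1) (w 2) z) (by apply_rules [D0.isCut, D0.bex, IsVar.mk]) hs
        (w := ![lev B η]) (by simpa using lev_mem_lev hη) ![⟨f₁, hf₁⟩, ⟨f₂, hf₂⟩, ⟨f₃, hf₃⟩]).2
        (Eventually.of_forall fun t => by
          simp only [Matrix.cons_val]
          have h1 := app_mem_lev hl (hf 0) t
          have h2 := app_mem_lev hl (hf 1) t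
          have h3 := app_mem_lev hl (hf 2) t
          refine ⟨G B 1 _ (G B 1 (app f₁ t) (G B i (app f₂ t) (app f₃ t))),
            hG.2 1 _ h1 _ (hG.2 1 _ h1 _ (hG.2 i _ h2 _ h3)), ?_⟩
          rw [isCut_iff]
          ext z
          simp only [mem_G, GMem, ZFSet.mem_inter]
          tauto)
      obtain ⟨k, hk, -⟩ := h.exists_up_eq (lev_mem_lev (A := B) hη) hs
      dsimp only [Matrix.cons_val] at hz
      rw [← hk] at hz
      obtain ⟨q', -, rfl⟩ := h.mem_val.1 hz
      exact ⟨_, (hT _).2 ⟨q', rfl⟩, hcut⟩) (by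
      intro x hx
      obtain ⟨⟨⟨f, hf⟩, ⟨s, hs⟩⟩, rfl⟩ := (hT _).1 hx
      obtain ⟨η, hη, hl, hf'⟩ := exists_limit_lev (B := B) h.regd h.uncd ![f] (by simpa)
      have hK := ((hier_lev B h.regd h.uncd).seq_lp_mem (hlim.add_one_lt hη)).1
      have hp : pair η.toZFSet (pair (lev B η) (levLe B η)) ∈ seqOf (lp B) (η + 1) :=
        pair_mem_seqOf.2 ⟨Order.lt_add_one_iff.2 le_rfl, rfl⟩
      have ht := isTransitive_lev B d.ord
      have h1 := of_pair_mem ht (ht _ hK hp)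
      have h2 := of_pair_mem ht h1.2
      have h3 := (h.los_up (m := 4) (n := 1) (Q := fun A v w => IsSeq A (v 0) ∧ (∃ q ∈ v 0,
        ∃ b o, q = pair b o ∧ b = v 1 ∧ o = pair (v 2) (v 3)) ∧ w 0 ∈ v 2) (by
          apply_rules [D0.isSeq, D0.opair, D0.mem, D0.and, D0.bex, D0.expair, D0.eq, IsVar.mk]) hs
        (w := ![seqOf (lp B) (η + 1), η.toZFSet, lev B η, levLe B η])
        (by simp [Fin.forall_fin_succ, hK, h1.1, h2.1, h2.2]) ![⟨f, hf⟩]).2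
        (Eventually.of_forall fun t =>
          ⟨isSeq_seqOf B _, ⟨_, hp, _, _, rfl, rfl, rfl⟩, app_mem_lev hl (hf' 0) t⟩)
      obtain ⟨h3, ⟨_, h4, _, _, rfl, rfl, rfl⟩, h5⟩ := h3
      obtain ⟨k, hk, -⟩ := h.exists_up_eq h2.1 hs
      exact ⟨_, _, _, _, h3, h4, h5, (hT _).2 ⟨_, hk⟩⟩)
  refine ⟨β, ?_, fun x => by rw [← hβ, hT]⟩
  -- A lower level would have fewer than `d` elements, yet `up` embeds `lev B d.ord` into it.
  by_contra hn
  have hinj : ∀ x ∈ lev B d.ord, ∀ y ∈ lev B d.ord, h.up x = h.up y → x = y := fun x hx y hy hxy =>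
    (h.d0_up d0_eq (w := ![x, y]) (by simp [Fin.forall_fin_succ, hx, hy])).2 hxy
  have hle : #(lev B d.ord) ≤ #(lev A β) := by
    refine mk_le_of_injective (f := fun x => ⟨h.up x.1, ?_⟩) ?_
    · rw [← hβ]
      obtain ⟨k, hk, -⟩ := h.exists_up_eq x.2 h.gA.1
      exact (hT _).2 ⟨_, hk⟩
    · intro x y hxy
      exact Subtype.ext (hinj _ x.2 _ y.2 (Subtype.ext_iff.1 hxy))
  rw [ZFSet.cardinalMk_coe_sort, ZFSet.cardinalMk_coe_sort, Cardinal.lift_le] at hle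
  exact absurd ((le_card_lev B le_rfl).trans hle) (not_le.2 (card_lev_lt A h.uncd (not_le.1 hn)))

end Emb

open ZFSet (pair)
open Filter

/-! ### Bad substructures -/

variable {A B x y M X : ZFSet.{u}} {c d : Cardinal.{u}} {j : ZFSet.{u} → ZFSet.{u}}

/-- `X` is a proper, cofinal, closed subset of `M`. -/
def IsBad (A M X : ZFSet.{u}) : Prop :=
  X ⊆ M ∧ (∃ e ∈ X, e = ∅) ∧ (∀ i, ∀ x ∈ X, ∀ y ∈ X, ∃ w ∈ X, IsCut A M i x y w) ∧
  (∀ x ∈ X, x = ∅ ∨ ∃ z ∈ x, z ∈ X) ∧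
  (∀ x ∈ X, ∃ K ∈ X, ∃ i ∈ X, ∃ S ∈ X, ∃ r ∈ X, IsSeq A K ∧
    (∃ q ∈ K, ∃ b o, q = pair b o ∧ b = i ∧ o = pair S r) ∧ x ∈ S) ∧
  (∃ m ∈ M, m ∉ X) ∧ ∀ y ∈ M, ∃ x ∈ X, x ∉ y

theorem D0.isBad {n : ℕ} {t s : (Fin n → ZFSet.{u}) → ZFSet.{u}} (ht : IsVar t) (hs : IsVar s) :
    D0 (fun A e => IsBad A (t e) (s e)) := by
  refine D0.comp2 (P := IsBad) ?_ ht hs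
  unfold IsBad
  refine D0.and (D0.sub (IsVar.mk _) (IsVar.mk _)) (D0.and ?_ (D0.and (D0.allFin fun i => ?_)
    (D0.and ?_ (D0.and ?_ (D0.and ?_ ?_)))))
  all_goals apply_rules [D0.isEmpty, D0.isCut, D0.isSeq, D0.opair, D0.expair, D0.ball, D0.bex,
    D0.and, D0.or, D0.neg, D0.eq, D0.mem, IsVar.mk]

theorem IsBad.cl (hc' : ℵ₀ < c) (hX : IsBad A (lev A c.ord) X) : Cl A X := by
  obtain ⟨hsub, ⟨_, h0, rfl⟩, hcut, hmeet, hseq, -, -⟩ := hX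
  have hg := gClosed_lev (A := A) (isSuccLimit_ord hc'.le)
  refine ⟨⟨h0, fun i x hx y hy => ?_⟩, fun x hx hne => ?_, fun x hx => ?_⟩
  · obtain ⟨w, hw, hw'⟩ := hcut i x hx y hy
    rw [hg.isCut_iff (isTransitive_lev A _) (hsub hx) (hsub hy)] at hw'
    exact hw' ▸ hw
  · refine (hmeet x hx).resolve_left ?_
    rintro rfl
    exact absurd hne (by simp)
  · obtain ⟨K, hK, i, hi, S, hS, r, hr, h1, ⟨q, hq, b, o, rfl, rfl, rfl⟩, h2⟩ := hseq x hx
    exact ⟨K, hK, b, hi, S, hS, r, hr, h1, hq, h2⟩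

/-- The embedding inverts the collapse of `X`; it is cofinal because `X` has elements outside any
given level, and levels in `X` around them. -/
theorem IsBad.exists_emb (hc : c.IsRegular) (hc' : ℵ₀ < c) (hd : d.IsRegular) (hcd : c < d)
    (hA : A ⊆ lev A c.ord) (hX : IsBad A (lev A c.ord) X) :
    ∃ B j, Emb A B c d j ∧ ∀ x ∈ lev B c.ord, j x ∈ X := by
  have hcl := hX.cl hc'
  obtain ⟨hsub, -, -, -, -, -, hunb⟩ := hX
  have hlim := isSuccLimit_ord hc'.le
  have hmem : ∀ y, y ∈ Cl.colImage X X ↔ ∃ x ∈ X, Cl.col X x = y := by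
    intro y
    rw [Cl.mem_colImage]
    exact ⟨fun ⟨z, hz, _, h⟩ => ⟨z, hz, h⟩, fun ⟨z, hz, h⟩ => ⟨z, hz, hz, h⟩⟩
  obtain ⟨β, -, hβ⟩ := hcl.colImage_self_eq_lev
  have hcard : c ≤ X.card := by
    by_contra hn
    obtain ⟨γ, hγ, -, hXγ⟩ := (hier_lev A hc hc').exists_bound (not_le.1 hn) hsub
    obtain ⟨x, hx, hx'⟩ := hunb _ (lev_mem_lev hγ)
    exact hx' (hXγ hx)
  have hcard' : X.card ≤ (Cl.colImage X X).card := by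
    have : #X ≤ #(Cl.colImage X X) := by
      refine mk_le_of_injective (f := fun x => ⟨Cl.col X x.1, (hmem _).2 ⟨_, x.2, rfl⟩⟩) ?_
      intro x y hxy
      exact Subtype.ext (hcl.col_injOn _ x.2 _ y.2 (Subtype.ext_iff.1 hxy))
    rwa [ZFSet.cardinalMk_coe_sort, ZFSet.cardinalMk_coe_sort, Cardinal.lift_le] at this
  -- A greater height would put a level with at least `c` elements into the collapse, while elements
  -- of `X` have fewer than `c` elements. A smaller height is impossible since `X`, being unbounded,
  -- has at least `c` elements.
  have hβc : β = c.ord := by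
    refine le_antisymm ?_ ?_
    · by_contra hn
      have h1 : lev (Cl.colImage X A) c.ord ∈ Cl.colImage X X := hβ ▸ lev_mem_lev (not_le.1 hn)
      obtain ⟨x, hx, he⟩ := (hmem _).1 h1
      have h2 : c ≤ x.card := (le_card_lev _ le_rfl).trans (card_le_of_image (Cl.col X)
        fun y hy => by
          rw [← he] at hy
          obtain ⟨z, hz, -, hzy⟩ := (Cl.mem_col hx).1 hy
          exact ⟨z, hz, hzy⟩)
      have h3 : x.card < c := by
        obtain ⟨η, hη, hx'⟩ := (mem_lev_of_isSuccLimit hlim).1 (hsub hx)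
        exact (ZFSet.card_mono (isTransitive_lev A η _ hx')).trans_lt (card_lev_lt A hc' hη)
      exact absurd h2 (not_le.2 h3)
    · by_contra hn
      exact absurd (hcard.trans (hcard'.trans_eq (by rw [hβ])))
        (not_le.2 (card_lev_lt _ hc' (not_le.1 hn)))
  rw [hβc] at hβ
  have hj : ∀ y, ∃ x, y ∈ lev (Cl.colImage X A) c.ord → x ∈ X ∧ Cl.col X x = y := by
    intro y
    by_cases hy : y ∈ lev (Cl.colImage X A) c.ord
    · obtain ⟨x, hx, he⟩ := (hmem y).1 (hβ ▸ hy)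
      exact ⟨x, fun _ => ⟨hx, he⟩⟩
    · exact ⟨∅, fun h => absurd h hy⟩
  choose j hj using hj
  refine ⟨Cl.colImage X A, j, ⟨hc, hc', hd, hcd, hA, ?_, fun hx => hsub (hj _ hx).1,
    fun φ v hv => ?_, fun {a} ha => ?_⟩, fun x hx => (hj x hx).1⟩
  · rw [← hβ]
    intro y hy
    obtain ⟨x, hx, -, he⟩ := Cl.mem_colImage.1 hy
    exact (hmem y).2 ⟨x, hx, he⟩
  · rw [hcl.sat_col φ fun i => (hj _ (hv i)).1]
    simp only [fun i => (hj _ (hv i)).2]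
  · obtain ⟨η, hη, ha⟩ := (mem_lev_of_isSuccLimit hlim).1 ha
    obtain ⟨x, hx, hx'⟩ := hunb _ (lev_mem_lev hη)
    obtain ⟨ξ, hxξ, hξ⟩ := hcl.exists_lev hx
    have hle : η ≤ ξ := by
      by_contra hn
      exact hx' (lev_mono (not_le.1 hn).le hxξ)
    have h1 : Cl.col X (lev A ξ) ∈ lev (Cl.colImage X A) c.ord := hβ ▸ (hmem _).2 ⟨_, hξ, rfl⟩
    refine ⟨_, h1, ?_⟩
    rw [hcl.col_injOn _ (hj _ h1).1 _ hξ (hj _ h1).2]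
    exact lev_mono hle ha

theorem Emb.false_of_isBad (h : Emb A B c d j) {m : ZFSet.{u}} (hX : IsBad A (lev A c.ord) X)
    (hXd : X ∈ lev A d.ord) (hj : ∀ x ∈ lev B c.ord, j x ∈ X) (hmX : m ∉ X)
    (hmin : ∀ Y, IsBad A (lev A c.ord) Y → ∀ y ∈ lev A c.ord, y ∉ Y →
      pair m y ∈ levLe A c.ord) : False := by
  have hlim := isSuccLimit_ord h.unc.le
  have hN : lev B c.ord ∈ lev B d.ord := lev_mem_lev h.lt_ord
  obtain ⟨β, hβ, hT⟩ := h.exists_lev_eq_range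
  -- Constructed before `d.ord`, the bad set lies in the collapsed ultrapower and so is represented
  -- by a function at a seed.
  obtain ⟨⟨f, ⟨s, hs⟩⟩, rfl⟩ := (hT X).1 (lev_mono hβ hXd)
  have hbad := (h.los_up (m := 1) (n := 1) (Q := fun A v w => IsBad A (v 0) (w 0))
    (by apply_rules [D0.isBad, IsVar.mk]) hs (w := ![lev B c.ord]) (by simpa) ![f]).1
    (by simpa [h.up_lev] using hX)
  simp only [Matrix.cons_val] at hbad
  have hne := h.neBot (ha := hs)
  obtain ⟨t, ht⟩ := hbad.exists
  have hft : ∀ t, app f.1 t ∈ lev B d.ord := app_mem_lev (isSuccLimit_ord h.uncd.le) f.2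
  have hwo := wo_lev B c.ord
  -- The analogue of `m` on the side of `B`, with the bad sets restricted to `lev B d.ord`, the
  -- domain of `up`.
  obtain ⟨g, ⟨hg, Y, hY, hYbad, hgY⟩, hgmin⟩ := hwo.lwo.least
    {g | g ∈ lev B c.ord ∧ ∃ Y ∈ lev B d.ord, IsBad B (lev B c.ord) Y ∧ g ∉ Y} (by
      obtain ⟨g, hg, hg'⟩ := ht.2.2.2.2.2.1
      exact ⟨g, hg, _, hft t, ht, hg'⟩) fun g hg => hg.1
  have h1 : pair m (j g) ∈ levLe A c.ord := by
    refine hmin (h.up Y) ?_ _ (h.mem hg) ?_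
    · have := (h.d0_up (n := 2) (Q := fun A e => IsBad A (e 0) (e 1))
        (by apply_rules [D0.isBad, IsVar.mk]) (w := ![lev B c.ord, Y])
        (by simp [Fin.forall_fin_succ, hN, hY])).1 hYbad
      simpa [h.up_lev] using this
    · have := (h.d0_up (n := 2) (Q := fun _ e => e 0 ∉ e 1)
        (D0.neg (D0.mem (IsVar.mk _) (IsVar.mk _))) (w := ![g, Y])
        (by simp [Fin.forall_fin_succ, hY, h.mem_d hg])).1 hgY
      simpa [h.up_eq hg] using this
  -- The order of `lev B c.ord` is not an element of it, so the comparison is made in a level γ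
  -- containing g. By absoluteness of `IsSeq`, j carries this level and its order to some level δ of
  -- `A` and its order.
  obtain ⟨γ, hγ, hgγ⟩ := (mem_lev_of_isSuccLimit hlim).1 hg
  have hK := ((hier_lev B h.reg h.unc).seq_lp_mem (hlim.add_one_lt hγ)).1
  have hp : pair γ.toZFSet (pair (lev B γ) (levLe B γ)) ∈ seqOf (lp B) (γ + 1) :=
    pair_mem_seqOf.2 ⟨Order.lt_add_one_iff.2 le_rfl, rfl⟩
  have htr := isTransitive_lev B c.ord
  have hp1 := of_pair_mem htr (htr _ hK hp)
  have hp2 := of_pair_mem htr hp1.2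
  obtain ⟨hs1, q, hq, b, o, rfl, rfl, rfl⟩ := (h.d0 (n := 4) (Q := fun A e => IsSeq A (e 0) ∧
    ∃ q ∈ e 0, ∃ b o, q = pair b o ∧ b = e 1 ∧ o = pair (e 2) (e 3)) (by
      apply_rules [D0.isSeq, D0.opair, D0.and, D0.bex, D0.expair, D0.eq, IsVar.mk])
    (v := ![seqOf (lp B) (γ + 1), γ.toZFSet, lev B γ, levLe B γ])
    (by simp [Fin.forall_fin_succ, hK, hp1.1, hp2.1, hp2.2])).1
      ⟨isSeq_seqOf B _, _, hp, _, _, rfl, rfl, rfl⟩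
  obtain ⟨δ, hδ⟩ := hs1.eq_lp _ _ hq
  simp only [Matrix.cons_val, lp, ZFSet.pair_inj] at hδ
  have hgδ : j g ∈ lev A δ := hδ.1 ▸ (h.map_mem hg hp2.1).2 hgγ
  have hδc : δ ≤ c.ord := by
    by_contra hn
    have := hδ.1 ▸ h.mem hp2.1
    exact hn (lev_mem_lev_iff.1 this).le
  have h2 := (levOrder A c.ord).initial δ hδc m (j g) hgδ h1
  -- Łoś's theorem for the statement that everything at or below g, except g itself, lies in f(t).
  -- It holds whenever f(t) is bad, by minimality of g.
  have h3 := (h.los_up (m := 2) (n := 1) (Q := fun _ v w => ∀ t ∈ v 0, ∀ m b, t = pair m b →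
    b = v 1 → m = v 1 ∨ m ∈ w 0) (by
      apply_rules [D0.ball, D0.allpair, D0.imp, D0.or, D0.eq, D0.mem, IsVar.mk]) hs
    (w := ![levLe B γ, g]) (by simp [Fin.forall_fin_succ, h.mem_d hp2.2, h.mem_d hg]) ![f]).2 (by
      refine hbad.mono fun t ht => ?_
      rintro p hp m b rfl hb
      simp only [Matrix.cons_val] at hp hb ⊢
      subst hb
      by_contra hn
      push Not at hn
      have hm : m ∈ lev B c.ord := lev_mono hγ.le ((wo_lev B γ).left hp)
      exact hn.1 (hwo.lwo.anti m hm b hg (levLe_mono hγ.le hp)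
        (hgmin m ⟨hm, _, hft t, ht, hn.2⟩)))
  simp only [Matrix.cons_val, h.up_eq hg, h.up_eq hp2.2, hδ.2] at h3
  rcases h3 _ h2 m (j g) rfl rfl with h4 | h4
  · exact hmX (h4 ▸ hj g hg)
  · exact hmX h4

/-- The least element `m` omitted by any bad set is compared with its analogue after collapsing a
bad set that omits it. The hypothesis places that set in a level of regular height above `c`. -/
theorem not_isBad (hc : c.IsRegular) (hc' : ℵ₀ < c) (hA : A ⊆ lev A c.ord)
    (hV : ∀ X, IsBad A (lev A c.ord) X → ∃ d, d.IsRegular ∧ c < d ∧ X ∈ lev A d.ord) :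
    ¬ IsBad A (lev A c.ord) X := by
  intro hX
  obtain ⟨m, ⟨hm, Y, hY, hmY⟩, hmin⟩ := (wo_lev A c.ord).lwo.least
    {m | m ∈ lev A c.ord ∧ ∃ Y, IsBad A (lev A c.ord) Y ∧ m ∉ Y} (by
      obtain ⟨m, hm, hm'⟩ := hX.2.2.2.2.2.1
      exact ⟨m, hm, X, hX, hm'⟩) fun m hm => hm.1
  obtain ⟨d, hd, hcd, hYd⟩ := hV Y hY
  obtain ⟨B, j, h, hj⟩ := hY.exists_emb hc hc' hd hcd hA
  exact h.false_of_isBad hY hYd hj hmY fun Z hZ y hy hyZ => hmin y ⟨hy, Z, hZ, hyZ⟩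

open ZFSet (pair)

/-! ### Elementary embeddings -/

universe w

open FirstOrder FirstOrder.Language in
-- A definable relation that has witnesses for parameters in the range has witnesses in the range,
-- by elementarity for the existential closure of its formula.
theorem exists_of_elementaryEmbedding {A m : ZFSet.{u}} {N : Type w} [setPredLang.Structure N]
    (F : N ↪ₑ[setPredLang] PredModel A m) {n k : ℕ} {Q : (Fin (n + k) → ZFSet.{u}) → Prop}
    (hQ : IsDef A m Q) (v : Fin n → N)
    (h : ∃ y : Fin k → ZFSet.{u}, (∀ i, y i ∈ m) ∧ Q (Fin.append (fun i => (F (v i)).1) y)) :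
    ∃ y : Fin k → N, Q (Fin.append (fun i => (F (v i)).1) fun i => (F (y i)).1) := by
  obtain ⟨φ, hφ⟩ := Set.empty_definable_iff.1 hQ
  have hφ' : ∀ w : Fin (n + k) → PredModel A m, φ.Realize w ↔ Q (vals w) := fun w =>
    (Set.ext_iff.1 hφ w).symm
  have hφ'' : ∀ (a : Fin n → PredModel A m) (b : Fin k → PredModel A m),
      (φ.relabel finSumFinEquiv.symm).Realize (Sum.elim a b) ↔ Q (Fin.append (vals a) (vals b)) := by
    intro a b
    rw [Formula.realize_relabel, hφ']
    refine iff_of_eq (congrArg Q (funext fun i => ?_))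
    refine Fin.addCases (fun i => ?_) (fun i => ?_) i <;> simp [vals]
  have h1 := F.map_formula ((φ.relabel finSumFinEquiv.symm).iExs (Fin k)) v
  rw [Formula.realize_iExs, Formula.realize_iExs] at h1
  obtain ⟨y, hy, hQy⟩ := h
  obtain ⟨y, hy⟩ := h1.1 ⟨toModel A y hy, (hφ'' _ _).2 hQy⟩
  refine ⟨y, (hφ'' _ _).1 ?_⟩
  have := (F.map_formula (φ.relabel finSumFinEquiv.symm) (Sum.elim v y)).2 hy
  rwa [Sum.comp_elim] at this

theorem D0.isDef {A m : ZFSet.{u}} (hm : m.IsTransitive) (hm' : m.Nonempty) {n : ℕ}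
    {Q : ZFSet.{u} → (Fin n → ZFSet.{u}) → Prop} (hQ : D0 Q) : IsDef A m (Q A) := by
  obtain ⟨φ, hφ⟩ := hQ
  exact (IsDef.sat hm hm' φ).congr fun v _ => (hφ A v).symm

/-- The form in which cardinality κ of the substructure is used: its range is contained in no set
with fewer than κ elements. -/
theorem exists_notMem_of_injective {κ : Cardinal.{u}} {N : Type w} {f : N → ZFSet.{u}} (hf : Function.Injective f)
    (hN : lift.{u + 1} #N = lift.{max w (u + 1)} κ) (y : ZFSet.{u}) (hy : y.card < κ) :
    ∃ a, f a ∉ y := by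
  by_contra! hn
  have := lift_mk_le_lift_mk_of_injective (f := fun a => (⟨f a, hn a⟩ : y))
    fun a b hab => hf (Subtype.ext_iff.1 hab)
  rw [hN, ZFSet.cardinalMk_coe_sort, lift_lift, Cardinal.lift_le] at this
  exact absurd this (not_le.2 hy)

section
variable {A x : ZFSet.{u}} {κ : Cardinal.{u}} {N : Type w} [setPredLang.Structure N]

theorem nonempty_L (A : ZFSet.{u}) {ξ : Ordinal.{u}} (hξ : ξ ≠ 0) : (L A ξ).Nonempty :=
  ⟨_, L_mem_L (pos_of_ne_zero hξ)⟩

theorem finite_L_natCast (A : ZFSet.{u}) (n : ℕ) : (L A n : ZFSet.{u}).card < ℵ₀ := by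
  induction n with
  | zero => simpa [L_zero] using aleph0_pos
  | succ n ih =>
    have : L A ((n + 1 : ℕ) : Ordinal.{u}) ⊆ ZFSet.powerset (L A n) := by
      intro x hx
      obtain ⟨η, hη, hx⟩ := mem_L.1 hx
      rw [ZFSet.mem_powerset]
      refine hx.1.trans (L_mono ?_)
      rwa [Nat.cast_add_one, Order.lt_add_one_iff] at hη
    refine (ZFSet.card_mono this).trans_lt ?_
    rw [ZFSet.card_powerset]
    exact power_lt_aleph0 (by simp) ih

theorem finite_of_mem_L_omega0 (hx : x ∈ L A Ordinal.omega0) : x.card < ℵ₀ := by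
  obtain ⟨η, hη, hx⟩ := mem_L.1 hx
  obtain ⟨n, rfl⟩ := Ordinal.lt_omega0.1 hη
  exact (ZFSet.card_mono hx.1).trans_lt (finite_L_natCast A n)

theorem exists_enum (hx : x.card < ℵ₀) : ∃ (n : ℕ) (v : Fin n → ZFSet.{u}), ∀ y, y ∈ x ↔ ∃ i, v i = y := by
  have : Finite x := by
    rw [← lt_aleph0_iff_finite, ZFSet.cardinalMk_coe_sort]
    simpa using hx
  obtain ⟨n, ⟨e⟩⟩ := Finite.exists_equiv_fin x
  refine ⟨n, fun i => (e.symm i).1, fun y => ⟨fun hy => ⟨e ⟨y, hy⟩, by simp⟩, ?_⟩⟩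
  rintro ⟨i, rfl⟩
  exact (e.symm i).2

open FirstOrder FirstOrder.Language

/-- An element of L_ω[A] is finite and so is definable from its elements, which are in the range by
∈-induction. -/
theorem surjective_of_omega0 (F : N ↪ₑ[setPredLang] LModel A Ordinal.omega0) :
    ∀ x ∈ L A Ordinal.omega0, ∃ y, (F y).1 = x := by
  intro x
  have ht := isTransitive_L A Ordinal.omega0
  induction x using ZFSet.inductionOn with
  | h x ih =>
  intro hx
  obtain ⟨n, v, hv⟩ := exists_enum (finite_of_mem_L_omega0 hx)
  have hvx : ∀ i, v i ∈ x := fun i => (hv _).2 ⟨i, rfl⟩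
  choose w hw using fun i => ih (v i) (hvx i) (ht _ hx (hvx i))
  have hD : D0 (n := n + 1) fun _ e => (∀ z ∈ (Lst e : ZFSet.{u}), ∃ i : Fin n, z = e i.castSucc) ∧
      ∀ i : Fin n, e i.castSucc ∈ Lst e := by
    refine D0.and (D0.ball (IsVar.mk _) (D0.exFin fun i => D0.eq (IsVar.mk _) (IsVar.mk _)))
      (D0.allFin fun i => D0.mem (IsVar.mk _) (IsVar.mk _))
  have happ : ∀ (a : Fin n → ZFSet.{u}) (b : Fin 1 → ZFSet.{u}),
      (∀ i : Fin n, Fin.append a b i.castSucc = a i) ∧ Lst (Fin.append a b) = b 0 := fun a b =>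
    ⟨fun i => Fin.append_left a b i, Fin.append_right a b 0⟩
  obtain ⟨y, hy⟩ := exists_of_elementaryEmbedding F (k := 1) (hD.isDef (A := A) ht
    (nonempty_L A Ordinal.omega0_ne_zero)) w ⟨![x], by simpa, by
      simp only [happ, hw]
      refine ⟨fun z hz => ?_, fun i => hvx i⟩
      obtain ⟨i, rfl⟩ := (hv z).1 hz
      exact ⟨i, rfl⟩⟩
  simp only [happ, hw] at hy
  refine ⟨y 0, ?_⟩
  ext z
  rw [hv]
  constructor
  · intro hz
    obtain ⟨i, rfl⟩ := hy.1 z hz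
    exact ⟨i, rfl⟩
  · rintro ⟨i, rfl⟩
    exact hy.2 i

/-- Each closure condition says that certain elements of the model exist in a definable relation to
given ones, so the range inherits it. It is unbounded because elements of the model have fewer than
κ elements. -/
theorem isBad_of_elementaryEmbedding (hκ : κ.IsRegular) (hκ' : ℵ₀ < κ)
    (F : N ↪ₑ[setPredLang] LModel A κ.ord)
    (hN : ∀ y : ZFSet.{u}, y.card < κ → ∃ a, (F a).1 ∉ y) (hx : x ∈ L A κ.ord)
    (hx' : ∀ y, (F y).1 ≠ x) :
    IsBad A (lev A κ.ord) (ZFSet.sep (fun z => ∃ a, (F a).1 = z) (lev A κ.ord)) := by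
  have heq := lev_eq_L A hκ hκ'
  have ht : (lev A κ.ord).IsTransitive := isTransitive_lev A _
  have hcl := cl_lev A hκ hκ'
  have hlim := isSuccLimit_ord hκ'.le
  have hne : (lev A κ.ord).Nonempty := ⟨∅, hcl.gClosed.1⟩
  have hmem : ∀ {z}, z ∈ ZFSet.sep (fun z => ∃ a, (F a).1 = z) (lev A κ.ord) ↔ ∃ a, (F a).1 = z := by
    intro z
    rw [ZFSet.mem_sep, and_iff_right_iff_imp]
    rintro ⟨a, rfl⟩
    rw [heq]; exact (F a).2
  have hFM : ∀ a, (F a).1 ∈ lev A κ.ord := fun a => by rw [heq]; exact (F a).2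
  have key : ∀ {n k : ℕ} {Q : (Fin (n + k) → ZFSet.{u}) → Prop}, IsDef A (lev A κ.ord) Q → ∀ v : Fin n → N,
      (∃ y : Fin k → ZFSet.{u}, (∀ i, y i ∈ lev A κ.ord) ∧ Q (Fin.append (fun i => (F (v i)).1) y)) →
      ∃ y : Fin k → N, Q (Fin.append (fun i => (F (v i)).1) fun i => (F (y i)).1) := by
    rw [heq]
    exact fun hQ v => exists_of_elementaryEmbedding F hQ v
  have a1 : ∀ (a : Fin 1 → ZFSet.{u}) (b : Fin 1 → ZFSet.{u}), Fin.append a b = ![a 0, b 0] := by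
    intro a b; funext i; fin_cases i <;> rfl
  have a2 : ∀ (a : Fin 2 → ZFSet.{u}) (b : Fin 1 → ZFSet.{u}),
      Fin.append a b = ![a 0, a 1, b 0] := by
    intro a b; funext i; fin_cases i <;> rfl
  have a4 : ∀ (a : Fin 1 → ZFSet.{u}) (b : Fin 4 → ZFSet.{u}),
      Fin.append a b = ![a 0, b 0, b 1, b 2, b 3] := by
    intro a b; funext i; fin_cases i <;> rfl
  refine ⟨fun z hz => (ZFSet.mem_sep.1 hz).1, ⟨∅, hmem.2 ?_, rfl⟩, ?_, ?_, ?_,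
    ⟨x, by rwa [heq], fun h => (hmem.1 h).elim hx'⟩, ?_⟩
  · obtain ⟨y, hy⟩ := key (n := 0) (k := 1) (Q := fun e => e 0 = ∅)
      ((D0.isEmpty (IsVar.mk 0)).isDef ht hne) Fin.elim0 ⟨![∅], by simpa using hcl.gClosed.1, rfl⟩
    exact ⟨y 0, hy⟩
  · intro i x hx y hy
    obtain ⟨a, rfl⟩ := hmem.1 hx
    obtain ⟨b, rfl⟩ := hmem.1 hy
    have h1 : D0 (n := 3) fun A e => ∀ z ∈ e 2, GMem i A z (e 0) (e 1) := by
      apply_rules [D0.gmem, D0.ball, IsVar.mk]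
    have h2 : D0 (n := 4) fun A e => GMem i A (e 3) (e 0) (e 1) ∧ e 3 ∉ e 2 := by
      apply_rules [D0.gmem, D0.and, D0.neg, D0.mem, IsVar.mk]
    -- The value of an operation is described over the model: all its elements satisfy the defining
    -- condition, and no element of the model that satisfies it is missing.
    have h3 := (h1.isDef (A := A) ht hne).diff (h2.isDef (A := A) ht hne).ex
    obtain ⟨w, hw1, hw2⟩ := key (n := 2) (k := 1) h3 ![a, b] ⟨![G A i (F a).1 (F b).1], by
      simpa using hcl.gClosed.2 i _ (hFM a) _ (hFM b), by
        rw [a2]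
        refine ⟨fun z hz => mem_G.1 hz, ?_⟩
        rintro ⟨z, -, hz, hz'⟩
        exact hz' (mem_G.2 hz)⟩
    rw [a2] at hw1 hw2
    refine ⟨(F (w 0)).1, hmem.2 ⟨_, rfl⟩, ?_, ?_⟩
    · exact fun z hz => ⟨ht _ (hFM _) hz, hw1 z hz⟩
    · intro z hz hz'
      by_contra hn
      exact hw2 ⟨z, hz, hz', hn⟩
  · intro x hx
    obtain ⟨a, rfl⟩ := hmem.1 hx
    rcases (F a).1.eq_empty_or_nonempty with h | ⟨z, hz⟩
    · exact .inl h
    · obtain ⟨y, hy⟩ := key (n := 1) (k := 1) ((D0.mem (IsVar.mk 1) (IsVar.mk 0)).isDef (A := A) ht hne)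
        ![a] ⟨![z], by simpa using ht _ (hFM a) hz, by rw [a1]; exact hz⟩
      rw [a1] at hy
      exact .inr ⟨_, hy, hmem.2 ⟨_, rfl⟩⟩
  · intro x hx
    obtain ⟨a, rfl⟩ := hmem.1 hx
    obtain ⟨K, hK, i, hi, S, hS, r, hr, h1, h2, h3⟩ := hcl.seq _ (hFM a)
    have hD : D0 (n := 5) fun A e => IsSeq A (e 1) ∧
        (∃ q ∈ e 1, ∃ b o, q = pair b o ∧ b = e 2 ∧ o = pair (e 3) (e 4)) ∧ e 0 ∈ e 3 := by
      apply_rules [D0.isSeq, D0.opair, D0.mem, D0.and, D0.bex, D0.expair, D0.eq, IsVar.mk]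
    obtain ⟨y, hy⟩ := key (n := 1) (k := 4) (hD.isDef (A := A) ht hne) ![a] ⟨![K, i, S, r], by
      simpa [Fin.forall_fin_succ] using ⟨hK, hi, hS, hr⟩, by
        rw [a4]
        exact ⟨h1, ⟨_, h2, _, _, rfl, rfl, rfl⟩, h3⟩⟩
    rw [a4] at hy
    exact ⟨_, hmem.2 ⟨y 0, rfl⟩, _, hmem.2 ⟨y 1, rfl⟩, _, hmem.2 ⟨y 2, rfl⟩, _, hmem.2 ⟨y 3, rfl⟩, hy⟩
  · intro y hy
    obtain ⟨η, hη, hy'⟩ := (mem_lev_of_isSuccLimit hlim).1 hy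
    obtain ⟨a, ha⟩ := hN y ((ZFSet.card_mono (isTransitive_lev A η _ hy')).trans_lt
      (card_lev_lt A hκ' hη))
    exact ⟨_, hmem.2 ⟨a, rfl⟩, ha⟩

theorem surjective_elementaryEmbedding (hκ : κ.IsRegular) (hA : A ⊆ κ.ord.toZFSet)
    (hV : UniverseEqL A) (F : N ↪ₑ[setPredLang] LModel A κ.ord)
    (hN : ∀ y : ZFSet.{u}, y.card < κ → ∃ a, (F a).1 ∉ y) (hx : x ∈ L A κ.ord) :
    ∃ y, (F y).1 = x := by
  rcases hκ.aleph0_le.eq_or_lt with rfl | hκ'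
  · revert F
    rw [ord_aleph0] at hx ⊢
    exact fun F _ => surjective_of_omega0 F x hx
  · by_contra hn
    push Not at hn
    refine not_isBad hκ hκ' (fun z hz => ?_) (fun X hX => ?_)
      (isBad_of_elementaryEmbedding hκ hκ' F hN hx hn)
    · obtain ⟨η, hη, rfl⟩ := Ordinal.mem_toZFSet_iff.1 (hA hz)
      exact (hier_lev A hκ hκ').toZFSet_mem hη
    · obtain ⟨ξ, hξ⟩ := hV X
      have hle : ℵ₀ ≤ max κ ξ.card := hκ.aleph0_le.trans (le_max_left _ _)
      -- The successor of the maximum of κ and |ξ| is a regular cardinal above both κ and ξ.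
      have hd := isRegular_succ hle
      have hlt := Order.lt_succ (max κ ξ.card)
      refine ⟨_, hd, (le_max_left _ _).trans_lt hlt, ?_⟩
      rw [lev_eq_L A hd (hle.trans_lt hlt)]
      exact L_mono (lt_ord.2 ((le_max_right _ _).trans_lt hlt)).le hξ

theorem card_L_ord (A : ZFSet.{u}) (hκ : κ.IsRegular) : (L A κ.ord).card = κ := by
  refine le_antisymm ?_ ?_
  · rcases hκ.aleph0_le.eq_or_lt with rfl | hκ'
    · have : L A (ℵ₀ : Cardinal.{u}).ord ⊆ ZFSet.iUnion fun η : Set.Iio (ℵ₀ : Cardinal.{u}).ord =>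
          L A η.1 := by
        intro x hx
        rw [ZFSet.mem_iUnion]
        obtain ⟨η, hη, hx⟩ := (mem_L_of_isSuccLimit (isSuccLimit_ord le_rfl)).1 hx
        exact ⟨⟨η, hη⟩, hx⟩
      refine (ZFSet.card_mono this).trans (card_iUnion_iio_le le_rfl (by simp) (L A) fun η hη => ?_)
      rw [ord_aleph0] at hη
      obtain ⟨n, rfl⟩ := Ordinal.lt_omega0.1 hη
      exact (finite_L_natCast A n).le
    · rw [← lev_eq_L A hκ hκ']
      exact card_lev_le A hκ'.le (by simp)
  · have hinj : Function.Injective (L A) := by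
      intro η ξ h
      rcases lt_trichotomy η ξ with h' | h' | h'
      · exact absurd (h ▸ L_mem_L h') (ZFSet.mem_irrefl _)
      · exact h'
      · exact absurd (h ▸ L_mem_L h') (ZFSet.mem_irrefl _)
    have hle : lift.{u + 1} κ ≤ #(L A κ.ord) := by
      have := mk_le_of_injective (α := Set.Iio κ.ord) (β := L A κ.ord)
        (f := fun η => ⟨L A η.1, L_mem_L η.2⟩) fun a b hab =>
          Subtype.ext (hinj (Subtype.ext_iff.1 hab))
      rwa [mk_Iio_ordinal, card_ord] at this
    rwa [ZFSet.cardinalMk_coe_sort, Cardinal.lift_le] at hle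

end

/-! ### Countability of the language and the main theorem -/

instance : Countable setPredLang.Symbols := by
  have h1 : ∀ n, Countable (SetPredRel n) := fun n => by
    have : Subsingleton (SetPredRel n) := ⟨fun a b => by cases a <;> cases b <;> rfl⟩
    infer_instance
  have h2 : Countable (Σ n, setPredLang.Relations n) := by
    have : ∀ n, Countable (setPredLang.Relations n) := h1
    infer_instance
  have h3 : Countable (Σ n, setPredLang.Functions n) := by
    have : ∀ n, IsEmpty (setPredLang.Functions n) := fun n => inferInstanceAs (IsEmpty Empty)
    infer_instance
  exact inferInstanceAs (Countable ((Σ n, setPredLang.Functions n) ⊕ Σ n, setPredLang.Relations n))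

end RelConstr

theorem mainTheorem3 (κ : Cardinal.{u}) (hκ : κ.IsRegular)
    (A : ZFSet.{u}) (hA : A ⊆ κ.ord.toZFSet)
    (hV : RelConstr.UniverseEqL A) :
    ZFSet.card (RelConstr.L A κ.ord) = κ ∧
      IsJonssonAlgebra RelConstr.setPredLang (RelConstr.LModel A κ.ord) ∧
      ¬ IsJonssonCardinal κ := by
  have hcard := RelConstr.card_L_ord A hκ
  have hmk : #(RelConstr.LModel A κ.ord) = lift.{u + 1} κ := by
    exact ZFSet.cardinalMk_coe_sort.trans (congrArg _ hcard)
  refine ⟨hcard, fun X hX => ?_, fun hJ => ?_⟩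
  · refine SetLike.ext fun x => iff_of_true ?_ trivial
    obtain ⟨y, hy⟩ := RelConstr.surjective_elementaryEmbedding hκ hA hV X.subtype
      (RelConstr.exists_notMem_of_injective (κ := κ)
        (fun a b hab => Subtype.ext (Subtype.ext hab)) (by rw [hX, hmk, lift_lift])) x.2
    exact (Subtype.ext hy : (y : RelConstr.LModel A κ.ord) = x) ▸ y.2
  -- The structure is copied to κ along a bijection; a substructure of the copy embeds elementarily
  -- in L_κ[A], and surjectivity of that embedding makes the substructure everything.
  · obtain ⟨e⟩ : Nonempty (RelConstr.LModel A κ.ord ≃ κ.ord.ToType) := by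
      rw [← lift_mk_eq'.{u + 1, u}, hmk]
      simp
    let := e.inducedStructure (L := RelConstr.setPredLang)
    obtain ⟨X, hX, hne⟩ := hJ RelConstr.setPredLang
    refine hne (SetLike.ext fun x => iff_of_true ?_ trivial)
    let F := (e.inducedStructureEquiv (L := RelConstr.setPredLang)).symm.toElementaryEmbedding.comp
      X.subtype
    have hF : ∀ a, F a = e.symm a := fun a => rfl
    obtain ⟨y, hy⟩ := RelConstr.surjective_elementaryEmbedding hκ hA hV F
      (RelConstr.exists_notMem_of_injective (κ := κ)
        (fun a b hab => Subtype.ext (e.symm.injective (Subtype.ext hab))) (by rw [hX])) (e.symm x).2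
    have : e.symm y = e.symm x := Subtype.ext hy
    exact e.symm.injective this ▸ y.2
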